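/- Let $M$ be a smooth manifold and let $(\mathcal G,\gamma)$ be an $S^1$-bundle gerbe with connection over $M$: a surjective submersion $\pi:X\to M$, a central $S^1$-extension of Lie groupoids $P\rightrightarrows X$ of the submersion groupoid $X\times_M X\rightrightarrows X$ (source $s$, target $t$, unit map $\epsilon$, inversion $i$; $g\cdot h$ is defined when $s(g)=t(h)$; $P\to X\times_M X$ is a principal $S^1$-bundle with $(zp)\cdot(wq)=(zw)(p\cdot q)$), and a connection $1$-form $\gamma\in\Omega^1(P)$ that is multiplicative, $m^*\gamma=\mathrm{pr}_1^*\gamma+\mathrm{pr}_2^*\gamma$ on $P\times_XP$. For a form $\alpha$ on $X$ put $\delta\alpha=s^*\alpha-t^*\alpha$. A curving for $\gamma$ is a form $B\in\Omega^2(X)$ with $\delta B=d\gamma$. A multiplicative vector field on $P\rightrightarrows X$ is a pair $(\mathbf x,\mathbf p)\in\mathfrak X(X)\times\mathfrak X(P)$ which is a functor from $P\rightrightarrows X$ to its tangent groupoid; let $\mathbb X(\mathbf P)_0$ be the space of these. Let $A_P=\ker ds|_X$ be the Lie algebroid of $P\rightrightarrows X$. For $a\in\Gamma(A_P)$ let $\overrightarrow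 a(g)=dR_g(a(t(g)))$, $\overleftarrow a(g)=d(L_g\circ i)(a(s(g)))$, $\mathbf a=dt(a)\in\mathfrak X(X)$, $\overline{\mathbf a}=\overrightarrow a+\overleftarrow a\in\mathfrak X(P)$ and $\mathsf v_a=\epsilon^*\iota_{\overrightarrow a}\gamma\in C^\infty(X)$. Then $\gamma$ admits a curving, and the $2$-term complex $$\Gamma(A_P)\longrightarrow\{(\mathbf x,\mathbf p,\alpha)\in\mathbb X(\mathbf P)_0\times\Omega^1(X)\mid L_{\mathbf p}\gamma=\delta\alpha\},\qquad \mathsf d a=(\mathbf a,\overline{\mathbf a},\iota_{\mathbf a}B-d\mathsf v_a),$$ where $B$ is any curving for $\gamma$ (the differential does not depend on the choice of $B$), is a strict Lie $2$-algebra $\mathbb X(\mathcal G,\gamma)$, i.e. a $2$-term $L_\infty$-algebra over $\mathbb R$ with zero Jacobiator, with the brackets $$[(\mathbf x,\mathbf p,\alpha),(\mathbf z,\mathbf r,\beta)]=([\mathbf x,\mathbf z],[\mathbf p,\mathbf r],L_{\mathbf x}\beta-L_{\mathbf z}\alpha)$$ in degree $0$ and $$[(\mathbf x,\mathbf p,\alpha),a]=-[a,(\mathbf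 x,\mathbf p,\alpha)]=[\mathbf p,\overrightarrow a]\big|_X$$ in mixed degrees. In particular, the differential and the brackets take values in the stated spaces. -/

import Mathlib

open scoped Manifold ContDiff Topology
open Set

noncomputable section

namespace Gerbe

/-! ### Vector fields and differential forms on a manifold

`M` is a boundaryless manifold modelled on the normed space `E`; the tangent space at every point
is (as a type) a copy of `E`. -/

section Forms

variable {E : Type*} [NormedAddCommGroup E] [NormedSpace ℝ E]
  {M : Type*} [TopologicalSpace M] [ChartedSpace E M]
  {E' : Type*} [NormedAddCommGroup E'] [NormedSpace ℝ E']
  {N : Type*} [TopologicalSpace N] [ChartedSpace E' N]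

variable (E M) in
/-- Not necessarily smooth differential `k`-forms on `M`. -/
abbrev RawForm (k : ℕ) : Type _ := Π x : M, TangentSpace 𝓘(ℝ, E) x [⋀^Fin k]→L[ℝ] ℝ

/-- The expression of the form `η` in the preferred chart at `x₀`: its pullback under the inverse
of that chart. -/
def chartRep {k : ℕ} (x₀ : M) (η : RawForm E M k) (y : E) : E [⋀^Fin k]→L[ℝ] ℝ :=
  (η ((extChartAt 𝓘(ℝ, E) x₀).symm y)).compContinuousLinearMap
    (mfderiv 𝓘(ℝ, E) 𝓘(ℝ, E) (extChartAt 𝓘(ℝ, E) x₀).symm y)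

theorem chartRep_add {k : ℕ} (x₀ : M) (η ζ : RawForm E M k) :
    chartRep x₀ (η + ζ) = chartRep x₀ η + chartRep x₀ ζ := rfl

theorem chartRep_smul {k : ℕ} (x₀ : M) (c : ℝ) (η : RawForm E M k) :
    chartRep x₀ (c • η) = c • chartRep x₀ η := rfl

variable (E M) in
/-- `Ω^k(M)`: the smooth differential `k`-forms, i.e. those whose expression in every chart of the
atlas is smooth. -/
def DiffForm (k : ℕ) : Submodule ℝ (RawForm E M k) where
  carrier := {η | ∀ x₀ : M, ContDiffOn ℝ ∞ (chartRep x₀ η) (extChartAt 𝓘(ℝ, E) x₀).target}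
  add_mem' {η ζ} hη hζ x₀ := by
    rw [chartRep_add]
    exact (hη x₀).add (hζ x₀)
  zero_mem' x₀ := by
    have : chartRep x₀ (0 : RawForm E M k) = 0 := rfl
    rw [this]
    exact contDiffOn_const
  smul_mem' c η hη x₀ := by
    rw [chartRep_smul]
    exact contDiffOn_const.smul (hη x₀)

/-- The exterior derivative, computed in the preferred chart at each point. -/
def extD {k : ℕ} (η : RawForm E M k) : RawForm E M (k + 1) := fun x =>
  (extDeriv (chartRep x η) (extChartAt 𝓘(ℝ, E) x x)).compContinuousLinearMap
    (mfderiv 𝓘(ℝ, E) 𝓘(ℝ, E) (extChartAt 𝓘(ℝ, E) x) x)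

/-- The pullback `f^*η`. -/
def pullbackForm {k : ℕ} (f : M → N) (η : RawForm E' N k) : RawForm E M k := fun x =>
  (η (f x)).compContinuousLinearMap (mfderiv 𝓘(ℝ, E) 𝓘(ℝ, E') f x)

/-- The interior product `ι_V η`, inserting `V` in the first slot. -/
def contract {k : ℕ} (V : Π x : M, TangentSpace 𝓘(ℝ, E) x) (η : RawForm E M (k + 1)) :
    RawForm E M k := fun x =>
  ContinuousAlternatingMap.curryLeft (E := E) (η x) (V x)

/-- The Lie derivative `L_V η = d ι_V η + ι_V dη` of a form of positive degree. -/
def lieD {k : ℕ} (V : Π x : M, TangentSpace 𝓘(ℝ, E) x) (η : RawForm E M (k + 1)) :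
    RawForm E M (k + 1) :=
  extD (contract V η) + contract V (extD η)

theorem contMDiff_along_add [IsManifold 𝓘(ℝ, E') ∞ N] {f : M → N}
    {V W : Π x : M, TangentSpace 𝓘(ℝ, E') (f x)}
    (hV : ContMDiff 𝓘(ℝ, E) (𝓘(ℝ, E').prod 𝓘(ℝ, E')) ∞
      (fun x => (⟨f x, V x⟩ : TangentBundle 𝓘(ℝ, E') N)))
    (hW : ContMDiff 𝓘(ℝ, E) (𝓘(ℝ, E').prod 𝓘(ℝ, E')) ∞
      (fun x => (⟨f x, W x⟩ : TangentBundle 𝓘(ℝ, E') N))) :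
    ContMDiff 𝓘(ℝ, E) (𝓘(ℝ, E').prod 𝓘(ℝ, E')) ∞
      (fun x => (⟨f x, V x + W x⟩ : TangentBundle 𝓘(ℝ, E') N)) := by
  intro x₀
  have h1 := (Bundle.contMDiffAt_totalSpace (F := E')).1 (hV x₀)
  have h2 := (Bundle.contMDiffAt_totalSpace (F := E')).1 (hW x₀)
  refine (Bundle.contMDiffAt_totalSpace (F := E')).2 ⟨h1.1, ?_⟩
  refine (h1.2.add h2.2).congr_of_eventuallyEq ?_
  have hb := h1.1.continuousAt.preimage_mem_nhds
    ((trivializationAt E' (TangentSpace 𝓘(ℝ, E')) (f x₀)).open_baseSet.mem_nhds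
      (mem_baseSet_trivializationAt E' (TangentSpace 𝓘(ℝ, E')) (f x₀)))
  filter_upwards [hb] with x hx
  exact ((trivializationAt E' (TangentSpace 𝓘(ℝ, E')) (f x₀)).linear ℝ hx).1 (V x) (W x)

theorem contMDiff_along_smul [IsManifold 𝓘(ℝ, E') ∞ N] {f : M → N} (c : ℝ)
    {V : Π x : M, TangentSpace 𝓘(ℝ, E') (f x)}
    (hV : ContMDiff 𝓘(ℝ, E) (𝓘(ℝ, E').prod 𝓘(ℝ, E')) ∞
      (fun x => (⟨f x, V x⟩ : TangentBundle 𝓘(ℝ, E') N))) :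
    ContMDiff 𝓘(ℝ, E) (𝓘(ℝ, E').prod 𝓘(ℝ, E')) ∞
      (fun x => (⟨f x, c • V x⟩ : TangentBundle 𝓘(ℝ, E') N)) := by
  intro x₀
  have h1 := (Bundle.contMDiffAt_totalSpace (F := E')).1 (hV x₀)
  refine (Bundle.contMDiffAt_totalSpace (F := E')).2 ⟨h1.1, ?_⟩
  refine ((contMDiffAt_const (I := 𝓘(ℝ, E)) (I' := 𝓘(ℝ, ℝ)) (c := c)).smul h1.2).congr_of_eventuallyEq ?_
  have hb := h1.1.continuousAt.preimage_mem_nhds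
    ((trivializationAt E' (TangentSpace 𝓘(ℝ, E')) (f x₀)).open_baseSet.mem_nhds
      (mem_baseSet_trivializationAt E' (TangentSpace 𝓘(ℝ, E')) (f x₀)))
  filter_upwards [hb] with x hx
  exact ((trivializationAt E' (TangentSpace 𝓘(ℝ, E')) (f x₀)).linear ℝ hx).2 c (V x)

variable (E M) in
/-- `𝔛(M)`: the smooth vector fields on `M`. -/
def VectorField [IsManifold 𝓘(ℝ, E) ∞ M] : Submodule ℝ (Π x : M, TangentSpace 𝓘(ℝ, E) x) where
  carrier := {V | ContMDiff 𝓘(ℝ, E) (𝓘(ℝ, E).prod 𝓘(ℝ, E)) ∞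
    (fun x => (⟨x, V x⟩ : TangentBundle 𝓘(ℝ, E) M))}
  add_mem' hV hW := ContMDiff.add_section (V := (TangentSpace 𝓘(ℝ, E) : M → Type _)) hV hW
  zero_mem' := Bundle.contMDiff_zeroSection (IB := 𝓘(ℝ, E)) (F := E) (n := ∞) ℝ
    (TangentSpace 𝓘(ℝ, E) : M → Type _)
  smul_mem' _ _ hV := ContMDiff.const_smul_section (V := (TangentSpace 𝓘(ℝ, E) : M → Type _)) hV

theorem contract_add {k : ℕ} (V W : Π x : M, TangentSpace 𝓘(ℝ, E) x) (η : RawForm E M (k + 1)) :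
    contract (V + W) η = contract V η + contract W η := by
  funext x
  exact map_add (ContinuousAlternatingMap.curryLeft (E := E) (η x)) (V x) (W x)

theorem contract_smul {k : ℕ} (c : ℝ) (V : Π x : M, TangentSpace 𝓘(ℝ, E) x)
    (η : RawForm E M (k + 1)) : contract (c • V) η = c • contract V η := by
  funext x
  exact map_smul (ContinuousAlternatingMap.curryLeft (E := E) (η x)) c (V x)

/-- In the preferred chart at `x₀`, the interior product of a smooth form with a smooth vector
field is differentiable at `x₀`. -/
theorem differentiableAt_chartRep_contract [IsManifold 𝓘(ℝ, E) ∞ M] [CompleteSpace E] {k : ℕ}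
    {V : Π x : M, TangentSpace 𝓘(ℝ, E) x} (hV : V ∈ VectorField E M)
    {η : RawForm E M (k + 1)} (hη : η ∈ DiffForm E M (k + 1)) (x₀ : M) :
    DifferentiableAt ℝ (chartRep x₀ (contract V η)) (extChartAt 𝓘(ℝ, E) x₀ x₀) := by
  have hnhds : (extChartAt 𝓘(ℝ, E) x₀).target ∈ 𝓝 (extChartAt 𝓘(ℝ, E) x₀ x₀) :=
    extChartAt_target_mem_nhds x₀
  set W : E → E := VectorField.mpullbackWithin 𝓘(ℝ, E) 𝓘(ℝ, E) (extChartAt 𝓘(ℝ, E) x₀).symm V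
    (range 𝓘(ℝ, E)) with hW
  have hWd : DifferentiableAt ℝ W (extChartAt 𝓘(ℝ, E) x₀ x₀) := by
    have h := VectorField.contMDiffWithinAt_mpullbackWithin_extChartAt_symm (I := 𝓘(ℝ, E))
      (V := V) (s := univ) (x := x₀) (m := 1) (n := ∞)
      ((hV.of_le (by norm_cast)) x₀).contMDiffWithinAt uniqueMDiffOn_univ
      (mem_univ _) (by norm_cast)
    have h2 := contMDiffWithinAt_vectorSpace_iff_contDiffWithinAt.1 h
    simp only [preimage_univ, inter_univ] at h2
    exact (h2.contDiffAt hnhds).differentiableAt (by simp)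
  have hηd : DifferentiableAt ℝ (chartRep x₀ η) (extChartAt 𝓘(ℝ, E) x₀ x₀) :=
    ((hη x₀).contDiffAt hnhds).differentiableAt (by simp)
  have hcl : DifferentiableAt ℝ (fun y => (chartRep x₀ η y).curryLeft (W y))
      (extChartAt 𝓘(ℝ, E) x₀ x₀) := by
    have hL : ContDiff ℝ 1 (fun f : E [⋀^Fin (k + 1)]→L[ℝ] ℝ => f.curryLeft) := by
      apply IsBoundedLinearMap.contDiff
      exact ⟨⟨fun _ _ => rfl, fun _ _ => rfl⟩, 1, one_pos, fun f => by simp⟩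
    have : DifferentiableAt ℝ (fun y => (chartRep x₀ η y).curryLeft)
        (extChartAt 𝓘(ℝ, E) x₀ x₀) :=
      (hL.differentiable (by simp)).differentiableAt.comp _ hηd
    exact this.clm_apply hWd
  refine hcl.congr_of_eventuallyEq ?_
  filter_upwards [hnhds] with y hy
  have hinv : (mfderiv 𝓘(ℝ, E) 𝓘(ℝ, E) (extChartAt 𝓘(ℝ, E) x₀).symm y).IsInvertible := by
    have := isInvertible_mfderivWithin_extChartAt_symm (I := 𝓘(ℝ, E)) (x := x₀) hy
    simpa using this
  have hAW : (mfderiv 𝓘(ℝ, E) 𝓘(ℝ, E) (extChartAt 𝓘(ℝ, E) x₀).symm y) (W y) =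
      V ((extChartAt 𝓘(ℝ, E) x₀).symm y) := by
    have h1 : W y = (mfderiv 𝓘(ℝ, E) 𝓘(ℝ, E) (extChartAt 𝓘(ℝ, E) x₀).symm y).inverse
        (V ((extChartAt 𝓘(ℝ, E) x₀).symm y)) := by
      rw [hW, VectorField.mpullbackWithin_apply, modelWithCornersSelf_coe, range_id,
        mfderivWithin_univ]
    rw [h1]
    exact hinv.self_apply_inverse _
  ext v
  change η _ (Fin.cons (V ((extChartAt 𝓘(ℝ, E) x₀).symm y)) _) = η _ _
  congr 1
  funext i
  refine Fin.cases ?_ (fun j => ?_) i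
  · exact hAW.symm
  · rfl

theorem lieD_add [IsManifold 𝓘(ℝ, E) ∞ M] [CompleteSpace E] {k : ℕ}
    {V W : Π x : M, TangentSpace 𝓘(ℝ, E) x} (hV : V ∈ VectorField E M) (hW : W ∈ VectorField E M)
    {η : RawForm E M (k + 1)} (hη : η ∈ DiffForm E M (k + 1)) :
    lieD (V + W) η = lieD V η + lieD W η := by
  have h : extD (contract (V + W) η) = extD (contract V η) + extD (contract W η) := by
    funext x
    simp only [extD, contract_add, chartRep_add, Pi.add_apply]
    rw [extDeriv_add (differentiableAt_chartRep_contract hV hη x)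
      (differentiableAt_chartRep_contract hW hη x)]
    rfl
  rw [lieD, h, contract_add, lieD, lieD]
  abel

theorem lieD_smul {k : ℕ} (c : ℝ) (V : Π x : M, TangentSpace 𝓘(ℝ, E) x)
    (η : RawForm E M (k + 1)) : lieD (c • V) η = c • lieD V η := by
  have h : extD (contract (c • V) η) = c • extD (contract V η) := by
    funext x
    simp only [extD, contract_smul, chartRep_smul, Pi.smul_apply]
    rw [extDeriv_smul]
    rfl
  rw [lieD, h, contract_smul, lieD, smul_add]

end Forms

/-! ### Lie groupoids and multiplicative vector fields -/

section Groupoid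

variable (EX EP X P : Type*)
  [NormedAddCommGroup EX] [NormedSpace ℝ EX] [TopologicalSpace X] [ChartedSpace EX X]
  [NormedAddCommGroup EP] [NormedSpace ℝ EP] [TopologicalSpace P] [ChartedSpace EP P]

/-- A Lie groupoid `P ⇉ X`. An arrow `g` goes from `src g` to `tgt g`, and `mul g h` is the product
of `g` and `h` when `src g = tgt h`; the values of `mul` on non-composable pairs are irrelevant.
The composable pairs form an embedded submanifold of `P × P`, and the smooth functions on it are
those that are smooth in the sense of `ContMDiffOn`. -/
structure LieGroupoid where
  src : P → X
  tgt : P → X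
  mul : P → P → P
  unit : X → P
  inv : P → P
  src_mul : ∀ g h, src g = tgt h → src (mul g h) = src h
  tgt_mul : ∀ g h, src g = tgt h → tgt (mul g h) = tgt g
  mul_assoc : ∀ g h k, src g = tgt h → src h = tgt k → mul (mul g h) k = mul g (mul h k)
  src_unit : ∀ x, src (unit x) = x
  tgt_unit : ∀ x, tgt (unit x) = x
  unit_mul : ∀ g, mul (unit (tgt g)) g = g
  mul_unit : ∀ g, mul g (unit (src g)) = g
  src_inv : ∀ g, src (inv g) = tgt g
  tgt_inv : ∀ g, tgt (inv g) = src g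
  mul_inv : ∀ g, mul g (inv g) = unit (tgt g)
  inv_mul : ∀ g, mul (inv g) g = unit (src g)
  isSubmersion_src : Manifold.IsSubmersion 𝓘(ℝ, EP) 𝓘(ℝ, EX) ∞ src
  isSubmersion_tgt : Manifold.IsSubmersion 𝓘(ℝ, EP) 𝓘(ℝ, EX) ∞ tgt
  contMDiff_unit : ContMDiff 𝓘(ℝ, EX) 𝓘(ℝ, EP) ∞ unit
  contMDiff_inv : ContMDiff 𝓘(ℝ, EP) 𝓘(ℝ, EP) ∞ inv
  contMDiffOn_mul : ContMDiffOn (𝓘(ℝ, EP).prod 𝓘(ℝ, EP)) 𝓘(ℝ, EP) ∞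
    (fun q : P × P => mul q.1 q.2) {q | src q.1 = tgt q.2}

namespace LieGroupoid

variable {EX EP X P}
variable (G : LieGroupoid EX EP X P)

/-- The product `dm (u, v)` of composable tangent vectors (those with `ds u = dt v`) in the tangent
groupoid. The set of composable pairs need not be a set of unique differentiability in `P × P`, but
all derivatives of `mul` within it agree on the pairs `(u, v)` with `ds u = dt v`, which are exactly
the vectors tangent to it. -/
def tangentMul (g h : P) (u : TangentSpace 𝓘(ℝ, EP) g) (v : TangentSpace 𝓘(ℝ, EP) h) :
    TangentSpace 𝓘(ℝ, EP) (G.mul g h) :=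
  mfderivWithin (𝓘(ℝ, EP).prod 𝓘(ℝ, EP)) 𝓘(ℝ, EP) (fun q : P × P => G.mul q.1 q.2)
    {q | G.src q.1 = G.tgt q.2} (g, h) ((u, v) : EP × EP)

theorem tangentMul_add (g h : P) (u u' : TangentSpace 𝓘(ℝ, EP) g)
    (v v' : TangentSpace 𝓘(ℝ, EP) h) :
    G.tangentMul g h (u + u') (v + v') = G.tangentMul g h u v + G.tangentMul g h u' v' :=
  map_add (mfderivWithin (𝓘(ℝ, EP).prod 𝓘(ℝ, EP)) 𝓘(ℝ, EP) (fun q : P × P => G.mul q.1 q.2)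
    {q | G.src q.1 = G.tgt q.2} (g, h)) ((u, v) : EP × EP) ((u', v') : EP × EP)

theorem tangentMul_smul (g h : P) (c : ℝ) (u : TangentSpace 𝓘(ℝ, EP) g)
    (v : TangentSpace 𝓘(ℝ, EP) h) :
    G.tangentMul g h (c • u) (c • v) = c • G.tangentMul g h u v :=
  map_smul (mfderivWithin (𝓘(ℝ, EP).prod 𝓘(ℝ, EP)) 𝓘(ℝ, EP) (fun q : P × P => G.mul q.1 q.2)
    {q | G.src q.1 = G.tgt q.2} (g, h)) c ((u, v) : EP × EP)

/-- The pair of (smooth) vector fields `(x, p)` on `X` and `P` is multiplicative: it is a functor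
from the groupoid to its tangent groupoid. -/
structure IsMultiplicative (x : Π a : X, TangentSpace 𝓘(ℝ, EX) a)
    (p : Π g : P, TangentSpace 𝓘(ℝ, EP) g) : Prop where
  src : ∀ g, mfderiv 𝓘(ℝ, EP) 𝓘(ℝ, EX) G.src g (p g) = x (G.src g)
  tgt : ∀ g, mfderiv 𝓘(ℝ, EP) 𝓘(ℝ, EX) G.tgt g (p g) = x (G.tgt g)
  unit : ∀ a, mfderiv 𝓘(ℝ, EX) 𝓘(ℝ, EP) G.unit a (x a) = p (G.unit a)
  mul : ∀ g h, G.src g = G.tgt h → p (G.mul g h) = G.tangentMul g h (p g) (p h)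

/-- `Γ(A)`: the smooth sections of the Lie algebroid `A = ker ds |_X`. -/
def algebroidSection [IsManifold 𝓘(ℝ, EP) ∞ P] :
    Submodule ℝ (Π x : X, TangentSpace 𝓘(ℝ, EP) (G.unit x)) where
  carrier := {a | ContMDiff 𝓘(ℝ, EX) (𝓘(ℝ, EP).prod 𝓘(ℝ, EP)) ∞
      (fun x => (⟨G.unit x, a x⟩ : TangentBundle 𝓘(ℝ, EP) P)) ∧
    ∀ x, mfderiv 𝓘(ℝ, EP) 𝓘(ℝ, EX) G.src (G.unit x) (a x) = 0}
  add_mem' {a b} ha hb := by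
    refine ⟨contMDiff_along_add ha.1 hb.1, fun x => ?_⟩
    rw [Pi.add_apply, map_add, ha.2, hb.2, add_zero]
  zero_mem' := by
    refine ⟨?_, fun x => map_zero _⟩
    exact (Bundle.contMDiff_zeroSection (IB := 𝓘(ℝ, EP)) (F := EP) (n := ∞) ℝ
      (TangentSpace 𝓘(ℝ, EP) : P → Type _)).comp G.contMDiff_unit
  smul_mem' c a ha := by
    refine ⟨contMDiff_along_smul c ha.1, fun x => ?_⟩
    rw [Pi.smul_apply, map_smul, ha.2, smul_zero]

variable (a : Π x : X, TangentSpace 𝓘(ℝ, EP) (G.unit x))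

/-- The vector field `𝐚 = dt(a)` on `X`. -/
def anchor : Π x : X, TangentSpace 𝓘(ℝ, EX) x := fun x =>
  (mfderiv 𝓘(ℝ, EP) 𝓘(ℝ, EX) G.tgt (G.unit x) (a x) : EX)

/-- The right-invariant vector field `g ↦ dR_g (a (t g))`, where `R_g` is right multiplication
by `g` on the source fibre `s⁻¹(t g)`. -/
def rightField : Π g : P, TangentSpace 𝓘(ℝ, EP) g := fun g =>
  (mfderivWithin 𝓘(ℝ, EP) 𝓘(ℝ, EP) (fun h => G.mul h g) {h | G.src h = G.tgt g}
    (G.unit (G.tgt g)) (a (G.tgt g)) : EP)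

/-- The left-invariant vector field `g ↦ d(L_g ∘ i) (a (s g))`, where `L_g ∘ i` is inversion
followed by left multiplication by `g`, on the source fibre `s⁻¹(s g)`. -/
def leftField : Π g : P, TangentSpace 𝓘(ℝ, EP) g := fun g =>
  (mfderivWithin 𝓘(ℝ, EP) 𝓘(ℝ, EP) (fun h => G.mul g (G.inv h)) {h | G.src h = G.src g}
    (G.unit (G.src g)) (a (G.src g)) : EP)

/-- The vector field `ā`, the sum of the right- and left-invariant vector fields of `a`. -/
def barField : Π g : P, TangentSpace 𝓘(ℝ, EP) g := G.rightField a + G.leftField a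

/-- The simplicial differential `δ = s^* - t^*` from forms on `X` to forms on `P`. -/
def delta {k : ℕ} (α : RawForm EX X k) : RawForm EP P k :=
  pullbackForm G.src α - pullbackForm G.tgt α

/-- A 1-form `γ` on `P` is multiplicative: `m^*γ = pr₁^*γ + pr₂^*γ` on the manifold of composable
pairs. -/
def IsMultiplicativeForm (γ : RawForm EP P 1) : Prop :=
  ∀ g h, G.src g = G.tgt h →
    ∀ (u : TangentSpace 𝓘(ℝ, EP) g) (v : TangentSpace 𝓘(ℝ, EP) h),
      (mfderiv 𝓘(ℝ, EP) 𝓘(ℝ, EX) G.src g u : EX) = mfderiv 𝓘(ℝ, EP) 𝓘(ℝ, EX) G.tgt h v →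
      γ (G.mul g h) (fun _ => G.tangentMul g h u v) = γ g (fun _ => u) + γ h (fun _ => v)

end LieGroupoid

end Groupoid

/-! ### Bundle gerbes with connection -/

section BundleGerbe

variable (EM EX EP M X P : Type*)
  [NormedAddCommGroup EM] [NormedSpace ℝ EM] [TopologicalSpace M] [ChartedSpace EM M]
  [NormedAddCommGroup EX] [NormedSpace ℝ EX] [TopologicalSpace X] [ChartedSpace EX X]
  [NormedAddCommGroup EP] [NormedSpace ℝ EP] [TopologicalSpace P] [ChartedSpace EP P]
  [MulAction Circle P]

/-- An `S¹`-bundle gerbe over `M`: a surjective submersion `proj : X → M` and an `S¹`-central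
extension `P ⇉ X` of the submersion groupoid `X ×_M X ⇉ X`, the map `P → X ×_M X` being
`(tgt, src)`. -/
structure BundleGerbe extends LieGroupoid EX EP X P where
  proj : X → M
  isSubmersion_proj : Manifold.IsSubmersion 𝓘(ℝ, EX) 𝓘(ℝ, EM) ∞ proj
  surjective_proj : Function.Surjective proj
  proj_tgt : ∀ p, proj (tgt p) = proj (src p)
  contMDiff_smul : ContMDiff ((𝓡 1).prod 𝓘(ℝ, EP)) 𝓘(ℝ, EP) ∞ (fun q : Circle × P => q.1 • q.2)
  src_smul : ∀ (z : Circle) (p : P), src (z • p) = src p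
  tgt_smul : ∀ (z : Circle) (p : P), tgt (z • p) = tgt p
  /-- The action is free. -/
  eq_one_of_smul_eq : ∀ (z : Circle) (p : P), z • p = p → z = 1
  /-- `P → X ×_M X` is locally trivial: near every point of `X ×_M X` (an embedded submanifold of
  `X × X`) there are a local section `σ` and a fibre coordinate `θ`, both smooth, such that
  `p ↦ ((tgt p, src p), θ p)` and `(q, z) ↦ z • σ q` are inverse to each other. -/
  locallyTrivial : ∀ y x, proj y = proj x →
    ∃ (U : Set (X × X)) (σ : X × X → P) (θ : P → Circle), IsOpen U ∧ (y, x) ∈ U ∧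
      ContMDiffOn (𝓘(ℝ, EX).prod 𝓘(ℝ, EX)) 𝓘(ℝ, EP) ∞ σ (U ∩ {q | proj q.1 = proj q.2}) ∧
      (∀ q ∈ U, proj q.1 = proj q.2 → tgt (σ q) = q.1 ∧ src (σ q) = q.2) ∧
      ContMDiffOn 𝓘(ℝ, EP) (𝓡 1) ∞ θ {p | (tgt p, src p) ∈ U} ∧
      ∀ p, (tgt p, src p) ∈ U → θ p • σ (tgt p, src p) = p
  /-- The action is compatible with the multiplication. -/
  smul_mul_smul : ∀ (z w : Circle) (p q : P), src p = tgt q →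
    mul (z • p) (w • q) = (z * w) • mul p q

variable {EP P} in
/-- The generator of the `S¹`-action: the velocity at `0` of `τ ↦ exp(iτ) • p`. -/
def fundamentalField (p : P) : TangentSpace 𝓘(ℝ, EP) p :=
  (mfderiv 𝓘(ℝ, ℝ) 𝓘(ℝ, EP) (fun τ : ℝ => Circle.exp τ • p) 0 (1 : ℝ) : EP)

namespace BundleGerbe

variable {EM EX EP M X P}
variable (G : BundleGerbe EM EX EP M X P)

/-- A connection on the bundle gerbe: a 1-form on `P` that is a connection form for the
`S¹`-action and is multiplicative. -/
structure Connection where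
  form : DiffForm EP P 1
  pullback_smul : ∀ z : Circle, pullbackForm (fun p : P => z • p) form.1 = form.1
  apply_fundamentalField : ∀ p, form.1 p (fun _ => fundamentalField p) = 1
  isMultiplicative : G.IsMultiplicativeForm form.1

variable {G}
variable (γ : G.Connection)

/-- `B` is a curving for `γ`: `δB = dγ`. -/
def IsCurving (B : DiffForm EX X 2) : Prop := G.delta B.1 = extD γ.form.1

/-- The function `v_a = ε^* ι_{a→} γ` on `X`, as a 0-form, where `ε` is the unit map and `a→` is the
right-invariant vector field of `a`. -/
def vFun (a : Π x : X, TangentSpace 𝓘(ℝ, EP) (G.unit x)) : RawForm EX X 0 :=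
  pullbackForm G.unit (contract (G.rightField a) γ.form.1)

variable [FiniteDimensional ℝ EP] [IsManifold 𝓘(ℝ, EX) ∞ X] [IsManifold 𝓘(ℝ, EP) ∞ P]

/-- The degree 0 part: triples `(x, p, α)` where `(x, p)` is a multiplicative vector field on
`P ⇉ X` and `α` is a 1-form on `X` with `L_p γ = δα`. -/
def connectionPreserving :
    Submodule ℝ ((Π a : X, TangentSpace 𝓘(ℝ, EX) a) × (Π g : P, TangentSpace 𝓘(ℝ, EP) g) ×
      RawForm EX X 1) where
  carrier := {ξ | ξ.1 ∈ VectorField EX X ∧ ξ.2.1 ∈ VectorField EP P ∧ ξ.2.2 ∈ DiffForm EX X 1 ∧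
    G.IsMultiplicative ξ.1 ξ.2.1 ∧ lieD ξ.2.1 γ.form.1 = G.delta ξ.2.2}
  add_mem' := by
    rintro ⟨x, p, α⟩ ⟨y, q, β⟩ ⟨hx, hp, hα, h1, h2⟩ ⟨hy, hq, hβ, h3, h4⟩
    have : CompleteSpace EP := FiniteDimensional.complete ℝ EP
    refine ⟨add_mem hx hy, add_mem hp hq, add_mem hα hβ,
      ⟨fun g => ?_, fun g => ?_, fun a => ?_, fun g h hgh => ?_⟩, ?_⟩
    · exact (map_add (mfderiv 𝓘(ℝ, EP) 𝓘(ℝ, EX) G.src g) (p g) (q g)).trans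
        (congrArg₂ (· + ·) (h1.src g) (h3.src g))
    · exact (map_add (mfderiv 𝓘(ℝ, EP) 𝓘(ℝ, EX) G.tgt g) (p g) (q g)).trans
        (congrArg₂ (· + ·) (h1.tgt g) (h3.tgt g))
    · exact (map_add (mfderiv 𝓘(ℝ, EX) 𝓘(ℝ, EP) G.unit a) (x a) (y a)).trans
        (congrArg₂ (· + ·) (h1.unit a) (h3.unit a))
    · exact (congrArg₂ (· + ·) (h1.mul g h hgh) (h3.mul g h hgh)).trans
        (G.tangentMul_add g h _ _ _ _).symm
    · refine (lieD_add hp hq γ.form.2).trans ((congrArg₂ (· + ·) h2 h4).trans ?_)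
      exact (add_sub_add_comm (pullbackForm G.src α) (pullbackForm G.src β)
        (pullbackForm G.tgt α) (pullbackForm G.tgt β)).symm
  zero_mem' := by
    refine ⟨zero_mem _, zero_mem _, zero_mem _, ⟨fun g => map_zero _, fun g => map_zero _,
      fun a => map_zero _, fun g h _ => ?_⟩, ?_⟩
    · have := G.tangentMul_smul g h 0 0 0
      simp only [zero_smul] at this
      exact this.symm
    · have := lieD_smul 0 (0 : Π g : P, TangentSpace 𝓘(ℝ, EP) g) γ.form.1
      simp only [zero_smul] at this
      refine this.trans ?_
      exact (sub_self (0 : RawForm EP P 1)).symm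
  smul_mem' := by
    rintro c ⟨x, p, α⟩ ⟨hx, hp, hα, h1, h2⟩
    refine ⟨Submodule.smul_mem _ c hx, Submodule.smul_mem _ c hp, Submodule.smul_mem _ c hα,
      ⟨fun g => ?_, fun g => ?_, fun a => ?_, fun g h hgh => ?_⟩, ?_⟩
    · exact (map_smul (mfderiv 𝓘(ℝ, EP) 𝓘(ℝ, EX) G.src g) c (p g)).trans
        (congrArg (c • ·) (h1.src g))
    · exact (map_smul (mfderiv 𝓘(ℝ, EP) 𝓘(ℝ, EX) G.tgt g) c (p g)).trans
        (congrArg (c • ·) (h1.tgt g))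
    · exact (map_smul (mfderiv 𝓘(ℝ, EX) 𝓘(ℝ, EP) G.unit a) c (x a)).trans
        (congrArg (c • ·) (h1.unit a))
    · exact (congrArg (c • ·) (h1.mul g h hgh)).trans (G.tangentMul_smul g h c _ _).symm
    · refine (lieD_smul c p γ.form.1).trans ((congrArg (c • ·) h2).trans ?_)
      exact smul_sub c (pullbackForm G.src α) (pullbackForm G.tgt α)

end BundleGerbe

end BundleGerbe

/-! ### Strict Lie 2-algebras -/

/-- A strict Lie 2-algebra with underlying 2-term complex `d : L₁ → L₀`: a 2-term `L_∞`-algebra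
whose Jacobiator vanishes. The brackets are `bracket₀ : L₀ × L₀ → L₀`, `bracket₀₁ : L₀ × L₁ → L₁`
and `bracket₁₀ : L₁ × L₀ → L₁`. -/
structure StrictLieTwoAlgebra (L₁ L₀ : Type*) [AddCommGroup L₁] [Module ℝ L₁]
    [AddCommGroup L₀] [Module ℝ L₀] where
  d : L₁ →ₗ[ℝ] L₀
  bracket₀ : L₀ →ₗ[ℝ] L₀ →ₗ[ℝ] L₀
  bracket₀₁ : L₀ →ₗ[ℝ] L₁ →ₗ[ℝ] L₁
  bracket₁₀ : L₁ →ₗ[ℝ] L₀ →ₗ[ℝ] L₁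
  bracket₀_skew : ∀ x y, bracket₀ x y = -bracket₀ y x
  bracket₁₀_skew : ∀ a x, bracket₀₁ x a = -bracket₁₀ a x
  d_bracket : ∀ x a, d (bracket₀₁ x a) = bracket₀ x (d a)
  bracket_d : ∀ a b, bracket₀₁ (d a) b = bracket₁₀ a (d b)
  jacobi₀ : ∀ x y z, bracket₀ x (bracket₀ y z) + bracket₀ y (bracket₀ z x) +
    bracket₀ z (bracket₀ x y) = 0
  jacobi₁ : ∀ x y a, bracket₀₁ x (bracket₀₁ y a) + bracket₀₁ y (bracket₁₀ a x) +
    bracket₁₀ a (bracket₀ x y) = 0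

end Gerbe

end

open scoped Manifold ContDiff Topology
open Set

set_option linter.unusedSectionVars false

noncomputable section

namespace Gerbe

/-! ### Smooth dependence of pullback, contraction and exterior derivative on alternating forms -/

section AlternatingPullback

variable {𝕍 E F : Type*} [NormedAddCommGroup 𝕍] [NormedSpace ℝ 𝕍]
  [NormedAddCommGroup E] [NormedSpace ℝ E] [NormedAddCommGroup F] [NormedSpace ℝ F]

/-! The assertion amounts to a crossed module of Lie algebras: the degree zero part acts on `Γ(A_P)`
by derivations of a bracket, and the differential is equivariant and satisfies the Peiffer identity.
`StrictLieTwoAlgebra.ofAction` converts these data into a strict Lie 2-algebra.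

The vector field components all follow from `mlieBracket_mul`: the Lie bracket is compatible with
the groupoid multiplication. A multiplicative field is the product of the pair `(p, p)`, a
right-invariant field of `(→a, 0)`, a left-invariant field of `(0, ←a)`. Taking brackets factor by
factor shows that brackets of multiplicative fields are multiplicative, that right- and
left-invariant fields commute, and that `[p, →a]` is again right-invariant, hence equal to the
right-invariant field of its restriction to the units. The action property is then the Jacobi
identity. The Peiffer identity holds because `[ā, →b] = [→a, →b]` is skew in `a` and `b`.

The form component rests on `contract_curving_sub_extD`: for every curving `B` the form `ι_𝐚 B - d
v_a` equals `-ε^* L_{→a} γ`, where `B` no longer occurs. This gives independence of `B`, and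
equivariance becomes the commutator formula for Lie derivatives (`lieD_mlieBracket`). That `d a`
satisfies `L_ā γ = δα` is Cartan's formula together with `ι_ā γ = -δ v_a` and `ι_ā dγ = δ ι_𝐚 B`;
the first of these is the multiplicativity of `γ`.

A curving exists because `dγ` is invariant under arbitrary `S¹`-valued changes of a map into `P`
(`plotForm_smul`), hence depends only on source and target, and is multiplicative. For a local
section `σ` of `π`, choose locally arrows `τ y` from `y` to `σ (π y)` and pull `dγ` back along `τ`.
The arrows `τ (t p) · p` and `τ (s p)` have the same ends, which gives `δ B_σ = dγ`. A partition of
unity on `M` glues these forms, since `δ` is linear over functions on `M`.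

Two devices carry the calculus. Forms are tested by pulling them back along smooth maps from normed
spaces (`plotForm`), of which chart inverses are a special case. Invariant fields are handled as
velocities of curves of arrows, on which derivatives within source fibres or within the composable
pairs are unambiguous. -/

variable (E) in
/-- Antisymmetrization of multilinear maps, as a bounded operator. -/
def alternatizationCLM (k : ℕ) :
    ContinuousMultilinearMap ℝ (fun _ : Fin k => E) ℝ →L[ℝ] E [⋀^Fin k]→L[ℝ] ℝ :=
  LinearMap.mkContinuous
    { toFun := fun f => f.alternatization
      map_add' := fun f g => map_add _ f g
      map_smul' := fun c f => by
        ext v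
        simp [ContinuousMultilinearMap.alternatization_apply_apply, Finset.mul_sum, mul_smul_comm] }
    (Fintype.card (Equiv.Perm (Fin k)))
    (fun f => by
      refine ContinuousAlternatingMap.opNorm_le_bound _ (by positivity) fun v => ?_
      change ‖f.alternatization v‖ ≤ _
      rw [ContinuousMultilinearMap.alternatization_apply_apply]
      refine (norm_sum_le_of_le (n := fun _ => ‖f‖ * ∏ i, ‖v i‖) _ fun σ _ => ?_).trans ?_
      · have h1 : ‖Equiv.Perm.sign σ • f (v ∘ σ)‖ = ‖f (v ∘ σ)‖ := by
          rcases Int.units_eq_one_or (Equiv.Perm.sign σ) with h | h <;> simp [h]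
        rw [h1]
        refine (f.le_opNorm _).trans (le_of_eq ?_)
        congr 1
        exact Equiv.prod_comp σ fun i => ‖v i‖
      · simp [mul_assoc])

/-- Every permutation contributes the same term, the two signs cancelling. Dividing by `k!`
therefore recovers an alternating map linearly and boundedly from its underlying multilinear map. -/
theorem alternatizationCLM_toContinuousMultilinearMap {k : ℕ} (f : E [⋀^Fin k]→L[ℝ] ℝ) :
    alternatizationCLM E k f.toContinuousMultilinearMap = (k.factorial : ℝ) • f := by
  ext v
  change f.toContinuousMultilinearMap.alternatization v = _
  rw [ContinuousMultilinearMap.alternatization_apply_apply]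
  have : ∀ σ : Equiv.Perm (Fin k), Equiv.Perm.sign σ • f.toContinuousMultilinearMap (v ∘ σ) = f v := by
    intro σ
    change Equiv.Perm.sign σ • f (v ∘ σ) = f v
    have h := f.toAlternatingMap.map_perm v σ
    change f (v ∘ σ) = Equiv.Perm.sign σ • f v at h
    rw [h, smul_smul]
    simp
  rw [Finset.sum_congr rfl fun σ _ => this σ]
  simp [Fintype.card_perm]

/-- For multilinear maps, composition is smooth jointly in the form and in the linear maps. The
alternating case is `1/k!` times the antisymmetrization of that one, which is a bounded linear
operator. -/
theorem contDiffAt_compContinuousLinearMap {k : ℕ} {n : ℕ∞ω} {η : 𝕍 → F [⋀^Fin k]→L[ℝ] ℝ}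
    {A : 𝕍 → E →L[ℝ] F} {v : 𝕍} (hη : ContDiffAt ℝ n η v) (hA : ContDiffAt ℝ n A v) :
    ContDiffAt ℝ n (fun w => (η w).compContinuousLinearMap (A w)) v := by
  have h1 : ContDiffAt ℝ n (fun w => ContinuousMultilinearMap.compContinuousLinearMapContinuousMultilinear ℝ
      (fun _ : Fin k => E) (fun _ => F) ℝ (fun _ => A w) (η w).toContinuousMultilinearMap) v := by
    refine ContDiffAt.clm_apply ?_ ?_
    · exact (ContinuousMultilinearMap.contDiff _).contDiffAt.comp v (contDiffAt_pi.2 fun _ => hA)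
    · exact (ContinuousAlternatingMap.toContinuousMultilinearMapCLM ℝ).contDiff.contDiffAt.comp v hη
  have h2 := ((alternatizationCLM E k).contDiff.contDiffAt.comp v h1).const_smul
    ((k.factorial : ℝ)⁻¹)
  refine h2.congr_of_eventuallyEq (Filter.Eventually.of_forall fun w => ?_)
  have h3 := alternatizationCLM_toContinuousMultilinearMap ((η w).compContinuousLinearMap (A w))
  have h4 : (k.factorial : ℝ) ≠ 0 := by positivity
  change _ = (k.factorial : ℝ)⁻¹ • alternatizationCLM E k
    ((η w).compContinuousLinearMap (A w)).toContinuousMultilinearMap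
  rw [h3, smul_smul, inv_mul_cancel₀ h4, one_smul]

theorem contDiffAt_curryLeft {k : ℕ} {n : ℕ∞ω} {η : 𝕍 → F [⋀^Fin (k + 1)]→L[ℝ] ℝ}
    {w : 𝕍 → F} {v : 𝕍} (hη : ContDiffAt ℝ n η v) (hw : ContDiffAt ℝ n w v) :
    ContDiffAt ℝ n (fun y => (η y).curryLeft (w y)) v := by
  have hL : ContDiff ℝ n (fun f : F [⋀^Fin (k + 1)]→L[ℝ] ℝ => f.curryLeft) := by
    apply IsBoundedLinearMap.contDiff
    exact ⟨⟨fun _ _ => rfl, fun _ _ => rfl⟩, 1, one_pos, fun f => by simp⟩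
  exact (hL.contDiffAt.comp v hη).clm_apply hw

theorem contDiffAt_extDeriv {k : ℕ} {η : F → F [⋀^Fin k]→L[ℝ] ℝ} {v : F}
    (hη : ContDiffAt ℝ ∞ η v) : ContDiffAt ℝ ∞ (extDeriv η) v := by
  have h := (ContinuousAlternatingMap.alternatizeUncurryFinCLM (n := k) ℝ F ℝ).contDiff.contDiffAt.comp
    v (hη.fderiv_right (m := ∞) (by norm_cast))
  refine h.congr_of_eventuallyEq (Filter.Eventually.of_forall fun y => ?_)
  simp [extDeriv]

end AlternatingPullback

theorem minSmoothness_two_le : minSmoothness ℝ 2 ≤ (∞ : ℕ∞ω) := by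
  rw [minSmoothness_of_isRCLikeNormedField]
  exact WithTop.coe_le_coe.2 le_top

/-! ### Forms tested along smooth maps from normed spaces -/

section Plots

variable {E : Type*} [NormedAddCommGroup E] [NormedSpace ℝ E]
  {M : Type*} [TopologicalSpace M] [ChartedSpace E M]
  {E' : Type*} [NormedAddCommGroup E'] [NormedSpace ℝ E']
  {N : Type*} [TopologicalSpace N] [ChartedSpace E' N]
  {𝕍 : Type*} [NormedAddCommGroup 𝕍] [NormedSpace ℝ 𝕍]

/-- The pullback of a form along a map from a normed space, as a form on that space. -/
def plotForm {k : ℕ} (f : 𝕍 → M) (η : RawForm E M k) (v : 𝕍) : 𝕍 [⋀^Fin k]→L[ℝ] ℝ :=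
  (η (f v)).compContinuousLinearMap (mfderiv 𝓘(ℝ, 𝕍) 𝓘(ℝ, E) f v)

theorem chartRep_eq_plotForm {k : ℕ} (x₀ : M) (η : RawForm E M k) :
    chartRep x₀ η = plotForm (extChartAt 𝓘(ℝ, E) x₀).symm η := rfl

theorem plotForm_congr {k : ℕ} {f g : 𝕍 → M} {v : 𝕍} (h : f =ᶠ[𝓝 v] g) (η : RawForm E M k) :
    plotForm f η v = plotForm g η v := by
  have h1 := h.self_of_nhds
  have h2 : (mfderiv 𝓘(ℝ, 𝕍) 𝓘(ℝ, E) f v : 𝕍 →L[ℝ] E) = mfderiv 𝓘(ℝ, 𝕍) 𝓘(ℝ, E) g v :=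
    h.mfderiv_eq
  ext w
  change (η (f v) : E [⋀^Fin k]→L[ℝ] ℝ) (fun i => (mfderiv 𝓘(ℝ, 𝕍) 𝓘(ℝ, E) f v : 𝕍 →L[ℝ] E) (w i)) =
    (η (g v) : E [⋀^Fin k]→L[ℝ] ℝ) (fun i => (mfderiv 𝓘(ℝ, 𝕍) 𝓘(ℝ, E) g v : 𝕍 →L[ℝ] E) (w i))
  rw [h2]
  -- All tangent spaces are copies of the model space, so values of a form at equal points can be
  -- compared there. The same transport recurs below whenever two base points are equal but not
  -- identical expressions.
  have h3 : ∀ y z : M, y = z → (η y : E [⋀^Fin k]→L[ℝ] ℝ) = η z := by rintro y _ rfl; rfl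
  rw [h3 _ _ h1]
  rfl

theorem plotForm_pullbackForm {k : ℕ} {F : M → N} {f : 𝕍 → M} {v : 𝕍}
    (hF : MDifferentiableAt 𝓘(ℝ, E) 𝓘(ℝ, E') F (f v))
    (hf : MDifferentiableAt 𝓘(ℝ, 𝕍) 𝓘(ℝ, E) f v) (η : RawForm E' N k) :
    plotForm f (pullbackForm F η : RawForm E M k) v = plotForm (fun w => F (f w)) η v := by
  have h := mfderiv_comp (I := 𝓘(ℝ, 𝕍)) (I' := 𝓘(ℝ, E)) (I'' := 𝓘(ℝ, E')) v hF hf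
  ext w
  change (η (F (f v))) (fun i => (mfderiv 𝓘(ℝ, E) 𝓘(ℝ, E') F (f v))
      (mfderiv 𝓘(ℝ, 𝕍) 𝓘(ℝ, E) f v (w i))) =
    (η (F (f v))) (fun i => mfderiv 𝓘(ℝ, 𝕍) 𝓘(ℝ, E') (F ∘ f) v (w i))
  rw [h]
  rfl

theorem plotForm_contract {k : ℕ} {f : 𝕍 → M} {v w : 𝕍} {W : Π x : M, TangentSpace 𝓘(ℝ, E) x}
    (h : mfderiv 𝓘(ℝ, 𝕍) 𝓘(ℝ, E) f v w = W (f v)) (η : RawForm E M (k + 1)) :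
    plotForm f (contract W η) v = (plotForm f η v).curryLeft w := by
  ext u
  change (η (f v)) (Fin.cons (W (f v)) _) = (η (f v)) _
  congr 1
  funext i
  refine Fin.cases ?_ (fun j => ?_) i
  · exact h.symm
  · rfl

theorem eventually_mdifferentiableAt {H' : Type*} [TopologicalSpace H'] {EQ : Type*}
    [NormedAddCommGroup EQ] [NormedSpace ℝ EQ] {I : ModelWithCorners ℝ EQ H'}
    {Q : Type*} [TopologicalSpace Q] [ChartedSpace H' Q] [IsManifold I 1 Q] [IsManifold 𝓘(ℝ, E) ∞ M]
    {f : Q → M} {v : Q} (hf : ContMDiffAt I 𝓘(ℝ, E) ∞ f v) :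
    ∀ᶠ w in 𝓝 v, MDifferentiableAt I 𝓘(ℝ, E) f w := by
  have : IsManifold 𝓘(ℝ, E) 1 M := IsManifold.of_le (n := ∞) (by norm_cast)
  have h1 : ContMDiffAt I 𝓘(ℝ, E) 1 f v := hf.of_le (by norm_cast)
  filter_upwards [(contMDiffAt_iff_contMDiffAt_nhds (by simp)).1 h1] with w hw
  exact hw.mdifferentiableAt one_ne_zero

variable [IsManifold 𝓘(ℝ, E) ∞ M] [IsManifold 𝓘(ℝ, E') ∞ N]

omit [IsManifold 𝓘(ℝ, E) ∞ M] in
theorem extChartAt_target_mem_nhds_of_mem {x₀ : M} {z : E}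
    (hz : z ∈ (extChartAt 𝓘(ℝ, E) x₀).target) : (extChartAt 𝓘(ℝ, E) x₀).target ∈ 𝓝 z :=
  (isOpen_extChartAt_target x₀).mem_nhds hz

theorem contMDiffAt_chart_symm {x₀ : M} {z : E} (hz : z ∈ (extChartAt 𝓘(ℝ, E) x₀).target) :
    ContMDiffAt 𝓘(ℝ, E) 𝓘(ℝ, E) ∞ (extChartAt 𝓘(ℝ, E) x₀).symm z :=
  (contMDiffOn_extChartAt_symm x₀).contMDiffAt (extChartAt_target_mem_nhds_of_mem hz)

theorem contMDiffAt_chart {x₀ x : M} (hx : x ∈ (extChartAt 𝓘(ℝ, E) x₀).source) :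
    ContMDiffAt 𝓘(ℝ, E) 𝓘(ℝ, E) ∞ (extChartAt 𝓘(ℝ, E) x₀) x :=
  contMDiffAt_extChartAt' (by simpa using hx)

theorem mfderiv_chart_symm_chart {x₀ x : M} (hx : x ∈ (extChartAt 𝓘(ℝ, E) x₀).source)
    (u : TangentSpace 𝓘(ℝ, E) x) :
    (mfderiv 𝓘(ℝ, E) 𝓘(ℝ, E) (extChartAt 𝓘(ℝ, E) x₀).symm (extChartAt 𝓘(ℝ, E) x₀ x)
      (mfderiv 𝓘(ℝ, E) 𝓘(ℝ, E) (extChartAt 𝓘(ℝ, E) x₀) x u) : E) = u := by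
  have : IsManifold 𝓘(ℝ, E) 1 M := IsManifold.of_le (n := ∞) (by norm_cast)
  have := mfderivWithin_extChartAt_symm_comp_mfderiv_extChartAt' (I := 𝓘(ℝ, E)) hx
  rw [modelWithCornersSelf_coe, range_id, mfderivWithin_univ] at this
  exact DFunLike.congr_fun this u

theorem mfderiv_chart_chart_symm {x₀ : M} {z : E} (hz : z ∈ (extChartAt 𝓘(ℝ, E) x₀).target)
    (u : E) :
    (mfderiv 𝓘(ℝ, E) 𝓘(ℝ, E) (extChartAt 𝓘(ℝ, E) x₀) ((extChartAt 𝓘(ℝ, E) x₀).symm z)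
      (mfderiv 𝓘(ℝ, E) 𝓘(ℝ, E) (extChartAt 𝓘(ℝ, E) x₀).symm z u) : E) = u := by
  have : IsManifold 𝓘(ℝ, E) 1 M := IsManifold.of_le (n := ∞) (by norm_cast)
  have := mfderiv_extChartAt_comp_mfderivWithin_extChartAt_symm (I := 𝓘(ℝ, E)) hz
  rw [modelWithCornersSelf_coe, range_id, mfderivWithin_univ] at this
  exact DFunLike.congr_fun this u

/-- Writing `f` as the chart inverse after the chart after `f` turns a pullback along `f` into the
pullback of the chart expression along a map of normed spaces. Questions about plots thereby reduce
to calculus in normed spaces. -/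
theorem plotForm_eq_chartRep {k : ℕ} {f : 𝕍 → M} {v : 𝕍} {x₀ : M}
    (hfv : f v ∈ (extChartAt 𝓘(ℝ, E) x₀).source) (hf : MDifferentiableAt 𝓘(ℝ, 𝕍) 𝓘(ℝ, E) f v)
    (η : RawForm E M k) :
    plotForm f η v = (chartRep x₀ η (extChartAt 𝓘(ℝ, E) x₀ (f v))).compContinuousLinearMap
      (fderiv ℝ (fun w => extChartAt 𝓘(ℝ, E) x₀ (f w)) v) := by
  have h1 := mfderiv_comp v ((contMDiffAt_chart hfv).mdifferentiableAt (by simp)) hf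
  have h2 : ∀ u, (fderiv ℝ (fun w => extChartAt 𝓘(ℝ, E) x₀ (f w)) v : 𝕍 →L[ℝ] E) u =
      mfderiv 𝓘(ℝ, E) 𝓘(ℝ, E) (extChartAt 𝓘(ℝ, E) x₀) (f v) (mfderiv 𝓘(ℝ, 𝕍) 𝓘(ℝ, E) f v u) := by
    intro u
    rw [← mfderiv_eq_fderiv]
    exact DFunLike.congr_fun h1 u
  ext w
  have h3 : ∀ u, (mfderiv 𝓘(ℝ, E) 𝓘(ℝ, E) (extChartAt 𝓘(ℝ, E) x₀).symm
      (extChartAt 𝓘(ℝ, E) x₀ (f v)) (fderiv ℝ (fun w => extChartAt 𝓘(ℝ, E) x₀ (f w)) v u) : E) =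
      mfderiv 𝓘(ℝ, 𝕍) 𝓘(ℝ, E) f v u := by
    intro u
    rw [h2]
    exact mfderiv_chart_symm_chart hfv _
  have h4 : ∀ y z : M, y = z → (η y : E [⋀^Fin k]→L[ℝ] ℝ) = η z := by rintro y _ rfl; rfl
  change (η (f v) : E [⋀^Fin k]→L[ℝ] ℝ) (fun i => (mfderiv 𝓘(ℝ, 𝕍) 𝓘(ℝ, E) f v (w i) : E)) =
    (η ((extChartAt 𝓘(ℝ, E) x₀).symm (extChartAt 𝓘(ℝ, E) x₀ (f v))) : E [⋀^Fin k]→L[ℝ] ℝ)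
      (fun i => (mfderiv 𝓘(ℝ, E) 𝓘(ℝ, E) (extChartAt 𝓘(ℝ, E) x₀).symm
      (extChartAt 𝓘(ℝ, E) x₀ (f v)) (fderiv ℝ (fun w => extChartAt 𝓘(ℝ, E) x₀ (f w)) v (w i)) : E))
  rw [h4 _ _ ((extChartAt 𝓘(ℝ, E) x₀).left_inv hfv)]
  simp only [h3]
  rfl

theorem eventually_plotForm_eq {k : ℕ} {f : 𝕍 → M} {v : 𝕍} {x₀ : M}
    (hfv : f v ∈ (extChartAt 𝓘(ℝ, E) x₀).source) (hf : ContMDiffAt 𝓘(ℝ, 𝕍) 𝓘(ℝ, E) ∞ f v)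
    (η : RawForm E M k) :
    plotForm f η =ᶠ[𝓝 v] fun v => (chartRep x₀ η
      (extChartAt 𝓘(ℝ, E) x₀ (f v))).compContinuousLinearMap
      (fderiv ℝ (fun w => extChartAt 𝓘(ℝ, E) x₀ (f w)) v) := by
  filter_upwards [eventually_mdifferentiableAt hf, hf.continuousAt.preimage_mem_nhds
    ((isOpen_extChartAt_source x₀).mem_nhds hfv)] with w hw hw'
  exact plotForm_eq_chartRep hw' hw η

theorem contDiffAt_chart_comp {f : 𝕍 → M} {v : 𝕍} {x₀ : M}
    (hfv : f v ∈ (extChartAt 𝓘(ℝ, E) x₀).source) (hf : ContMDiffAt 𝓘(ℝ, 𝕍) 𝓘(ℝ, E) ∞ f v) :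
    ContDiffAt ℝ ∞ (fun w => extChartAt 𝓘(ℝ, E) x₀ (f w)) v :=
  contMDiffAt_iff_contDiffAt.1 ((contMDiffAt_chart hfv).comp v hf)

/-- Smoothness of a form at a point. -/
def SmoothFormAt {k : ℕ} (η : RawForm E M k) (x : M) : Prop :=
  ContDiffAt ℝ ∞ (chartRep x η) (extChartAt 𝓘(ℝ, E) x x)

theorem SmoothFormAt.contDiffAt_plotForm {k : ℕ} {η : RawForm E M k} {f : 𝕍 → M} {v : 𝕍}
    (hη : SmoothFormAt η (f v)) (hf : ContMDiffAt 𝓘(ℝ, 𝕍) 𝓘(ℝ, E) ∞ f v) :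
    ContDiffAt ℝ ∞ (plotForm f η) v := by
  refine ContDiffAt.congr_of_eventuallyEq ?_
    (eventually_plotForm_eq (mem_extChartAt_source (f v)) hf η)
  have h := contDiffAt_chart_comp (mem_extChartAt_source (f v)) hf
  refine contDiffAt_compContinuousLinearMap (n := ∞) ?_ (h.fderiv_right (m := ∞) (by norm_cast))
  exact ContDiffAt.comp (g := chartRep (f v) η) v hη h

/-- One chart around each point suffices: the inverse of any other chart is a smooth plot, and
smoothness at a point passes to plots through it. -/
theorem mem_diffForm_iff {k : ℕ} {η : RawForm E M k} :
    η ∈ DiffForm E M k ↔ ∀ x, SmoothFormAt η x := by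
  refine ⟨fun h x => (h x).contDiffAt (extChartAt_target_mem_nhds x), fun h x₀ z hz => ?_⟩
  have := (h ((extChartAt 𝓘(ℝ, E) x₀).symm z)).contDiffAt_plotForm (contMDiffAt_chart_symm hz)
  exact this.contDiffWithinAt

/-- Naturality of the exterior derivative on normed spaces, transported through the chart at `f v`.
Applied to chart inverses it shows that `extD`, defined with a different chart at each point, is
computed by every chart. -/
theorem SmoothFormAt.extDeriv_plotForm {k : ℕ} {η : RawForm E M k} {f : 𝕍 → M} {v : 𝕍}
    (hη : SmoothFormAt η (f v)) (hf : ContMDiffAt 𝓘(ℝ, 𝕍) 𝓘(ℝ, E) ∞ f v) :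
    extDeriv (plotForm f η) v = plotForm f (extD η) v := by
  have h := contDiffAt_chart_comp (mem_extChartAt_source (f v)) hf
  rw [(eventually_plotForm_eq (mem_extChartAt_source (f v)) hf η).extDeriv_eq,
    extDeriv_pullback (r := ∞) (f := fun w => extChartAt 𝓘(ℝ, E) (f v) (f w))
      (ContDiffAt.differentiableAt hη (by simp)) h minSmoothness_two_le]
  ext w
  have h1 := mfderiv_comp v ((contMDiffAt_chart (mem_extChartAt_source (f v))).mdifferentiableAt
    (by simp)) (hf.mdifferentiableAt (by simp))
  rw [← mfderiv_eq_fderiv]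
  change (extDeriv (chartRep (f v) η) (extChartAt 𝓘(ℝ, E) (f v) (f v)))
    (fun i => mfderiv 𝓘(ℝ, 𝕍) 𝓘(ℝ, E) (extChartAt 𝓘(ℝ, E) (f v) ∘ f) v (w i)) = _
  rw [h1]
  rfl

end Plots
end Gerbe

namespace Gerbe

/-! ### Lie brackets and Lie derivatives on normed spaces -/

section VectorSpace

variable {𝕍 F : Type*} [NormedAddCommGroup 𝕍] [NormedSpace ℝ 𝕍]
  [NormedAddCommGroup F] [NormedSpace ℝ F]

/-- Vector fields which are related along the image of a map `ρ` fixing `v` have related Lie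
brackets at `v`, provided their values at `v` are fixed by the derivative of `ρ`. -/
theorem lieBracket_of_related {f : 𝕍 → F} {v : 𝕍} (hf : ContDiffAt ℝ ∞ f v) {w₁ w₂ : 𝕍 → 𝕍}
    (hw₁ : DifferentiableAt ℝ w₁ v) (hw₂ : DifferentiableAt ℝ w₂ v) {z₁ z₂ : F → F}
    (hz₁ : DifferentiableAt ℝ z₁ (f v)) (hz₂ : DifferentiableAt ℝ z₂ (f v)) {ρ : 𝕍 → 𝕍}
    (hρ : DifferentiableAt ℝ ρ v) (hρv : ρ v = v) (h₁ : fderiv ℝ ρ v (w₁ v) = w₁ v)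
    (h₂ : fderiv ℝ ρ v (w₂ v) = w₂ v)
    (hr₁ : ∀ᶠ y in 𝓝 v, fderiv ℝ f (ρ y) (w₁ (ρ y)) = z₁ (f (ρ y)))
    (hr₂ : ∀ᶠ y in 𝓝 v, fderiv ℝ f (ρ y) (w₂ (ρ y)) = z₂ (f (ρ y))) :
    fderiv ℝ f v (VectorField.lieBracket ℝ w₁ w₂ v) =
      VectorField.lieBracket ℝ z₁ z₂ (f v) := by
  have hfd : DifferentiableAt ℝ f v := hf.differentiableAt (by simp)
  have hdf : DifferentiableAt ℝ (fderiv ℝ f) v :=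
    (hf.fderiv_right (m := ∞) (by norm_cast)).differentiableAt (by simp)
  -- Differentiate `Df(w) = z ∘ f` after composing with `ρ`. In a direction fixed by `dρ` the result
  -- is the same as if the relation held on a full neighbourhood of `v`.
  have key : ∀ (w : 𝕍 → 𝕍) (z : F → F), DifferentiableAt ℝ w v → DifferentiableAt ℝ z (f v) →
      (∀ᶠ y in 𝓝 v, fderiv ℝ f (ρ y) (w (ρ y)) = z (f (ρ y))) → ∀ h, fderiv ℝ ρ v h = h →
      fderiv ℝ (fderiv ℝ f) v h (w v) + fderiv ℝ f v (fderiv ℝ w v h) =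
        fderiv ℝ z (f v) (fderiv ℝ f v h) := by
    intro w z hw hz hr h hh
    have e1 : HasFDerivAt (fun y => fderiv ℝ f y (w y))
        ((fderiv ℝ f v).comp (fderiv ℝ w v) + (fderiv ℝ (fderiv ℝ f) v).flip (w v)) (ρ v) := by
      rw [hρv]
      exact hdf.hasFDerivAt.clm_apply hw.hasFDerivAt
    have e2 : HasFDerivAt (fun y => z (f y)) ((fderiv ℝ z (f v)).comp (fderiv ℝ f v)) (ρ v) := by
      rw [hρv]
      exact hz.hasFDerivAt.comp v hfd.hasFDerivAt
    have e3 := (e1.comp v hρ.hasFDerivAt).unique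
      ((e2.comp v hρ.hasFDerivAt).congr_of_eventuallyEq hr)
    have e4 := DFunLike.congr_fun e3 h
    simp only [ContinuousLinearMap.comp_apply, add_apply, hh,
      ContinuousLinearMap.flip_apply] at e4
    rw [add_comm]
    exact e4
  have e1 := key w₂ z₂ hw₂ hz₂ hr₂ (w₁ v) h₁
  have e2 := key w₁ z₁ hw₁ hz₁ hr₁ (w₂ v) h₂
  have s1 := hr₁.self_of_nhds
  have s2 := hr₂.self_of_nhds
  rw [hρv] at s1 s2
  -- The two relations contribute `D²f(w₁, w₂)` and `D²f(w₂, w₁)`, which cancel in the bracket.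
  have sym := (hf.isSymmSndFDerivAt minSmoothness_two_le).eq (w₁ v) (w₂ v)
  rw [VectorField.lieBracket_eq, VectorField.lieBracket_eq]
  simp only [map_sub]
  rw [← s1, ← s2, ← e1, ← e2, sym]
  abel

/-- The Lie derivative of a form on a normed space, by Cartan's formula. -/
def vecLieD {k : ℕ} (w : 𝕍 → 𝕍) (a : 𝕍 → 𝕍 [⋀^Fin (k + 1)]→L[ℝ] ℝ) (v : 𝕍) :
    𝕍 [⋀^Fin (k + 1)]→L[ℝ] ℝ :=
  extDeriv (fun y => (a y).curryLeft (w y)) v + (extDeriv a v).curryLeft (w v)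

/-- The covector field underlying an alternating 1-form. -/
def covector (a : 𝕍 → 𝕍 [⋀^Fin 1]→L[ℝ] ℝ) (y : 𝕍) : 𝕍 →L[ℝ] ℝ :=
  (ContinuousAlternatingMap.ofSubsingletonLIE (𝕜 := ℝ) (E := 𝕍) (F := ℝ) (ι := Fin 1) (0 : Fin 1)).symm (a y)

theorem covector_apply (a : 𝕍 → 𝕍 [⋀^Fin 1]→L[ℝ] ℝ) (y u : 𝕍) :
    covector a y u = a y (fun _ => u) := rfl

theorem contDiffAt_covector {a : 𝕍 → 𝕍 [⋀^Fin 1]→L[ℝ] ℝ} {v : 𝕍} (ha : ContDiffAt ℝ ∞ a v) :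
    ContDiffAt ℝ ∞ (covector a) v :=
  (ContinuousAlternatingMap.ofSubsingletonLIE (𝕜 := ℝ) (E := 𝕍) (F := ℝ) (ι := Fin 1) (0 : Fin 1)).symm.contDiff.contDiffAt.comp v ha

theorem fderiv_covector_apply {a : 𝕍 → 𝕍 [⋀^Fin 1]→L[ℝ] ℝ} {v : 𝕍} (ha : DifferentiableAt ℝ a v)
    (h u : 𝕍) : fderiv ℝ (covector a) v h u = fderiv ℝ (fun y => a y (fun _ => u)) v h := by
  have h1 : DifferentiableAt ℝ (covector a) v :=
    (ContinuousAlternatingMap.ofSubsingletonLIE (𝕜 := ℝ) (E := 𝕍) (F := ℝ) (ι := Fin 1) (0 : Fin 1)).symm.differentiable.differentiableAt.comp v ha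
  have h2 := (h1.hasFDerivAt.clm_apply (hasFDerivAt_const u v)).fderiv
  simp only [covector_apply] at h2
  rw [h2]
  simp

/-- The Lie derivative of a covector field. -/
def covectorLieD (w : 𝕍 → 𝕍) (b : 𝕍 → 𝕍 →L[ℝ] ℝ) (y : 𝕍) : 𝕍 →L[ℝ] ℝ :=
  fderiv ℝ b y (w y) + (b y).comp (fderiv ℝ w y)

/-- In Cartan's formula the terms `Db(u)(w)` from `dι` and from `ιd` cancel, leaving `Db(w) + b ∘
Dw`. This expression is free of antisymmetrization and is easy to iterate. -/
theorem covector_vecLieD {w : 𝕍 → 𝕍} {a : 𝕍 → 𝕍 [⋀^Fin 1]→L[ℝ] ℝ} {v : 𝕍}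
    (hw : ContDiffAt ℝ ∞ w v) (ha : ContDiffAt ℝ ∞ a v) :
    covector (vecLieD w a) v = covectorLieD w (covector a) v := by
  have had : DifferentiableAt ℝ a v := ha.differentiableAt (by simp)
  have hwd : DifferentiableAt ℝ w v := hw.differentiableAt (by simp)
  have hcd : DifferentiableAt ℝ (covector a) v :=
    (contDiffAt_covector ha).differentiableAt (by simp)
  ext u
  rw [covector_apply, vecLieD, ContinuousAlternatingMap.add_apply]
  have h1 : DifferentiableAt ℝ (fun y => (a y).curryLeft (w y)) v :=
    (contDiffAt_curryLeft ha hw).differentiableAt (by simp)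
  have h2 : extDeriv (fun y => (a y).curryLeft (w y)) v (fun _ => u) =
      fderiv ℝ (covector a) v u (w v) + covector a v (fderiv ℝ w v u) := by
    rw [extDeriv_apply h1]
    have h3 : ∀ y, (a y).curryLeft (w y) ((0 : Fin 1).removeNth fun _ => u) =
        covector a y (w y) := by
      intro y
      rw [covector_apply]
      change a y _ = a y _
      congr 1
      funext i
      fin_cases i
      rfl
    rw [Fin.sum_univ_one]
    rw [show (fun y => (a y).curryLeft (w y) ((0 : Fin 1).removeNth fun _ => u)) =
      fun y => covector a y (w y) from funext h3,
      (hcd.hasFDerivAt.clm_apply hwd.hasFDerivAt).fderiv]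
    simp [add_comm]
  have h4 : (extDeriv a v).curryLeft (w v) (fun _ => u) =
      fderiv ℝ (covector a) v (w v) u - fderiv ℝ (covector a) v u (w v) := by
    change extDeriv a v (Fin.cons (w v) fun _ => u) = _
    rw [extDeriv_apply had, Fin.sum_univ_two, fderiv_covector_apply had, fderiv_covector_apply had]
    have e0 : ((0 : Fin 2).removeNth (Fin.cons (w v) fun _ => u : Fin 2 → 𝕍)) = fun _ => u := by
      funext i
      fin_cases i
      rfl
    have e1 : ((1 : Fin 2).removeNth (Fin.cons (w v) fun _ => u : Fin 2 → 𝕍)) = fun _ => w v := by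
      funext i
      fin_cases i
      rfl
    rw [e0, e1]
    simp [sub_eq_add_neg]
  rw [h2, h4]
  simp only [covectorLieD, add_apply, ContinuousLinearMap.comp_apply]
  abel

/-- The product rule expands both iterated derivatives. The mixed first order terms cancel in pairs,
and the second order terms in `b` cancel by symmetry of the second derivative; those in `w₁` and
`w₂` assemble to the derivative of the bracket. -/
theorem covectorLieD_lieBracket {w₁ w₂ : 𝕍 → 𝕍} {b : 𝕍 → 𝕍 →L[ℝ] ℝ} {v : 𝕍}
    (hw₁ : ContDiffAt ℝ ∞ w₁ v) (hw₂ : ContDiffAt ℝ ∞ w₂ v) (hb : ContDiffAt ℝ ∞ b v) :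
    covectorLieD (VectorField.lieBracket ℝ w₁ w₂) b v =
      covectorLieD w₁ (covectorLieD w₂ b) v - covectorLieD w₂ (covectorLieD w₁ b) v := by
  have d : ∀ {G : Type _} [NormedAddCommGroup G] [NormedSpace ℝ G] {g : 𝕍 → G},
      ContDiffAt ℝ ∞ g v → HasFDerivAt g (fderiv ℝ g v) v :=
    fun h => (h.differentiableAt (by simp)).hasFDerivAt
  have d2 : ∀ {G : Type _} [NormedAddCommGroup G] [NormedSpace ℝ G] {g : 𝕍 → G},
      ContDiffAt ℝ ∞ g v → HasFDerivAt (fderiv ℝ g) (fderiv ℝ (fderiv ℝ g) v) v :=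
    fun h => d (h.fderiv_right (m := ∞) (by norm_cast))
  have key : ∀ {w : 𝕍 → 𝕍}, ContDiffAt ℝ ∞ w v → ∀ h u, fderiv ℝ (covectorLieD w b) v h u =
      fderiv ℝ (fderiv ℝ b) v h (w v) u + fderiv ℝ b v (fderiv ℝ w v h) u +
      fderiv ℝ b v h (fderiv ℝ w v u) + b v (fderiv ℝ (fderiv ℝ w) v h u) := by
    intro w hw h u
    have e := ((d2 hb).clm_apply (d hw)).add ((d hb).clm_comp (d2 hw))
    have e' : fderiv ℝ (covectorLieD w b) v = _ := e.fderiv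
    rw [e']
    simp
    abel
  have br : fderiv ℝ (VectorField.lieBracket ℝ w₁ w₂) v = _ :=
    (((d2 hw₂).clm_apply (d hw₁)).sub ((d2 hw₁).clm_apply (d hw₂))).fderiv
  have sb := fun x y => (hb.isSymmSndFDerivAt minSmoothness_two_le).eq x y
  have s1 := fun x y => (hw₁.isSymmSndFDerivAt minSmoothness_two_le).eq x y
  have s2 := fun x y => (hw₂.isSymmSndFDerivAt minSmoothness_two_le).eq x y
  ext u
  simp only [covectorLieD, add_apply, sub_apply,
    ContinuousLinearMap.comp_apply]
  have k1 := key hw₁ (w₂ v) u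
  have k2 := key hw₂ (w₁ v) u
  change _ = fderiv ℝ (covectorLieD w₂ b) v (w₁ v) u + _ -
    (fderiv ℝ (covectorLieD w₁ b) v (w₂ v) u + _)
  rw [k1, k2, br, VectorField.lieBracket_eq, sb (w₁ v) (w₂ v), s1 (w₂ v) u, s2 (w₁ v) u]
  simp
  ring

end VectorSpace

end Gerbe

namespace Gerbe

/-! ### Brackets, pullbacks and Lie derivatives on manifolds -/

section ManifoldCalculus

variable {E : Type*} [NormedAddCommGroup E] [NormedSpace ℝ E]
  {M : Type*} [TopologicalSpace M] [ChartedSpace E M] [IsManifold 𝓘(ℝ, E) ∞ M]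
  {E' : Type*} [NormedAddCommGroup E'] [NormedSpace ℝ E']
  {N : Type*} [TopologicalSpace N] [ChartedSpace E' N] [IsManifold 𝓘(ℝ, E') ∞ N]
  {𝕍 : Type*} [NormedAddCommGroup 𝕍] [NormedSpace ℝ 𝕍]

/-- The expression of a vector field in the preferred chart at `x₀`. -/
def vecRep (x₀ : M) (W : Π x : M, TangentSpace 𝓘(ℝ, E) x) : E → E :=
  VectorField.mpullback 𝓘(ℝ, E) 𝓘(ℝ, E) (extChartAt 𝓘(ℝ, E) x₀).symm W

theorem isInvertible_mfderiv_chart_symm {x₀ : M} {z : E}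
    (hz : z ∈ (extChartAt 𝓘(ℝ, E) x₀).target) :
    (mfderiv 𝓘(ℝ, E) 𝓘(ℝ, E) (extChartAt 𝓘(ℝ, E) x₀).symm z).IsInvertible := by
  have : IsManifold 𝓘(ℝ, E) 1 M := IsManifold.of_le (n := ∞) (by norm_cast)
  have := isInvertible_mfderivWithin_extChartAt_symm (I := 𝓘(ℝ, E)) hz
  simpa using this

theorem mfderiv_vecRep {x₀ : M} {z : E} (hz : z ∈ (extChartAt 𝓘(ℝ, E) x₀).target)
    (W : Π x : M, TangentSpace 𝓘(ℝ, E) x) :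
    mfderiv 𝓘(ℝ, E) 𝓘(ℝ, E) (extChartAt 𝓘(ℝ, E) x₀).symm z (vecRep x₀ W z : E) =
      W ((extChartAt 𝓘(ℝ, E) x₀).symm z) :=
  (isInvertible_mfderiv_chart_symm hz).self_apply_inverse _

theorem eventually_mfderiv_vecRep {x₀ : M} {z : E} (hz : z ∈ (extChartAt 𝓘(ℝ, E) x₀).target)
    (W : Π x : M, TangentSpace 𝓘(ℝ, E) x) :
    ∀ᶠ y in 𝓝 z, mfderiv 𝓘(ℝ, E) 𝓘(ℝ, E) (extChartAt 𝓘(ℝ, E) x₀).symm y (vecRep x₀ W y : E) =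
      W ((extChartAt 𝓘(ℝ, E) x₀).symm y) := by
  filter_upwards [extChartAt_target_mem_nhds_of_mem hz] with y hy
  exact mfderiv_vecRep hy W

theorem contDiffAt_vecRep [CompleteSpace E] {x₀ : M} {z : E}
    (hz : z ∈ (extChartAt 𝓘(ℝ, E) x₀).target) {W : Π x : M, TangentSpace 𝓘(ℝ, E) x}
    (hW : W ∈ VectorField E M) : ContDiffAt ℝ ∞ (vecRep x₀ W) z := by
  have : IsManifold 𝓘(ℝ, E) 1 M := IsManifold.of_le (n := ∞) (by norm_cast)
  have h := ContMDiffAt.mpullback_vectorField_preimage (m := ∞) (n := ∞)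
    (hW ((extChartAt 𝓘(ℝ, E) x₀).symm z))
    (contMDiffAt_chart_symm hz) (isInvertible_mfderiv_chart_symm hz) (by norm_cast)
  rw [← contMDiffWithinAt_univ] at h
  have h2 := contMDiffWithinAt_vectorSpace_iff_contDiffWithinAt.1 h
  exact contDiffWithinAt_univ.1 h2

/-- The bracket on a manifold is defined at `x` by the chart at `x`, so this unwinds the definition;
other charts need `mfderiv_chart_symm_lieBracket`. -/
theorem mfderiv_chart_mlieBracket (W Z : Π x : M, TangentSpace 𝓘(ℝ, E) x) (x : M) :
    (mfderiv 𝓘(ℝ, E) 𝓘(ℝ, E) (extChartAt 𝓘(ℝ, E) x) x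
      (VectorField.mlieBracket 𝓘(ℝ, E) W Z x) : E) =
    VectorField.lieBracket ℝ (vecRep x W) (vecRep x Z) (extChartAt 𝓘(ℝ, E) x x) := by
  have : IsManifold 𝓘(ℝ, E) 1 M := IsManifold.of_le (n := ∞) (by norm_cast)
  have hi : (mfderiv 𝓘(ℝ, E) 𝓘(ℝ, E) (extChartAt 𝓘(ℝ, E) x) x).IsInvertible :=
    isInvertible_mfderiv_extChartAt (mem_extChartAt_source x)
  rw [← VectorField.mlieBracketWithin_univ, VectorField.mlieBracketWithin_apply]
  simp only [modelWithCornersSelf_coe, range_id, VectorField.mpullbackWithin_univ, preimage_univ,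
    inter_univ]
  refine (hi.self_apply_inverse _).trans ?_
  exact congrFun (VectorField.lieBracketWithin_univ (𝕜 := ℝ) (V := vecRep x W)
    (W := vecRep x Z)) (extChartAt 𝓘(ℝ, E) x x : E)

theorem mlieBracket_mem {W Z : Π x : M, TangentSpace 𝓘(ℝ, E) x} [CompleteSpace E]
    (hW : W ∈ VectorField E M) (hZ : Z ∈ VectorField E M) :
    VectorField.mlieBracket 𝓘(ℝ, E) W Z ∈ VectorField E M := by
  have : IsManifold 𝓘(ℝ, E) (((⊤ : ℕ∞) : ℕ∞ω) + 1) M :=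
    IsManifold.of_le (n := ∞) (by norm_cast)
  have : IsManifold 𝓘(ℝ, E) (minSmoothness ℝ 2) M :=
    IsManifold.of_le (n := ∞) minSmoothness_two_le
  exact ContDiff.mlieBracket_vectorField (m := ⊤) (n := ⊤) hW hZ
    (by rw [minSmoothness_of_isRCLikeNormedField]; norm_cast)

/-- Vector fields on a normed space and on a manifold which are related along the image of a map
`ρ` fixing `v` have related Lie brackets at `v`, provided their values at `v` are fixed by the
derivative of `ρ`. -/
theorem mlieBracket_of_related_retract [CompleteSpace E] {f : 𝕍 → M} {v : 𝕍}
    (hf : ContMDiffAt 𝓘(ℝ, 𝕍) 𝓘(ℝ, E) ∞ f v)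
    {w₁ w₂ : 𝕍 → 𝕍} (hw₁ : DifferentiableAt ℝ w₁ v) (hw₂ : DifferentiableAt ℝ w₂ v)
    {Z₁ Z₂ : Π x : M, TangentSpace 𝓘(ℝ, E) x} (hZ₁ : Z₁ ∈ VectorField E M)
    (hZ₂ : Z₂ ∈ VectorField E M) {ρ : 𝕍 → 𝕍}
    (hρ : DifferentiableAt ℝ ρ v) (hρv : ρ v = v) (h₁ : fderiv ℝ ρ v (w₁ v) = w₁ v)
    (h₂ : fderiv ℝ ρ v (w₂ v) = w₂ v)
    (hr₁ : ∀ᶠ y in 𝓝 v, mfderiv 𝓘(ℝ, 𝕍) 𝓘(ℝ, E) f (ρ y) (w₁ (ρ y)) = Z₁ (f (ρ y)))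
    (hr₂ : ∀ᶠ y in 𝓝 v, mfderiv 𝓘(ℝ, 𝕍) 𝓘(ℝ, E) f (ρ y) (w₂ (ρ y)) = Z₂ (f (ρ y))) :
    mfderiv 𝓘(ℝ, 𝕍) 𝓘(ℝ, E) f v (VectorField.lieBracket ℝ w₁ w₂ v : 𝕍) =
      VectorField.mlieBracket 𝓘(ℝ, E) Z₁ Z₂ (f v) := by
  have hs := mem_extChartAt_source (I := 𝓘(ℝ, E)) (f v)
  have hF := contDiffAt_chart_comp hs hf
  have hder : ∀ y, f y ∈ (extChartAt 𝓘(ℝ, E) (f v)).source →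
      MDifferentiableAt 𝓘(ℝ, 𝕍) 𝓘(ℝ, E) f y → ∀ u : 𝕍,
      fderiv ℝ (fun y => extChartAt 𝓘(ℝ, E) (f v) (f y)) y u =
      (mfderiv 𝓘(ℝ, E) 𝓘(ℝ, E) (extChartAt 𝓘(ℝ, E) (f v)) (f y)
        (mfderiv 𝓘(ℝ, 𝕍) 𝓘(ℝ, E) f y u) : E) := by
    intro y hy hfy u
    rw [← mfderiv_eq_fderiv]
    exact DFunLike.congr_fun
      (mfderiv_comp y ((contMDiffAt_chart hy).mdifferentiableAt (by simp)) hfy) u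
  -- The relation read in the chart at `f v`. Continuity of `ρ` at its fixed point `v` keeps `f (ρ
  -- y)` inside this chart for `y` near `v`.
  have hrel : ∀ (w : 𝕍 → 𝕍) (Z : Π x : M, TangentSpace 𝓘(ℝ, E) x),
      (∀ᶠ y in 𝓝 v, mfderiv 𝓘(ℝ, 𝕍) 𝓘(ℝ, E) f (ρ y) (w (ρ y)) = Z (f (ρ y))) →
      ∀ᶠ y in 𝓝 v, fderiv ℝ (fun y => extChartAt 𝓘(ℝ, E) (f v) (f y)) (ρ y) (w (ρ y)) =
        vecRep (f v) Z (extChartAt 𝓘(ℝ, E) (f v) (f (ρ y))) := by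
    intro w Z h
    have hρt : Filter.Tendsto ρ (𝓝 v) (𝓝 v) := by
      have := hρ.continuousAt.tendsto
      rwa [hρv] at this
    filter_upwards [h, hρt.eventually (eventually_mdifferentiableAt hf),
      hρt.eventually (hf.continuousAt.preimage_mem_nhds
        ((isOpen_extChartAt_source (f v)).mem_nhds hs))] with y hy hfy hsy
    rw [hder _ hsy hfy, hy]
    have hm := (extChartAt 𝓘(ℝ, E) (f v)).map_source hsy
    have h5 := mfderiv_vecRep hm Z
    have h6 : (Z ((extChartAt 𝓘(ℝ, E) (f v)).symm (extChartAt 𝓘(ℝ, E) (f v) (f (ρ y)))) : E) =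
        Z (f (ρ y)) := by
      rw [(extChartAt 𝓘(ℝ, E) (f v)).left_inv hsy]
    have h7 := mfderiv_chart_chart_symm hm (vecRep (f v) Z (extChartAt 𝓘(ℝ, E) (f v) (f (ρ y))))
    rw [← h7, h5]
    change (mfderiv 𝓘(ℝ, E) 𝓘(ℝ, E) (extChartAt 𝓘(ℝ, E) (f v)) (f (ρ y)) : E →L[ℝ] E) _ =
      (mfderiv 𝓘(ℝ, E) 𝓘(ℝ, E) (extChartAt 𝓘(ℝ, E) (f v))
        ((extChartAt 𝓘(ℝ, E) (f v)).symm (extChartAt 𝓘(ℝ, E) (f v) (f (ρ y)))) : E →L[ℝ] E)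
        (Z ((extChartAt 𝓘(ℝ, E) (f v)).symm (extChartAt 𝓘(ℝ, E) (f v) (f (ρ y)))) : E)
    rw [h6]
    have h8 : ∀ p q : M, p = q →
        (mfderiv 𝓘(ℝ, E) 𝓘(ℝ, E) (extChartAt 𝓘(ℝ, E) (f v)) p : E →L[ℝ] E) =
          mfderiv 𝓘(ℝ, E) 𝓘(ℝ, E) (extChartAt 𝓘(ℝ, E) (f v)) q := by rintro p _ rfl; rfl
    rw [h8 _ _ ((extChartAt 𝓘(ℝ, E) (f v)).left_inv hsy)]
    rfl
  have hdZ : ∀ Z ∈ VectorField E M, DifferentiableAt ℝ (vecRep (f v) Z)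
      (extChartAt 𝓘(ℝ, E) (f v) (f v)) := fun Z hZ =>
    (contDiffAt_vecRep (mem_extChartAt_target (f v)) hZ).differentiableAt (by simp)
  have h := lieBracket_of_related hF hw₁ hw₂ (hdZ _ hZ₁) (hdZ _ hZ₂) hρ hρv h₁ h₂
    (hrel _ _ hr₁) (hrel _ _ hr₂)
  rw [hder v hs (hf.mdifferentiableAt (by simp)), ← mfderiv_chart_mlieBracket] at h
  have h9 := mfderiv_chart_symm_chart hs (mfderiv 𝓘(ℝ, 𝕍) 𝓘(ℝ, E) f v
    (VectorField.lieBracket ℝ w₁ w₂ v : 𝕍))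
  have h10 := mfderiv_chart_symm_chart hs (VectorField.mlieBracket 𝓘(ℝ, E) Z₁ Z₂ (f v))
  exact h9.symm.trans ((congrArg _ h).trans h10)

/-- The case `ρ = id`, where the relation holds on a whole neighbourhood. -/
theorem mlieBracket_of_related_plot [CompleteSpace E] {f : 𝕍 → M} {v : 𝕍}
    (hf : ContMDiffAt 𝓘(ℝ, 𝕍) 𝓘(ℝ, E) ∞ f v)
    {w₁ w₂ : 𝕍 → 𝕍} (hw₁ : DifferentiableAt ℝ w₁ v) (hw₂ : DifferentiableAt ℝ w₂ v)
    {Z₁ Z₂ : Π x : M, TangentSpace 𝓘(ℝ, E) x} (hZ₁ : Z₁ ∈ VectorField E M)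
    (hZ₂ : Z₂ ∈ VectorField E M)
    (hr₁ : ∀ᶠ y in 𝓝 v, mfderiv 𝓘(ℝ, 𝕍) 𝓘(ℝ, E) f y (w₁ y) = Z₁ (f y))
    (hr₂ : ∀ᶠ y in 𝓝 v, mfderiv 𝓘(ℝ, 𝕍) 𝓘(ℝ, E) f y (w₂ y) = Z₂ (f y)) :
    mfderiv 𝓘(ℝ, 𝕍) 𝓘(ℝ, E) f v (VectorField.lieBracket ℝ w₁ w₂ v : 𝕍) =
      VectorField.mlieBracket 𝓘(ℝ, E) Z₁ Z₂ (f v) :=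
  mlieBracket_of_related_retract hf hw₁ hw₂ hZ₁ hZ₂ (ρ := id) differentiableAt_id rfl
    (by rw [fderiv_id]; rfl) (by rw [fderiv_id]; rfl) hr₁ hr₂

/-- The inverse of a chart is a plot relating a field to its chart expression. Hence a single chart
computes the bracket at all points of its domain, not only at its centre. -/
theorem mfderiv_chart_symm_lieBracket [CompleteSpace E] {x₀ : M} {z : E}
    (hz : z ∈ (extChartAt 𝓘(ℝ, E) x₀).target)
    {W Z : Π x : M, TangentSpace 𝓘(ℝ, E) x} (hW : W ∈ VectorField E M) (hZ : Z ∈ VectorField E M) :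
    mfderiv 𝓘(ℝ, E) 𝓘(ℝ, E) (extChartAt 𝓘(ℝ, E) x₀).symm z
      (VectorField.lieBracket ℝ (vecRep x₀ W) (vecRep x₀ Z) z : E) =
      VectorField.mlieBracket 𝓘(ℝ, E) W Z ((extChartAt 𝓘(ℝ, E) x₀).symm z) :=
  mlieBracket_of_related_plot (contMDiffAt_chart_symm hz)
    ((contDiffAt_vecRep hz hW).differentiableAt (by simp))
    ((contDiffAt_vecRep hz hZ).differentiableAt (by simp)) hW hZ
    (eventually_mfderiv_vecRep hz W) (eventually_mfderiv_vecRep hz Z)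

/-- Related vector fields have related Lie brackets. -/
theorem mfderiv_mlieBracket_of_related [CompleteSpace E] [CompleteSpace E'] {F : M → N}
    (hF : ContMDiff 𝓘(ℝ, E) 𝓘(ℝ, E') ∞ F)
    {W₁ W₂ : Π x : M, TangentSpace 𝓘(ℝ, E) x} {Z₁ Z₂ : Π x : N, TangentSpace 𝓘(ℝ, E') x}
    (hW₁ : W₁ ∈ VectorField E M) (hW₂ : W₂ ∈ VectorField E M)
    (hZ₁ : Z₁ ∈ VectorField E' N) (hZ₂ : Z₂ ∈ VectorField E' N)
    (hr₁ : ∀ x, mfderiv 𝓘(ℝ, E) 𝓘(ℝ, E') F x (W₁ x) = Z₁ (F x))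
    (hr₂ : ∀ x, mfderiv 𝓘(ℝ, E) 𝓘(ℝ, E') F x (W₂ x) = Z₂ (F x)) (x : M) :
    mfderiv 𝓘(ℝ, E) 𝓘(ℝ, E') F x (VectorField.mlieBracket 𝓘(ℝ, E) W₁ W₂ x) =
      VectorField.mlieBracket 𝓘(ℝ, E') Z₁ Z₂ (F x) := by
  set φ := extChartAt 𝓘(ℝ, E) x with hφ
  have hz : φ x ∈ φ.target := mem_extChartAt_target x
  have hzx : φ.symm (φ x) = x := extChartAt_to_inv x
  have hcomp : ∀ y ∈ φ.target, ∀ u : E, (mfderiv 𝓘(ℝ, E) 𝓘(ℝ, E') (F ∘ φ.symm) y u : E') =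
      mfderiv 𝓘(ℝ, E) 𝓘(ℝ, E') F (φ.symm y) (mfderiv 𝓘(ℝ, E) 𝓘(ℝ, E) φ.symm y u) := by
    intro y hy u
    exact DFunLike.congr_fun (mfderiv_comp y ((hF _).mdifferentiableAt (by simp))
      ((contMDiffAt_chart_symm hy).mdifferentiableAt (by simp))) u
  have hrel : ∀ (W : Π x : M, TangentSpace 𝓘(ℝ, E) x) (Z : Π x : N, TangentSpace 𝓘(ℝ, E') x),
      (∀ x, mfderiv 𝓘(ℝ, E) 𝓘(ℝ, E') F x (W x) = Z (F x)) → ∀ᶠ y in 𝓝 (φ x),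
      mfderiv 𝓘(ℝ, E) 𝓘(ℝ, E') (F ∘ φ.symm) y (vecRep x W y : E) = Z ((F ∘ φ.symm) y) := by
    intro W Z h
    filter_upwards [extChartAt_target_mem_nhds_of_mem hz] with y hy
    refine (hcomp y hy _).trans ?_
    rw [mfderiv_vecRep hy]
    exact h _
  have h := mlieBracket_of_related_plot (f := F ∘ φ.symm) (v := φ x)
    ((hF _).comp _ (contMDiffAt_chart_symm hz))
    ((contDiffAt_vecRep hz hW₁).differentiableAt (by simp))
    ((contDiffAt_vecRep hz hW₂).differentiableAt (by simp)) hZ₁ hZ₂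
    (hrel _ _ hr₁) (hrel _ _ hr₂)
  have h2 := (hcomp _ hz _).symm.trans h
  rw [mfderiv_chart_symm_lieBracket hz hW₁ hW₂] at h2
  have h3 : ∀ p q : M, p = q →
      (mfderiv 𝓘(ℝ, E) 𝓘(ℝ, E') F p (VectorField.mlieBracket 𝓘(ℝ, E) W₁ W₂ p) : E') =
      VectorField.mlieBracket 𝓘(ℝ, E') Z₁ Z₂ (F p) →
      (mfderiv 𝓘(ℝ, E) 𝓘(ℝ, E') F q (VectorField.mlieBracket 𝓘(ℝ, E) W₁ W₂ q) : E') =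
      VectorField.mlieBracket 𝓘(ℝ, E') Z₁ Z₂ (F q) := by
    rintro p _ rfl h
    exact h
  exact h3 _ _ hzx h2

/-- The chart and its inverse have mutually inverse derivatives at the centre, so no information is
lost. Identities of forms are reduced to normed spaces in this way. -/
theorem form_eq_of_chartRep_eq {k : ℕ} {η ζ : RawForm E M k} {x : M}
    (h : chartRep x η (extChartAt 𝓘(ℝ, E) x x) = chartRep x ζ (extChartAt 𝓘(ℝ, E) x x)) :
    η x = ζ x := by
  have hs := mem_extChartAt_source (I := 𝓘(ℝ, E)) x
  have key : ∀ θ : RawForm E M k, ∀ v : Fin k → E, (θ x : E [⋀^Fin k]→L[ℝ] ℝ) v =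
      chartRep x θ (extChartAt 𝓘(ℝ, E) x x) fun i =>
        (mfderiv 𝓘(ℝ, E) 𝓘(ℝ, E) (extChartAt 𝓘(ℝ, E) x) x : E →L[ℝ] E) (v i) := by
    intro θ v
    have h2 : ∀ p q : M, p = q → (θ p : E [⋀^Fin k]→L[ℝ] ℝ) = θ q := by rintro p _ rfl; rfl
    have h3 : ∀ i, (v i : E) = mfderiv 𝓘(ℝ, E) 𝓘(ℝ, E) (extChartAt 𝓘(ℝ, E) x).symm
      (extChartAt 𝓘(ℝ, E) x x) (mfderiv 𝓘(ℝ, E) 𝓘(ℝ, E) (extChartAt 𝓘(ℝ, E) x) x (v i)) :=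
      fun i => (mfderiv_chart_symm_chart hs (v i)).symm
    have h4 := h2 _ _ (extChartAt_to_inv (I := 𝓘(ℝ, E)) x).symm
    rw [h4]
    exact congrArg (θ ((extChartAt 𝓘(ℝ, E) x).symm (extChartAt 𝓘(ℝ, E) x x)) :
      E [⋀^Fin k]→L[ℝ] ℝ) (funext h3)
  exact ContinuousAlternatingMap.ext fun v =>
    (key η v).trans ((by rw [h] : _ = _).trans (key ζ v).symm)

theorem smoothFormAt_of_mem {k : ℕ} {η : RawForm E M k} (hη : η ∈ DiffForm E M k) (x : M) :
    SmoothFormAt η x := mem_diffForm_iff.1 hη x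

theorem extD_mem {k : ℕ} {η : RawForm E M k} (hη : η ∈ DiffForm E M k) :
    extD η ∈ DiffForm E M (k + 1) := by
  intro x₀ z hz
  have h := (smoothFormAt_of_mem hη _).contDiffAt_plotForm (contMDiffAt_chart_symm hz)
  refine ((contDiffAt_extDeriv h).congr_of_eventuallyEq ?_).contDiffWithinAt
  filter_upwards [extChartAt_target_mem_nhds_of_mem hz] with y hy
  exact ((smoothFormAt_of_mem hη _).extDeriv_plotForm (contMDiffAt_chart_symm hy)).symm

theorem contract_mem [CompleteSpace E] {k : ℕ} {η : RawForm E M (k + 1)}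
    (hη : η ∈ DiffForm E M (k + 1)) {W : Π x : M, TangentSpace 𝓘(ℝ, E) x}
    (hW : W ∈ VectorField E M) : contract W η ∈ DiffForm E M k := by
  intro x₀ z hz
  have h := (smoothFormAt_of_mem hη _).contDiffAt_plotForm (contMDiffAt_chart_symm hz)
  refine ((contDiffAt_curryLeft h (contDiffAt_vecRep hz hW)).congr_of_eventuallyEq
    ?_).contDiffWithinAt
  filter_upwards [extChartAt_target_mem_nhds_of_mem hz] with y hy
  exact plotForm_contract (mfderiv_vecRep hy W) η

theorem lieD_mem [CompleteSpace E] {k : ℕ} {η : RawForm E M (k + 1)}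
    (hη : η ∈ DiffForm E M (k + 1)) {W : Π x : M, TangentSpace 𝓘(ℝ, E) x}
    (hW : W ∈ VectorField E M) : lieD W η ∈ DiffForm E M (k + 1) :=
  add_mem (extD_mem (contract_mem hη hW)) (contract_mem (extD_mem hη) hW)

theorem SmoothFormAt.pullbackForm {k : ℕ} {η : RawForm E' N k} {F : M → N} {x : M}
    (hη : SmoothFormAt η (F x)) (hF : ContMDiffAt 𝓘(ℝ, E) 𝓘(ℝ, E') ∞ F x) :
    SmoothFormAt (pullbackForm F η : RawForm E M k) x := by
  have hz := mem_extChartAt_target (I := 𝓘(ℝ, E)) x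
  have hx := extChartAt_to_inv (I := 𝓘(ℝ, E)) x
  have hF' : ContMDiffAt 𝓘(ℝ, E) 𝓘(ℝ, E') ∞ F
      ((extChartAt 𝓘(ℝ, E) x).symm (extChartAt 𝓘(ℝ, E) x x)) := by rwa [hx]
  have hf := hF'.comp _ (contMDiffAt_chart_symm hz)
  have hη' : SmoothFormAt η ((F ∘ (extChartAt 𝓘(ℝ, E) x).symm) (extChartAt 𝓘(ℝ, E) x x)) := by
    simpa [hx] using hη
  refine (hη'.contDiffAt_plotForm hf).congr_of_eventuallyEq ?_
  have hc : Filter.Tendsto (extChartAt 𝓘(ℝ, E) x).symm (𝓝 (extChartAt 𝓘(ℝ, E) x x)) (𝓝 x) := by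
    have := (contMDiffAt_chart_symm hz).continuousAt.tendsto
    rwa [hx] at this
  have : IsManifold 𝓘(ℝ, E) 1 M := IsManifold.of_le (n := ∞) (by norm_cast)
  filter_upwards [extChartAt_target_mem_nhds_of_mem hz,
    hc.eventually (eventually_mdifferentiableAt hF)] with y hy hFy
  exact plotForm_pullbackForm hFy ((contMDiffAt_chart_symm hy).mdifferentiableAt (by simp)) η

theorem pullbackForm_mem {k : ℕ} {η : RawForm E' N k} (hη : η ∈ DiffForm E' N k) {F : M → N}
    (hF : ContMDiff 𝓘(ℝ, E) 𝓘(ℝ, E') ∞ F) : (pullbackForm F η : RawForm E M k) ∈ DiffForm E M k :=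
  mem_diffForm_iff.2 fun x => (smoothFormAt_of_mem hη _).pullbackForm (hF x)

theorem plotForm_pullbackForm_of_contMDiff {k : ℕ} {F : M → N}
    (hF : ContMDiff 𝓘(ℝ, E) 𝓘(ℝ, E') ∞ F) {x₀ : M} {z : E}
    (hz : z ∈ (extChartAt 𝓘(ℝ, E) x₀).target) (η : RawForm E' N k) :
    chartRep x₀ (pullbackForm F η : RawForm E M k) z =
      plotForm (F ∘ (extChartAt 𝓘(ℝ, E) x₀).symm) η z :=
  plotForm_pullbackForm ((hF _).mdifferentiableAt (by simp))
    ((contMDiffAt_chart_symm hz).mdifferentiableAt (by simp)) η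

theorem extDeriv_chartRep {k : ℕ} {η : RawForm E M k} (hη : η ∈ DiffForm E M k) {x₀ : M} {z : E}
    (hz : z ∈ (extChartAt 𝓘(ℝ, E) x₀).target) :
    extDeriv (chartRep x₀ η) z = chartRep x₀ (extD η) z :=
  (smoothFormAt_of_mem hη _).extDeriv_plotForm (contMDiffAt_chart_symm hz)

/-- The exterior derivative commutes with pullback. -/
theorem extD_pullbackForm {k : ℕ} {η : RawForm E' N k} (hη : η ∈ DiffForm E' N k) {F : M → N}
    (hF : ContMDiff 𝓘(ℝ, E) 𝓘(ℝ, E') ∞ F) :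
    extD (pullbackForm F η : RawForm E M k) = pullbackForm F (extD η) := by
  funext x
  refine form_eq_of_chartRep_eq ?_
  have hz := mem_extChartAt_target (I := 𝓘(ℝ, E)) x
  rw [← extDeriv_chartRep (pullbackForm_mem hη hF) hz, plotForm_pullbackForm_of_contMDiff hF hz]
  have h : chartRep x (pullbackForm F η : RawForm E M k) =ᶠ[𝓝 (extChartAt 𝓘(ℝ, E) x x)]
      plotForm (F ∘ (extChartAt 𝓘(ℝ, E) x).symm) η := by
    filter_upwards [extChartAt_target_mem_nhds_of_mem hz] with y hy
    exact plotForm_pullbackForm_of_contMDiff hF hy η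
  rw [h.extDeriv_eq]
  exact (smoothFormAt_of_mem hη _).extDeriv_plotForm ((hF _).comp _ (contMDiffAt_chart_symm hz))

theorem extD_add {k : ℕ} {η ζ : RawForm E M k} (hη : η ∈ DiffForm E M k) (hζ : ζ ∈ DiffForm E M k) :
    extD (η + ζ) = extD η + extD ζ := by
  funext x
  have h : ∀ θ ∈ DiffForm E M k, DifferentiableAt ℝ (chartRep x θ) (extChartAt 𝓘(ℝ, E) x x) :=
    fun θ hθ => ContDiffAt.differentiableAt (smoothFormAt_of_mem hθ x) (by simp)
  simp only [extD, chartRep_add, Pi.add_apply]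
  rw [extDeriv_add (h η hη) (h ζ hζ)]
  rfl

theorem extD_smul {k : ℕ} (c : ℝ) (η : RawForm E M k) : extD (c • η) = c • extD η := by
  funext x
  simp only [extD, chartRep_smul, Pi.smul_apply]
  rw [extDeriv_smul]
  rfl

theorem extD_neg {k : ℕ} (η : RawForm E M k) : extD (-η) = -extD η := by
  have h := extD_smul (-1) η
  have e : ∀ {j : ℕ} (θ : RawForm E M j), (-1 : ℝ) • θ = -θ := fun θ => neg_one_smul ℝ θ
  rwa [e, e] at h

theorem extD_sub {k : ℕ} {η ζ : RawForm E M k} (hη : η ∈ DiffForm E M k) (hζ : ζ ∈ DiffForm E M k) :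
    extD (η - ζ) = extD η - extD ζ := by
  rw [sub_eq_add_neg, extD_add hη (neg_mem hζ), extD_neg, sub_eq_add_neg]

theorem contract_form_add {k : ℕ} (W : Π x : M, TangentSpace 𝓘(ℝ, E) x)
    (η ζ : RawForm E M (k + 1)) : contract W (η + ζ) = contract W η + contract W ζ := rfl

theorem contract_form_sub {k : ℕ} (W : Π x : M, TangentSpace 𝓘(ℝ, E) x)
    (η ζ : RawForm E M (k + 1)) : contract W (η - ζ) = contract W η - contract W ζ := rfl

theorem contract_form_smul {k : ℕ} (W : Π x : M, TangentSpace 𝓘(ℝ, E) x) (c : ℝ)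
    (η : RawForm E M (k + 1)) : contract W (c • η) = c • contract W η := rfl

theorem lieD_form_add [CompleteSpace E] {k : ℕ} {W : Π x : M, TangentSpace 𝓘(ℝ, E) x}
    (hW : W ∈ VectorField E M) {η ζ : RawForm E M (k + 1)} (hη : η ∈ DiffForm E M (k + 1))
    (hζ : ζ ∈ DiffForm E M (k + 1)) : lieD W (η + ζ) = lieD W η + lieD W ζ := by
  rw [lieD, contract_form_add, extD_add (contract_mem hη hW) (contract_mem hζ hW), extD_add hη hζ,
    contract_form_add, lieD, lieD]
  abel

theorem lieD_form_smul {k : ℕ} (W : Π x : M, TangentSpace 𝓘(ℝ, E) x) (c : ℝ)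
    (η : RawForm E M (k + 1)) : lieD W (c • η) = c • lieD W η := by
  rw [lieD, contract_form_smul, extD_smul, extD_smul, contract_form_smul, lieD, smul_add]

theorem lieD_form_neg {k : ℕ} (W : Π x : M, TangentSpace 𝓘(ℝ, E) x)
    (η : RawForm E M (k + 1)) : lieD W (-η) = -lieD W η := by
  have h := lieD_form_smul W (-1) η
  have e : ∀ θ : RawForm E M (k + 1), (-1 : ℝ) • θ = -θ := fun θ => neg_one_smul ℝ θ
  rwa [e, e] at h

theorem lieD_form_sub [CompleteSpace E] {k : ℕ} {W : Π x : M, TangentSpace 𝓘(ℝ, E) x}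
    (hW : W ∈ VectorField E M) {η ζ : RawForm E M (k + 1)} (hη : η ∈ DiffForm E M (k + 1))
    (hζ : ζ ∈ DiffForm E M (k + 1)) : lieD W (η - ζ) = lieD W η - lieD W ζ := by
  rw [sub_eq_add_neg, lieD_form_add hW hη (neg_mem hζ), lieD_form_neg, sub_eq_add_neg]

/-- The interior product is compatible with pullback along a map relating the vector fields. -/
theorem pullbackForm_contract {k : ℕ} {F : M → N} {W : Π x : M, TangentSpace 𝓘(ℝ, E) x}
    {Z : Π x : N, TangentSpace 𝓘(ℝ, E') x}
    (h : ∀ x, mfderiv 𝓘(ℝ, E) 𝓘(ℝ, E') F x (W x) = Z (F x)) (η : RawForm E' N (k + 1)) :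
    contract W (pullbackForm F η : RawForm E M (k + 1)) = pullbackForm F (contract Z η) := by
  funext x
  ext u
  change (η (F x)) _ = (η (F x)) (Fin.cons (Z (F x)) _)
  congr 1
  funext i
  refine Fin.cases ?_ (fun j => ?_) i
  · exact h x
  · rfl

/-- The Lie derivative is compatible with pullback along a map relating the vector fields. -/
theorem lieD_pullbackForm [CompleteSpace E'] {k : ℕ} {F : M → N}
    (hF : ContMDiff 𝓘(ℝ, E) 𝓘(ℝ, E') ∞ F)
    {W : Π x : M, TangentSpace 𝓘(ℝ, E) x} {Z : Π x : N, TangentSpace 𝓘(ℝ, E') x}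
    (hZ : Z ∈ VectorField E' N)
    (h : ∀ x, mfderiv 𝓘(ℝ, E) 𝓘(ℝ, E') F x (W x) = Z (F x)) {η : RawForm E' N (k + 1)}
    (hη : η ∈ DiffForm E' N (k + 1)) :
    lieD W (pullbackForm F η : RawForm E M (k + 1)) = pullbackForm F (lieD Z η) := by
  rw [lieD, pullbackForm_contract h, extD_pullbackForm (contract_mem hη hZ) hF,
    extD_pullbackForm hη hF, pullbackForm_contract h]
  rfl

/-- The field `w` is left free, subject only to being related to `W`, so that a Lie bracket of chart
expressions can be inserted for the expression of a Lie bracket. -/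
theorem chartRep_lieD [CompleteSpace E] {k : ℕ} {η : RawForm E M (k + 1)}
    (hη : η ∈ DiffForm E M (k + 1)) {W : Π x : M, TangentSpace 𝓘(ℝ, E) x}
    (hW : W ∈ VectorField E M) {x₀ : M} {z : E} (hz : z ∈ (extChartAt 𝓘(ℝ, E) x₀).target)
    {w : E → E} (hw : ∀ y ∈ (extChartAt 𝓘(ℝ, E) x₀).target,
      mfderiv 𝓘(ℝ, E) 𝓘(ℝ, E) (extChartAt 𝓘(ℝ, E) x₀).symm y (w y : E) =
        W ((extChartAt 𝓘(ℝ, E) x₀).symm y)) :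
    chartRep x₀ (lieD W η) z = vecLieD w (chartRep x₀ η) z := by
  have h1 : chartRep x₀ (contract W η) =ᶠ[𝓝 z] fun y => (chartRep x₀ η y).curryLeft (w y) := by
    filter_upwards [extChartAt_target_mem_nhds_of_mem hz] with y hy
    exact plotForm_contract (hw y hy) η
  rw [vecLieD, ← h1.extDeriv_eq, extDeriv_chartRep (contract_mem hη hW) hz,
    extDeriv_chartRep hη hz, lieD, chartRep_add, Pi.add_apply]
  congr 1
  exact plotForm_contract (hw z hz) _

/-- The Lie derivative along a Lie bracket is the commutator of Lie derivatives. -/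
theorem lieD_mlieBracket [CompleteSpace E] {η : RawForm E M 1} (hη : η ∈ DiffForm E M 1)
    {W Z : Π x : M, TangentSpace 𝓘(ℝ, E) x} (hW : W ∈ VectorField E M) (hZ : Z ∈ VectorField E M) :
    lieD (VectorField.mlieBracket 𝓘(ℝ, E) W Z) η = lieD W (lieD Z η) - lieD Z (lieD W η) := by
  funext x
  refine form_eq_of_chartRep_eq ?_
  have hz := mem_extChartAt_target (I := 𝓘(ℝ, E)) x
  have hW' := contDiffAt_vecRep hz hW
  have hZ' := contDiffAt_vecRep hz hZ
  have ha : ContDiffAt ℝ ∞ (chartRep x η) (extChartAt 𝓘(ℝ, E) x x) := smoothFormAt_of_mem hη x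
  have hlie : ∀ W ∈ VectorField E M, ∀ ζ ∈ DiffForm E M 1,
      chartRep x (lieD W ζ) =ᶠ[𝓝 (extChartAt 𝓘(ℝ, E) x x)] vecLieD (vecRep x W) (chartRep x ζ) := by
    intro W hW ζ hζ
    filter_upwards [extChartAt_target_mem_nhds_of_mem hz] with y hy
    exact chartRep_lieD hζ hW hy fun y hy => mfderiv_vecRep hy W
  have h0 := chartRep_lieD hη (mlieBracket_mem hW hZ) hz
    (w := VectorField.lieBracket ℝ (vecRep x W) (vecRep x Z))
    fun y hy => mfderiv_chart_symm_lieBracket hy hW hZ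
  have hcov : ∀ {a b : E → E [⋀^Fin 1]→L[ℝ] ℝ} {y : E}, covector a y = covector b y → a y = b y :=
    fun h => (ContinuousAlternatingMap.ofSubsingletonLIE (𝕜 := ℝ) (E := E) (F := ℝ)
      (ι := Fin 1) (0 : Fin 1)).symm.injective h
  -- The identity is needed on a neighbourhood, since the outer Lie derivative differentiates the
  -- inner one.
  have hcl : ∀ W ∈ VectorField E M, covector (chartRep x (lieD W η)) =ᶠ[𝓝 (extChartAt 𝓘(ℝ, E) x x)]
      covectorLieD (vecRep x W) (covector (chartRep x η)) := by
    intro W hW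
    filter_upwards [extChartAt_target_mem_nhds_of_mem hz, hlie W hW η hη] with y hy hy'
    have h1 : ContDiffAt ℝ ∞ (chartRep x η) y :=
      (smoothFormAt_of_mem hη _).contDiffAt_plotForm (contMDiffAt_chart_symm hy)
    rw [← covector_vecLieD (contDiffAt_vecRep hy hW) h1]
    simp only [covector, hy']
  have hcc : ∀ W₁ ∈ VectorField E M, ∀ W₂ ∈ VectorField E M,
      covector (chartRep x (lieD W₁ (lieD W₂ η))) (extChartAt 𝓘(ℝ, E) x x) =
      covectorLieD (vecRep x W₁) (covectorLieD (vecRep x W₂) (covector (chartRep x η)))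
        (extChartAt 𝓘(ℝ, E) x x) := by
    intro W₁ hW₁ W₂ hW₂
    have h1 := (hlie W₁ hW₁ _ (lieD_mem hη hW₂)).self_of_nhds
    have h2 : covector (chartRep x (lieD W₁ (lieD W₂ η))) (extChartAt 𝓘(ℝ, E) x x) =
        covector (vecLieD (vecRep x W₁) (chartRep x (lieD W₂ η))) (extChartAt 𝓘(ℝ, E) x x) := by
      simp only [covector, h1]
    rw [h2, covector_vecLieD (contDiffAt_vecRep hz hW₁) (smoothFormAt_of_mem (lieD_mem hη hW₂) x),
      covectorLieD, covectorLieD, (hcl W₂ hW₂).fderiv_eq, (hcl W₂ hW₂).self_of_nhds]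
  rw [h0]
  refine hcov (b := chartRep x (lieD W (lieD Z η) - lieD Z (lieD W η))) ?_
  have hbr : ContDiffAt ℝ ∞ (VectorField.lieBracket ℝ (vecRep x W) (vecRep x Z))
      (extChartAt 𝓘(ℝ, E) x x) :=
    ContDiffAt.lieBracket_vectorField (n := ∞) hW' hZ' (by norm_cast)
  rw [covector_vecLieD hbr ha, covectorLieD_lieBracket hW' hZ' (contDiffAt_covector ha),
    ← hcc _ hW _ hZ, ← hcc _ hZ _ hW]
  rfl

end ManifoldCalculus

end Gerbe

namespace Gerbe

/-! ### Local sections of submersions, and tangent vectors as velocities -/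

section Submersion

variable {E : Type*} [NormedAddCommGroup E] [NormedSpace ℝ E]
  {M : Type*} [TopologicalSpace M] [ChartedSpace E M] [IsManifold 𝓘(ℝ, E) ∞ M]
  {E' : Type*} [NormedAddCommGroup E'] [NormedSpace ℝ E']
  {N : Type*} [TopologicalSpace N] [ChartedSpace E' N] [IsManifold 𝓘(ℝ, E') ∞ N]

/-- A family of local sections of a submersion `s`, depending smoothly on a point through which
the section passes: `toFun (h, x)` lies over `x` and `toFun (h, s h) = h`. -/
structure LocalLift (s : M → N) where
  dom : Set (M × N)
  toFun : M × N → M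
  isOpen_dom : IsOpen dom
  contMDiffOn : ContMDiffOn (𝓘(ℝ, E).prod 𝓘(ℝ, E')) 𝓘(ℝ, E) ∞ toFun dom
  apply_toFun : ∀ q ∈ dom, s (toFun q) = q.2
  toFun_self : ∀ h, (h, s h) ∈ dom → toFun (h, s h) = h

/-- In submersion charts `s` is the projection to the first factor of a product. The lift keeps the
fibre coordinate of the given point and replaces its base coordinate by that of `x`. -/
theorem exists_localLift {s : M → N} (hs : Manifold.IsSubmersion 𝓘(ℝ, E) 𝓘(ℝ, E') ∞ s) (h₀ : M) :
    ∃ r : LocalLift (E := E) (E' := E') s, (h₀, s h₀) ∈ r.dom := by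
  obtain ⟨F, _, _, hF⟩ := hs
  have h := hF h₀
  set φ := h.domChart
  set ψ := h.codChart
  set e := h.equiv
  have hw : ∀ z ∈ φ.target, ψ (s (φ.symm z)) = (e z).1 := fun z hz =>
    h.writtenInCharts (by simpa using hz)
  have hc : ContMDiffOn (𝓘(ℝ, E).prod 𝓘(ℝ, E')) 𝓘(ℝ, E) ∞
      (fun q : M × N => e.symm (ψ q.2, (e (φ q.1)).2)) (φ.source ×ˢ ψ.source) := by
    have h1 : ContMDiffOn (𝓘(ℝ, E).prod 𝓘(ℝ, E')) 𝓘(ℝ, E) ∞ (fun q : M × N => φ q.1)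
        (φ.source ×ˢ ψ.source) :=
      (contMDiffOn_of_mem_maximalAtlas h.domChart_mem_maximalAtlas).comp
        contMDiff_fst.contMDiffOn fun q hq => hq.1
    have h2 : ContMDiffOn (𝓘(ℝ, E).prod 𝓘(ℝ, E')) 𝓘(ℝ, E') ∞ (fun q : M × N => ψ q.2)
        (φ.source ×ˢ ψ.source) :=
      (contMDiffOn_of_mem_maximalAtlas h.codChart_mem_maximalAtlas).comp
        contMDiff_snd.contMDiffOn fun q hq => hq.2
    have h3 := h2.prodMk_space h1
    have h4 : ContDiff ℝ ∞ fun p : E' × E => e.symm (p.1, (e p.2).2) := by fun_prop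
    exact h4.contMDiff.comp_contMDiffOn h3
  -- The domain also requires the new coordinates to stay in the chart target, where the chart can
  -- be inverted.
  refine ⟨⟨(φ.source ×ˢ ψ.source) ∩ (fun q : M × N => e.symm (ψ q.2, (e (φ q.1)).2)) ⁻¹' φ.target,
    fun q => φ.symm (e.symm (ψ q.2, (e (φ q.1)).2)), ?_, ?_, ?_, ?_⟩, ?_⟩
  · exact hc.continuousOn.isOpen_inter_preimage (φ.open_source.prod ψ.open_source) φ.open_target
  · exact (contMDiffOn_symm_of_mem_maximalAtlas h.domChart_mem_maximalAtlas).comp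
      (hc.mono inter_subset_left) fun q hq => hq.2
  · rintro ⟨k, x⟩ ⟨⟨hk, hx⟩, hz⟩
    refine ψ.injOn (h.source_subset_preimage_source (φ.map_target hz)) hx ?_
    rw [hw _ hz]
    simp
  · rintro k ⟨⟨hk, hx⟩, hz⟩
    have h5 := hw _ (φ.map_source hk)
    rw [φ.left_inv hk] at h5
    simp only [h5, Prod.mk.eta, ContinuousLinearEquiv.symm_apply_apply]
    exact φ.left_inv hk
  · have hk := h.mem_domChart_source
    refine ⟨⟨hk, h.mem_codChart_source⟩, ?_⟩
    have h5 := hw _ (φ.map_source hk)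
    rw [φ.left_inv hk] at h5
    simp only [mem_preimage, h5, Prod.mk.eta, ContinuousLinearEquiv.symm_apply_apply]
    exact φ.map_source hk

namespace LocalLift

variable {s : M → N} (r : LocalLift (E := E) (E' := E') s)

theorem contMDiffAt {q : M × N} (hq : q ∈ r.dom) :
    ContMDiffAt (𝓘(ℝ, E).prod 𝓘(ℝ, E')) 𝓘(ℝ, E) ∞ r.toFun q :=
  r.contMDiffOn.contMDiffAt (r.isOpen_dom.mem_nhds hq)

theorem mdifferentiableAt {q : M × N} (hq : q ∈ r.dom) :
    MDifferentiableAt (𝓘(ℝ, E).prod 𝓘(ℝ, E')) 𝓘(ℝ, E) r.toFun q :=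
  (r.contMDiffAt hq).mdifferentiableAt (by simp)

/-- Differentiate the identity `toFun (k, s k) = k` along the graph of `s`. -/
theorem mfderiv_self {h : M} (hs : MDifferentiableAt 𝓘(ℝ, E) 𝓘(ℝ, E') s h)
    (hq : (h, s h) ∈ r.dom) (u : E) :
    (mfderiv (𝓘(ℝ, E).prod 𝓘(ℝ, E')) 𝓘(ℝ, E) r.toFun (h, s h)
      ((u, mfderiv 𝓘(ℝ, E) 𝓘(ℝ, E') s h u) : E × E') : E) = u := by
  have h1 : HasMFDerivAt 𝓘(ℝ, E) (𝓘(ℝ, E).prod 𝓘(ℝ, E')) (fun k => (k, s k)) h _ :=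
    (hasMFDerivAt_id h).prodMk hs.hasMFDerivAt
  have h2 := (r.mdifferentiableAt hq).hasMFDerivAt.comp h h1
  have h3 : r.toFun ∘ (fun k => (k, s k)) =ᶠ[𝓝 h] id := by
    have : ContinuousAt (fun k => (k, s k)) h := h1.continuousAt
    filter_upwards [this.preimage_mem_nhds (r.isOpen_dom.mem_nhds hq)] with k hk
    exact r.toFun_self k hk
  have h4 := (h2.congr_of_eventuallyEq h3.symm).mfderiv
  have h5 := hasMFDerivAt_unique (hasMFDerivAt_id h) (h2.congr_of_eventuallyEq h3.symm)
  exact (DFunLike.congr_fun h5 u).symm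

end LocalLift

theorem mfderiv_chart_symm_self {x : M} (u : TangentSpace 𝓘(ℝ, E) x) :
    ∃ v : E, (mfderiv 𝓘(ℝ, E) 𝓘(ℝ, E) (extChartAt 𝓘(ℝ, E) x).symm (extChartAt 𝓘(ℝ, E) x x) v : E)
      = u :=
  ⟨_, mfderiv_chart_symm_chart (mem_extChartAt_source x) u⟩

/-- Every tangent vector is the velocity of a smooth curve. -/
theorem exists_curve (x : M) (u : TangentSpace 𝓘(ℝ, E) x) :
    ∃ c : ℝ → M, c 0 = x ∧ ContMDiffAt 𝓘(ℝ, ℝ) 𝓘(ℝ, E) ∞ c 0 ∧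
      (mfderiv 𝓘(ℝ, ℝ) 𝓘(ℝ, E) c 0 (1 : ℝ) : E) = u := by
  obtain ⟨v, hv⟩ := mfderiv_chart_symm_self u
  have hz := mem_extChartAt_target (I := 𝓘(ℝ, E)) x
  have h1 : ContDiff ℝ ∞ fun τ : ℝ => extChartAt 𝓘(ℝ, E) x x + τ • v := by fun_prop
  have h0 : extChartAt 𝓘(ℝ, E) x x + (0 : ℝ) • v = extChartAt 𝓘(ℝ, E) x x := by simp
  have h2 : ContMDiffAt 𝓘(ℝ, E) 𝓘(ℝ, E) ∞ (extChartAt 𝓘(ℝ, E) x).symm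
      (extChartAt 𝓘(ℝ, E) x x + (0 : ℝ) • v) := by
    rw [h0]
    exact contMDiffAt_chart_symm hz
  refine ⟨(extChartAt 𝓘(ℝ, E) x).symm ∘ fun τ : ℝ => extChartAt 𝓘(ℝ, E) x x + τ • v, ?_, ?_, ?_⟩
  · simp
  · exact h2.comp (0 : ℝ) h1.contMDiff.contMDiffAt
  · have h3 := mfderiv_comp (0 : ℝ) (h2.mdifferentiableAt (by simp))
      (h1.contMDiff.contMDiffAt.mdifferentiableAt (by simp))
    rw [h3]
    have h4 : HasFDerivAt (fun τ : ℝ => extChartAt 𝓘(ℝ, E) x x + τ • v)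
        ((1 : ℝ →L[ℝ] ℝ).smulRight v) 0 :=
      ((hasFDerivAt_id (0 : ℝ)).smul_const v).const_add _
    change (mfderiv 𝓘(ℝ, E) 𝓘(ℝ, E) (extChartAt 𝓘(ℝ, E) x).symm
      (extChartAt 𝓘(ℝ, E) x x + (0 : ℝ) • v) : E →L[ℝ] E) ((mfderiv 𝓘(ℝ, ℝ) 𝓘(ℝ, E)
        (fun τ : ℝ => extChartAt 𝓘(ℝ, E) x x + τ • v) 0 : ℝ →L[ℝ] E) 1) = u
    rw [mfderiv_eq_fderiv, h4.fderiv, h0]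
    have h5 : ((1 : ℝ →L[ℝ] ℝ).smulRight v) 1 = v := by simp
    exact (congrArg _ h5).trans hv

/-- Every vector tangent to a fibre of a submersion is the velocity of a curve in that fibre. -/
theorem exists_fibre_curve {s : M → N} (hs : Manifold.IsSubmersion 𝓘(ℝ, E) 𝓘(ℝ, E') ∞ s) (h : M)
    (u : TangentSpace 𝓘(ℝ, E) h) (hu : (mfderiv 𝓘(ℝ, E) 𝓘(ℝ, E') s h u : E') = 0) :
    ∃ c : ℝ → M, c 0 = h ∧ ContMDiffAt 𝓘(ℝ, ℝ) 𝓘(ℝ, E) ∞ c 0 ∧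
      (mfderiv 𝓘(ℝ, ℝ) 𝓘(ℝ, E) c 0 (1 : ℝ) : E) = u ∧ ∀ᶠ τ in 𝓝 0, s (c τ) = s h := by
  obtain ⟨r, hr⟩ := exists_localLift hs h
  obtain ⟨c, hc0, hc, hcu⟩ := exists_curve h u
  subst hc0
  have h1 : ContMDiffAt 𝓘(ℝ, ℝ) (𝓘(ℝ, E).prod 𝓘(ℝ, E')) ∞ (fun τ => (c τ, s (c 0))) 0 :=
    hc.prodMk contMDiffAt_const
  -- An arbitrary curve with velocity `u` is pushed into the fibre by the local lift. Because `ds u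
  -- = 0`, the vector `(u, 0)` equals `(u, ds u)`, which the derivative of the lift sends back to
  -- `u`.
  refine ⟨fun τ => r.toFun (c τ, s (c 0)), r.toFun_self _ hr, (r.contMDiffAt hr).comp (0 : ℝ) h1,
    ?_, ?_⟩
  · have h2 := (r.mdifferentiableAt hr).hasMFDerivAt.comp (0 : ℝ)
      ((hc.mdifferentiableAt (by simp)).hasMFDerivAt.prodMk (hasMFDerivAt_const (s (c 0)) (0 : ℝ)))
    have h3 := DFunLike.congr_fun h2.mfderiv (1 : ℝ)
    refine Eq.trans h3 ?_
    have h4 := r.mfderiv_self (hs.contMDiff.contMDiffAt.mdifferentiableAt (by simp)) hr u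
    rw [hu] at h4
    refine Eq.trans ?_ h4
    change (mfderiv (𝓘(ℝ, E).prod 𝓘(ℝ, E')) 𝓘(ℝ, E) r.toFun (c 0, s (c 0)) : E × E' →L[ℝ] E)
      ((mfderiv 𝓘(ℝ, ℝ) 𝓘(ℝ, E) c 0 (1 : ℝ) : E), (0 : E')) = _
    rw [hcu]
    rfl
  · filter_upwards [h1.continuousAt.preimage_mem_nhds (r.isOpen_dom.mem_nhds hr)] with τ hτ
    exact r.apply_toFun _ hτ

section Velocity

variable (E) in
/-- The velocity at `0` of a curve. -/
def velocity (c : ℝ → M) : E := (mfderiv 𝓘(ℝ, ℝ) 𝓘(ℝ, E) c 0 (1 : ℝ) : E)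

theorem velocity_congr {c c' : ℝ → M} (h : c =ᶠ[𝓝 0] c') : velocity E c = velocity E c' :=
  DFunLike.congr_fun (h.mfderiv_eq : (mfderiv 𝓘(ℝ, ℝ) 𝓘(ℝ, E) c 0 : ℝ →L[ℝ] E) =
    mfderiv 𝓘(ℝ, ℝ) 𝓘(ℝ, E) c' 0) (1 : ℝ)

theorem velocity_const (x : M) : velocity E (fun _ : ℝ => x) = 0 := by
  rw [velocity, mfderiv_const]
  rfl

theorem velocity_of_eventually_const {c : ℝ → M} {x : M} (h : ∀ᶠ τ in 𝓝 0, c τ = x) :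
    velocity E c = 0 :=
  (velocity_congr h).trans (velocity_const x)

variable {EQ HQ Q : Type*} [NormedAddCommGroup EQ] [NormedSpace ℝ EQ] [TopologicalSpace HQ]
  {I : ModelWithCorners ℝ EQ HQ} [TopologicalSpace Q] [ChartedSpace HQ Q]

/-- A derivative within `S` may be non-unique as a linear map, but its value on the derivative of a
map that stays in `S` is forced: the composite is differentiable on a full neighbourhood, where
derivatives are unique. -/
theorem mfderivWithin_comp_apply {f : M → N} {S : Set M} {x : M}
    (hf : MDifferentiableWithinAt 𝓘(ℝ, E) 𝓘(ℝ, E') f S x) {c : Q → M} {y : Q}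
    (hc : MDifferentiableAt I 𝓘(ℝ, E) c y) (hcx : c y = x) (hS : ∀ᶠ w in 𝓝 y, c w ∈ S)
    (v : EQ) :
    (mfderivWithin 𝓘(ℝ, E) 𝓘(ℝ, E') f S x (mfderiv I 𝓘(ℝ, E) c y v : E) : E') =
      mfderiv I 𝓘(ℝ, E') (fun w => f (c w)) y v := by
  subst hcx
  have h1 : HasMFDerivWithinAt I 𝓘(ℝ, E) c {w | c w ∈ S} y _ := hc.hasMFDerivAt.hasMFDerivWithinAt
  have h2 := hf.hasMFDerivWithinAt.comp y h1 fun w hw => hw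
  exact (DFunLike.congr_fun (h2.hasMFDerivAt hS).mfderiv v).symm

theorem mfderiv_comp_apply_of_eq {f : M → N} {x : M}
    (hf : MDifferentiableAt 𝓘(ℝ, E) 𝓘(ℝ, E') f x) {c : Q → M} {y : Q}
    (hc : MDifferentiableAt I 𝓘(ℝ, E) c y) (hcx : c y = x) (v : EQ) :
    (mfderiv 𝓘(ℝ, E) 𝓘(ℝ, E') f x (mfderiv I 𝓘(ℝ, E) c y v : E) : E') =
      mfderiv I 𝓘(ℝ, E') (fun w => f (c w)) y v := by
  subst hcx
  exact (DFunLike.congr_fun (mfderiv_comp y hf hc) v).symm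

theorem mfderivWithin_velocity {f : M → N} {S : Set M} {x : M}
    (hf : MDifferentiableWithinAt 𝓘(ℝ, E) 𝓘(ℝ, E') f S x) {c : ℝ → M}
    (hc : ContMDiffAt 𝓘(ℝ, ℝ) 𝓘(ℝ, E) ∞ c 0) (hcx : c 0 = x) (hS : ∀ᶠ τ in 𝓝 0, c τ ∈ S) :
    (mfderivWithin 𝓘(ℝ, E) 𝓘(ℝ, E') f S x (velocity E c) : E') =
      velocity E' (fun τ => f (c τ)) :=
  mfderivWithin_comp_apply hf (hc.mdifferentiableAt (by simp)) hcx hS (1 : ℝ)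

theorem mfderiv_velocity {f : M → N} {x : M}
    (hf : MDifferentiableAt 𝓘(ℝ, E) 𝓘(ℝ, E') f x) {c : ℝ → M}
    (hc : ContMDiffAt 𝓘(ℝ, ℝ) 𝓘(ℝ, E) ∞ c 0) (hcx : c 0 = x) :
    (mfderiv 𝓘(ℝ, E) 𝓘(ℝ, E') f x (velocity E c) : E') = velocity E' (fun τ => f (c τ)) :=
  mfderiv_comp_apply_of_eq hf (hc.mdifferentiableAt (by simp)) hcx (1 : ℝ)

end Velocity

end Submersion

/-! ### Groupoid algebra and products of tangent vectors along plots -/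

section Groupoid

namespace LieGroupoid

variable {EX EP X P : Type*}
  [NormedAddCommGroup EX] [NormedSpace ℝ EX] [TopologicalSpace X] [ChartedSpace EX X]
  [NormedAddCommGroup EP] [NormedSpace ℝ EP] [TopologicalSpace P] [ChartedSpace EP P]
  [IsManifold 𝓘(ℝ, EX) ∞ X] [IsManifold 𝓘(ℝ, EP) ∞ P]
  (G : LieGroupoid EX EP X P)

theorem eq_inv_of_mul_eq_unit {g h : P} (hgh : G.src g = G.tgt h)
    (hm : G.mul g h = G.unit (G.tgt g)) : h = G.inv g := by
  rw [← G.unit_mul h, ← hgh, ← G.inv_mul g, G.mul_assoc _ _ _ (G.src_inv g) hgh, hm,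
    ← G.src_inv g, G.mul_unit]

theorem inv_inv (g : P) : G.inv (G.inv g) = g :=
  (G.eq_inv_of_mul_eq_unit (G.src_inv g) (by rw [G.inv_mul, G.tgt_inv])).symm

theorem inv_unit (x : X) : G.inv (G.unit x) = G.unit x := by
  refine (G.eq_inv_of_mul_eq_unit (by rw [G.src_unit, G.tgt_unit]) ?_).symm
  have := G.unit_mul (G.unit x)
  rwa [G.tgt_unit] at this ⊢

/-- This carries left-invariant fields to right-invariant ones under inversion. -/
theorem inv_mul_inv {k g : P} (h : G.src k = G.src g) :
    G.inv (G.mul k (G.inv g)) = G.mul g (G.inv k) := by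
  have h1 : G.src k = G.tgt (G.inv g) := by rw [G.tgt_inv, h]
  have h2 : G.src g = G.tgt (G.inv k) := by rw [G.tgt_inv, h]
  have h3 : G.src (G.inv g) = G.tgt (G.mul g (G.inv k)) := by rw [G.src_inv, G.tgt_mul _ _ h2]
  refine (G.eq_inv_of_mul_eq_unit ?_ ?_).symm
  · rw [G.src_mul _ _ h1, h3]
  · rw [G.mul_assoc _ _ _ h1 h3, ← G.mul_assoc _ _ _ (G.src_inv g) h2, G.inv_mul, h2, G.unit_mul,
      G.mul_inv, G.tgt_mul _ _ h1]

/-- The cancellation whose derivative is `tangentMul_leftField_rightField`. -/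
theorem mul_inv_mul_mul {k g h : P} (h1 : G.src k = G.src g) (h2 : G.src g = G.tgt h) :
    G.mul (G.mul g (G.inv k)) (G.mul k h) = G.mul g h := by
  have e1 : G.src g = G.tgt (G.inv k) := by rw [G.tgt_inv, h1]
  have e2 : G.src k = G.tgt h := h1.trans h2
  rw [G.mul_assoc _ _ _ e1 (by rw [G.src_inv, G.tgt_mul _ _ e2]),
    ← G.mul_assoc _ _ _ (G.src_inv k) e2, G.inv_mul, e2, G.unit_mul]

theorem mdifferentiable_src : MDifferentiable 𝓘(ℝ, EP) 𝓘(ℝ, EX) G.src :=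
  G.isSubmersion_src.contMDiff.mdifferentiable (by simp)

theorem mdifferentiable_tgt : MDifferentiable 𝓘(ℝ, EP) 𝓘(ℝ, EX) G.tgt :=
  G.isSubmersion_tgt.contMDiff.mdifferentiable (by simp)

theorem mdifferentiable_inv : MDifferentiable 𝓘(ℝ, EP) 𝓘(ℝ, EP) G.inv :=
  G.contMDiff_inv.mdifferentiable (by simp)

theorem mdifferentiable_unit : MDifferentiable 𝓘(ℝ, EX) 𝓘(ℝ, EP) G.unit :=
  G.contMDiff_unit.mdifferentiable (by simp)

section Plots

variable {EQ HQ Q : Type*} [NormedAddCommGroup EQ] [NormedSpace ℝ EQ] [TopologicalSpace HQ]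
  {I : ModelWithCorners ℝ EQ HQ} [TopologicalSpace Q] [ChartedSpace HQ Q]

/-- Multiplication is smooth only within the composable pairs. Two maps that remain composable near
`y` factor through that set on a neighbourhood, so their product is smooth in the ordinary sense. -/
theorem contMDiffAt_mul {α β : Q → P} {y : Q} (hα : ContMDiffAt I 𝓘(ℝ, EP) ∞ α y)
    (hβ : ContMDiffAt I 𝓘(ℝ, EP) ∞ β y) (hc : ∀ᶠ w in 𝓝 y, G.src (α w) = G.tgt (β w)) :
    ContMDiffAt I 𝓘(ℝ, EP) ∞ (fun w => G.mul (α w) (β w)) y := by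
  have h0 : ContMDiffWithinAt I (𝓘(ℝ, EP).prod 𝓘(ℝ, EP)) ∞ (fun w => (α w, β w))
      {w | G.src (α w) = G.tgt (β w)} y := (hα.prodMk hβ).contMDiffWithinAt
  have hm : ContMDiffWithinAt (𝓘(ℝ, EP).prod 𝓘(ℝ, EP)) 𝓘(ℝ, EP) ∞
      (fun q : P × P => G.mul q.1 q.2) {q | G.src q.1 = G.tgt q.2} (α y, β y) :=
    G.contMDiffOn_mul _ hc.self_of_nhds
  have hmt : MapsTo (fun w => (α w, β w)) {w | G.src (α w) = G.tgt (β w)}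
    {q : P × P | G.src q.1 = G.tgt q.2} := fun w hw => hw
  have h1 : ContMDiffWithinAt I 𝓘(ℝ, EP) ∞ (fun w => G.mul (α w) (β w))
      {w | G.src (α w) = G.tgt (β w)} y :=
    ContMDiffWithinAt.comp (g := fun q : P × P => G.mul q.1 q.2) y hm h0 hmt
  exact h1.contMDiffAt hc

/-- The product of composable tangent vectors, computed along a plot of composable pairs. -/
theorem tangentMul_mfderiv {α β : Q → P} {y : Q} (hα : MDifferentiableAt I 𝓘(ℝ, EP) α y)
    (hβ : MDifferentiableAt I 𝓘(ℝ, EP) β y) (hc : ∀ᶠ w in 𝓝 y, G.src (α w) = G.tgt (β w))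
    {g h : P} (hg : α y = g) (hh : β y = h) (v : EQ) :
    (G.tangentMul g h (mfderiv I 𝓘(ℝ, EP) α y v : EP) (mfderiv I 𝓘(ℝ, EP) β y v : EP) : EP) =
      mfderiv I 𝓘(ℝ, EP) (fun w => G.mul (α w) (β w)) y v := by
  subst hg hh
  have h1 : HasMFDerivWithinAt I (𝓘(ℝ, EP).prod 𝓘(ℝ, EP)) (fun w => (α w, β w))
      {w | G.src (α w) = G.tgt (β w)} y _ :=
    (hα.hasMFDerivAt.prodMk hβ.hasMFDerivAt).hasMFDerivWithinAt
  have hm : MDifferentiableWithinAt (𝓘(ℝ, EP).prod 𝓘(ℝ, EP)) 𝓘(ℝ, EP)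
      (fun q : P × P => G.mul q.1 q.2) {q | G.src q.1 = G.tgt q.2} (α y, β y) :=
    (G.contMDiffOn_mul _ hc.self_of_nhds).mdifferentiableWithinAt (by simp)
  have hmt : {w | G.src (α w) = G.tgt (β w)} ⊆
    (fun w => (α w, β w)) ⁻¹' {q : P × P | G.src q.1 = G.tgt q.2} := fun w hw => hw
  have h2 := hm.hasMFDerivWithinAt.comp y h1 hmt
  exact (DFunLike.congr_fun (h2.hasMFDerivAt hc).mfderiv v).symm

end Plots

theorem tangentMul_velocity {α β : ℝ → P} (hα : ContMDiffAt 𝓘(ℝ, ℝ) 𝓘(ℝ, EP) ∞ α 0)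
    (hβ : ContMDiffAt 𝓘(ℝ, ℝ) 𝓘(ℝ, EP) ∞ β 0) (hc : ∀ᶠ τ in 𝓝 0, G.src (α τ) = G.tgt (β τ))
    {g h : P} (hg : α 0 = g) (hh : β 0 = h) :
    (G.tangentMul g h (velocity EP α) (velocity EP β) : EP) =
      velocity EP (fun τ => G.mul (α τ) (β τ)) :=
  G.tangentMul_mfderiv (hα.mdifferentiableAt (by simp)) (hβ.mdifferentiableAt (by simp)) hc hg hh
    (1 : ℝ)

theorem exists_section_curve {a : Π x : X, TangentSpace 𝓘(ℝ, EP) (G.unit x)}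
    (ha : a ∈ G.algebroidSection) (x : X) :
    ∃ k : ℝ → P, k 0 = G.unit x ∧ ContMDiffAt 𝓘(ℝ, ℝ) 𝓘(ℝ, EP) ∞ k 0 ∧
      velocity EP k = a x ∧ ∀ᶠ τ in 𝓝 0, G.src (k τ) = x := by
  obtain ⟨k, h0, hk, hv, hs⟩ := exists_fibre_curve G.isSubmersion_src (G.unit x) (a x) (ha.2 x)
  rw [G.src_unit] at hs
  exact ⟨k, h0, hk, hv, hs⟩

end LieGroupoid

end Groupoid

end Gerbe

namespace Gerbe

/-! ### Invariant vector fields as velocities of curves of arrows -/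

section Groupoid

namespace LieGroupoid

variable {EX EP X P : Type*}
  [NormedAddCommGroup EX] [NormedSpace ℝ EX] [TopologicalSpace X] [ChartedSpace EX X]
  [NormedAddCommGroup EP] [NormedSpace ℝ EP] [TopologicalSpace P] [ChartedSpace EP P]
  [IsManifold 𝓘(ℝ, EX) ∞ X] [IsManifold 𝓘(ℝ, EP) ∞ P]
  (G : LieGroupoid EX EP X P)

/-- A curve through the unit at `x`, in the source fibre over `x`, with velocity `a x`. -/
structure IsSectionCurve (a : Π x : X, TangentSpace 𝓘(ℝ, EP) (G.unit x)) (x : X) (k : ℝ → P) :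
    Prop where
  apply_zero : k 0 = G.unit x
  contMDiffAt : ContMDiffAt 𝓘(ℝ, ℝ) 𝓘(ℝ, EP) ∞ k 0
  velocity_eq : velocity EP k = a x
  src_eq : ∀ᶠ τ in 𝓝 0, G.src (k τ) = x

variable {a : Π x : X, TangentSpace 𝓘(ℝ, EP) (G.unit x)}

theorem exists_isSectionCurve (ha : a ∈ G.algebroidSection) (x : X) :
    ∃ k, G.IsSectionCurve a x k := by
  obtain ⟨k, h0, hk, hv, hs⟩ := G.exists_section_curve ha x
  exact ⟨k, h0, hk, hv, hs⟩

theorem mdifferentiableWithinAt_mul_right {h g : P} (hgh : G.src h = G.tgt g) :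
    MDifferentiableWithinAt 𝓘(ℝ, EP) 𝓘(ℝ, EP) (fun h => G.mul h g) {h | G.src h = G.tgt g} h := by
  have hm : MDifferentiableWithinAt (𝓘(ℝ, EP).prod 𝓘(ℝ, EP)) 𝓘(ℝ, EP)
      (fun q : P × P => G.mul q.1 q.2) {q | G.src q.1 = G.tgt q.2} (h, g) :=
    (G.contMDiffOn_mul _ hgh).mdifferentiableWithinAt (by simp)
  have h1 : MDifferentiableWithinAt 𝓘(ℝ, EP) (𝓘(ℝ, EP).prod 𝓘(ℝ, EP)) (fun h => (h, g))
      {h | G.src h = G.tgt g} h :=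
    (mdifferentiableAt_id.prodMk mdifferentiableAt_const).mdifferentiableWithinAt
  have hmt : {h | G.src h = G.tgt g} ⊆
    (fun h => (h, g)) ⁻¹' {q : P × P | G.src q.1 = G.tgt q.2} := fun w hw => hw
  exact hm.comp h h1 hmt

theorem mdifferentiableWithinAt_mul_inv {h g : P} (hgh : G.src h = G.src g) :
    MDifferentiableWithinAt 𝓘(ℝ, EP) 𝓘(ℝ, EP) (fun h => G.mul g (G.inv h))
      {h | G.src h = G.src g} h := by
  have hm : MDifferentiableWithinAt (𝓘(ℝ, EP).prod 𝓘(ℝ, EP)) 𝓘(ℝ, EP)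
      (fun q : P × P => G.mul q.1 q.2) {q | G.src q.1 = G.tgt q.2} (g, G.inv h) :=
    (G.contMDiffOn_mul _ (by simp [G.tgt_inv, hgh])).mdifferentiableWithinAt (by simp)
  have h1 : MDifferentiableWithinAt 𝓘(ℝ, EP) (𝓘(ℝ, EP).prod 𝓘(ℝ, EP)) (fun h => (g, G.inv h))
      {h | G.src h = G.src g} h :=
    (mdifferentiableAt_const.prodMk (G.mdifferentiable_inv h)).mdifferentiableWithinAt
  have hmt : {h | G.src h = G.src g} ⊆
    (fun h => (g, G.inv h)) ⁻¹' {q : P × P | G.src q.1 = G.tgt q.2} := fun w hw =>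
      hw.symm.trans (G.tgt_inv w).symm
  exact MDifferentiableWithinAt.comp (g := fun q : P × P => G.mul q.1 q.2) h hm h1 hmt

namespace IsSectionCurve

variable {G} {x : X} {k : ℝ → P} {g : P}

/-- The curve stays in the source fibre, so the derivative within that fibre is determined on its
velocity. Identities between invariant fields thereby become identities between products of arrows.
-/
theorem rightField_eq (hk : G.IsSectionCurve a x k) (hg : G.tgt g = x) :
    (G.rightField a g : EP) = velocity EP fun τ => G.mul (k τ) g := by
  subst hg
  have h := mfderivWithin_velocity (G.mdifferentiableWithinAt_mul_right (G.src_unit (G.tgt g)))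
    hk.contMDiffAt hk.apply_zero hk.src_eq
  rw [hk.velocity_eq] at h
  exact h

theorem leftField_eq (hk : G.IsSectionCurve a x k) (hg : G.src g = x) :
    (G.leftField a g : EP) = velocity EP fun τ => G.mul g (G.inv (k τ)) := by
  subst hg
  have h := mfderivWithin_velocity (G.mdifferentiableWithinAt_mul_inv (G.src_unit (G.src g)))
    hk.contMDiffAt hk.apply_zero hk.src_eq
  rw [hk.velocity_eq] at h
  exact h

theorem anchor_eq (hk : G.IsSectionCurve a x k) :
    (G.anchor a x : EX) = velocity EX fun τ => G.tgt (k τ) := by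
  have h := mfderiv_velocity (G.mdifferentiable_tgt (G.unit x)) hk.contMDiffAt hk.apply_zero
  rw [hk.velocity_eq] at h
  exact h

theorem contMDiffAt_inv (hk : G.IsSectionCurve a x k) :
    ContMDiffAt 𝓘(ℝ, ℝ) 𝓘(ℝ, EP) ∞ (fun τ => G.inv (k τ)) 0 :=
  (G.contMDiff_inv (k 0)).comp (0 : ℝ) hk.contMDiffAt

theorem inv_apply_zero (hk : G.IsSectionCurve a x k) : G.inv (k 0) = G.unit x := by
  rw [hk.apply_zero, G.inv_unit]

theorem contMDiffAt_mul_right (hk : G.IsSectionCurve a x k) (hg : G.tgt g = x) :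
    ContMDiffAt 𝓘(ℝ, ℝ) 𝓘(ℝ, EP) ∞ (fun τ => G.mul (k τ) g) 0 :=
  G.contMDiffAt_mul hk.contMDiffAt contMDiffAt_const
    (by filter_upwards [hk.src_eq] with τ hτ using hτ.trans hg.symm)

theorem contMDiffAt_mul_inv (hk : G.IsSectionCurve a x k) (hg : G.src g = x) :
    ContMDiffAt 𝓘(ℝ, ℝ) 𝓘(ℝ, EP) ∞ (fun τ => G.mul g (G.inv (k τ))) 0 :=
  G.contMDiffAt_mul contMDiffAt_const hk.contMDiffAt_inv
    (by filter_upwards [hk.src_eq] with τ hτ using by rw [hg, G.tgt_inv, hτ])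

theorem mul_right_apply_zero (hk : G.IsSectionCurve a x k) (hg : G.tgt g = x) :
    G.mul (k 0) g = g := by
  rw [hk.apply_zero, ← hg, G.unit_mul]

theorem mul_inv_apply_zero (hk : G.IsSectionCurve a x k) (hg : G.src g = x) :
    G.mul g (G.inv (k 0)) = g := by
  rw [hk.inv_apply_zero, ← hg, G.mul_unit]

end IsSectionCurve

theorem mfderiv_src_rightField (ha : a ∈ G.algebroidSection) (g : P) :
    (mfderiv 𝓘(ℝ, EP) 𝓘(ℝ, EX) G.src g (G.rightField a g) : EX) = 0 := by
  obtain ⟨k, hk⟩ := G.exists_isSectionCurve ha (G.tgt g)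
  refine (congrArg (mfderiv 𝓘(ℝ, EP) 𝓘(ℝ, EX) G.src g : EP →L[ℝ] EX) (hk.rightField_eq rfl)).trans
    ?_
  refine (mfderiv_velocity (G.mdifferentiable_src g) (hk.contMDiffAt_mul_right rfl)
    (hk.mul_right_apply_zero rfl)).trans (velocity_of_eventually_const (E := EX) (x := G.src g) ?_)
  filter_upwards [hk.src_eq] with τ hτ using G.src_mul _ _ hτ

theorem mfderiv_tgt_rightField (ha : a ∈ G.algebroidSection) (g : P) :
    (mfderiv 𝓘(ℝ, EP) 𝓘(ℝ, EX) G.tgt g (G.rightField a g) : EX) = G.anchor a (G.tgt g) := by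
  obtain ⟨k, hk⟩ := G.exists_isSectionCurve ha (G.tgt g)
  refine (congrArg (mfderiv 𝓘(ℝ, EP) 𝓘(ℝ, EX) G.tgt g : EP →L[ℝ] EX) (hk.rightField_eq rfl)).trans
    ?_
  refine (mfderiv_velocity (G.mdifferentiable_tgt g) (hk.contMDiffAt_mul_right rfl)
    (hk.mul_right_apply_zero rfl)).trans (Eq.trans (velocity_congr (E := EX) ?_) hk.anchor_eq.symm)
  filter_upwards [hk.src_eq] with τ hτ using G.tgt_mul _ _ hτ

/-- Inversion takes `k(τ) · g` to `g⁻¹ · k(τ)⁻¹`, the curve that computes the left-invariant field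
at `g⁻¹`. -/
theorem mfderiv_inv_rightField (ha : a ∈ G.algebroidSection) (g : P) :
    (mfderiv 𝓘(ℝ, EP) 𝓘(ℝ, EP) G.inv g (G.rightField a g) : EP) = G.leftField a (G.inv g) := by
  obtain ⟨k, hk⟩ := G.exists_isSectionCurve ha (G.tgt g)
  refine (congrArg (mfderiv 𝓘(ℝ, EP) 𝓘(ℝ, EP) G.inv g : EP →L[ℝ] EP) (hk.rightField_eq rfl)).trans
    ?_
  refine (mfderiv_velocity (G.mdifferentiable_inv g) (hk.contMDiffAt_mul_right rfl)
    (hk.mul_right_apply_zero rfl)).trans (Eq.trans (velocity_congr (E := EP) ?_)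
      (hk.leftField_eq (G.src_inv g)).symm)
  filter_upwards [hk.src_eq] with τ hτ
  rw [← G.inv_mul_inv (k := k τ) (g := G.inv g) (by rw [hτ, G.src_inv]), G.inv_inv]

theorem mfderiv_src_leftField (ha : a ∈ G.algebroidSection) (g : P) :
    (mfderiv 𝓘(ℝ, EP) 𝓘(ℝ, EX) G.src g (G.leftField a g) : EX) = G.anchor a (G.src g) := by
  obtain ⟨k, hk⟩ := G.exists_isSectionCurve ha (G.src g)
  refine (congrArg (mfderiv 𝓘(ℝ, EP) 𝓘(ℝ, EX) G.src g : EP →L[ℝ] EX) (hk.leftField_eq rfl)).trans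
    ?_
  refine (mfderiv_velocity (G.mdifferentiable_src g) (hk.contMDiffAt_mul_inv rfl)
    (hk.mul_inv_apply_zero rfl)).trans (Eq.trans (velocity_congr (E := EX) ?_) hk.anchor_eq.symm)
  filter_upwards [hk.src_eq] with τ hτ
  rw [G.src_mul _ _ (by rw [G.tgt_inv, hτ]), G.src_inv]

theorem mfderiv_tgt_leftField (ha : a ∈ G.algebroidSection) (g : P) :
    (mfderiv 𝓘(ℝ, EP) 𝓘(ℝ, EX) G.tgt g (G.leftField a g) : EX) = 0 := by
  obtain ⟨k, hk⟩ := G.exists_isSectionCurve ha (G.src g)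
  refine (congrArg (mfderiv 𝓘(ℝ, EP) 𝓘(ℝ, EX) G.tgt g : EP →L[ℝ] EX) (hk.leftField_eq rfl)).trans
    ?_
  refine (mfderiv_velocity (G.mdifferentiable_tgt g) (hk.contMDiffAt_mul_inv rfl)
    (hk.mul_inv_apply_zero rfl)).trans (velocity_of_eventually_const (E := EX) (x := G.tgt g) ?_)
  filter_upwards [hk.src_eq] with τ hτ
  rw [G.tgt_mul _ _ (by rw [G.tgt_inv, hτ])]

theorem rightField_eq_tangentMul (ha : a ∈ G.algebroidSection) (g : P) :
    (G.rightField a g : EP) = G.tangentMul (G.unit (G.tgt g)) g (a (G.tgt g)) (0 : EP) := by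
  obtain ⟨k, hk⟩ := G.exists_isSectionCurve ha (G.tgt g)
  have h := G.tangentMul_velocity hk.contMDiffAt (contMDiffAt_const (c := g)) hk.src_eq
    hk.apply_zero rfl
  rw [velocity_const, hk.velocity_eq] at h
  exact (hk.rightField_eq rfl).trans h.symm

theorem rightField_unit (ha : a ∈ G.algebroidSection) (x : X) :
    (G.rightField a (G.unit x) : EP) = a x := by
  obtain ⟨k, hk⟩ := G.exists_isSectionCurve ha x
  refine (hk.rightField_eq (G.tgt_unit x)).trans (Eq.trans (velocity_congr (E := EP) ?_) hk.velocity_eq)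
  filter_upwards [hk.src_eq] with τ hτ
  exact hτ ▸ G.mul_unit (k τ)

/-- The derivative of `k(τ) · (g · h) = (k(τ) · g) · h`, with `h` held constant. -/
theorem rightField_mul (ha : a ∈ G.algebroidSection) {g h : P} (hgh : G.src g = G.tgt h) :
    (G.rightField a (G.mul g h) : EP) = G.tangentMul g h (G.rightField a g) (0 : EP) := by
  obtain ⟨k, hk⟩ := G.exists_isSectionCurve ha (G.tgt g)
  have h1 : ∀ᶠ τ in 𝓝 0, G.src (G.mul (k τ) g) = G.tgt h := by
    filter_upwards [hk.src_eq] with τ hτ using (G.src_mul _ _ hτ).trans hgh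
  have h := G.tangentMul_velocity (hk.contMDiffAt_mul_right rfl) (contMDiffAt_const (c := h)) h1
    (hk.mul_right_apply_zero rfl) rfl
  rw [velocity_const, ← hk.rightField_eq rfl] at h
  refine (hk.rightField_eq (G.tgt_mul _ _ hgh)).trans (Eq.trans (velocity_congr (E := EP) ?_) h.symm)
  filter_upwards [hk.src_eq] with τ hτ using (G.mul_assoc _ _ _ hτ hgh).symm

theorem leftField_mul (ha : a ∈ G.algebroidSection) {g h : P} (hgh : G.src g = G.tgt h) :
    (G.leftField a (G.mul g h) : EP) = G.tangentMul g h (0 : EP) (G.leftField a h) := by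
  obtain ⟨k, hk⟩ := G.exists_isSectionCurve ha (G.src h)
  have h0 : ∀ᶠ τ in 𝓝 0, G.src h = G.tgt (G.inv (k τ)) := by
    filter_upwards [hk.src_eq] with τ hτ using by rw [G.tgt_inv, hτ]
  have h1 : ∀ᶠ τ in 𝓝 0, G.src g = G.tgt (G.mul h (G.inv (k τ))) := by
    filter_upwards [h0] with τ hτ using hgh.trans (G.tgt_mul _ _ hτ).symm
  have h := G.tangentMul_velocity (contMDiffAt_const (c := g)) (hk.contMDiffAt_mul_inv rfl) h1
    rfl (hk.mul_inv_apply_zero rfl)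
  rw [velocity_const, ← hk.leftField_eq rfl] at h
  refine (hk.leftField_eq (G.src_mul _ _ hgh)).trans (Eq.trans (velocity_congr (E := EP) ?_) h.symm)
  filter_upwards [h0] with τ hτ using G.mul_assoc _ _ _ hgh hτ

/-- The curves `g · k(τ)⁻¹` and `k(τ) · h` have the constant product `g · h`. Multiplicativity of
`ā` and the formula for `ι_{←a} γ` both depend on this vanishing. -/
theorem tangentMul_leftField_rightField (ha : a ∈ G.algebroidSection) {g h : P}
    (hgh : G.src g = G.tgt h) :
    (G.tangentMul g h (G.leftField a g) (G.rightField a h) : EP) = 0 := by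
  obtain ⟨k, hk⟩ := G.exists_isSectionCurve ha (G.src g)
  have h1 : ∀ᶠ τ in 𝓝 0, G.src (G.mul g (G.inv (k τ))) = G.tgt (G.mul (k τ) h) := by
    filter_upwards [hk.src_eq] with τ hτ
    rw [G.src_mul _ _ (by rw [G.tgt_inv, hτ]), G.src_inv, G.tgt_mul _ _ (hτ.trans hgh)]
  have h2 := G.tangentMul_velocity (hk.contMDiffAt_mul_inv rfl) (hk.contMDiffAt_mul_right hgh.symm)
    h1 (hk.mul_inv_apply_zero rfl) (hk.mul_right_apply_zero hgh.symm)
  rw [← hk.leftField_eq rfl, ← hk.rightField_eq hgh.symm] at h2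
  refine h2.trans (velocity_of_eventually_const (E := EP) (x := G.mul g h) ?_)
  filter_upwards [hk.src_eq] with τ hτ using G.mul_inv_mul_mul hτ hgh

/-- At a unit, the infinitesimal inverse of `a` is `dε(𝐚) - a`. -/
theorem mfderiv_unit_anchor (ha : a ∈ G.algebroidSection) (x : X) :
    (mfderiv 𝓘(ℝ, EX) 𝓘(ℝ, EP) G.unit x (G.anchor a x) : EP) =
      G.barField a (G.unit x) := by
  obtain ⟨k, hk⟩ := G.exists_isSectionCurve ha x
  have h0 : (mfderiv 𝓘(ℝ, EX) 𝓘(ℝ, EP) G.unit x (G.anchor a x) : EP) =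
      velocity EP fun τ => G.unit (G.tgt (k τ)) := by
    refine (congrArg (mfderiv 𝓘(ℝ, EX) 𝓘(ℝ, EP) G.unit x : EX →L[ℝ] EP) hk.anchor_eq).trans ?_
    exact mfderiv_velocity (G.mdifferentiable_unit x)
      ((G.isSubmersion_tgt.contMDiff.contMDiffAt).comp (0 : ℝ) hk.contMDiffAt)
      (by rw [hk.apply_zero, G.tgt_unit])
  have hc : ∀ᶠ τ in 𝓝 0, G.src (k τ) = G.tgt (G.inv (k τ)) :=
    Filter.Eventually.of_forall fun τ => (G.tgt_inv _).symm
  have h1 := G.tangentMul_velocity hk.contMDiffAt hk.contMDiffAt_inv hc hk.apply_zero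
    hk.inv_apply_zero
  have h2 := G.tangentMul_velocity hk.contMDiffAt (contMDiffAt_const (c := G.unit x))
    (by filter_upwards [hk.src_eq] with τ hτ using by rw [hτ, G.tgt_unit]) hk.apply_zero rfl
  have h3 := G.tangentMul_velocity (contMDiffAt_const (c := G.unit x)) hk.contMDiffAt_inv
    (by filter_upwards [hk.src_eq] with τ hτ using by rw [G.tgt_inv, hτ, G.src_unit]) rfl
    hk.inv_apply_zero
  -- The velocity of `ε(t(k)) = k · k⁻¹` splits by linearity into those of `k · 1` and `1 · k⁻¹`,
  -- which are the right- and left-invariant fields at the unit.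
  have h4 := G.tangentMul_add (G.unit x) (G.unit x) (velocity EP k) (0 : EP) (0 : EP)
    (velocity EP fun τ => G.inv (k τ))
  rw [velocity_const] at h2 h3
  have h5 : (velocity EP k + (0 : EP) : EP) = velocity EP k := add_zero _
  have h6 : ((0 : EP) + velocity EP (fun τ => G.inv (k τ)) : EP) =
    velocity EP fun τ => G.inv (k τ) := zero_add _
  have h7 : (G.barField a (G.unit x) : EP) = (G.rightField a (G.unit x) : EP) +
    (G.leftField a (G.unit x) : EP) := rfl
  rw [h7, hk.rightField_eq (G.tgt_unit x), hk.leftField_eq (G.src_unit x), ← h2, ← h3, h0]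
  have h8 : (fun τ => G.unit (G.tgt (k τ))) = fun τ => G.mul (k τ) (G.inv (k τ)) :=
    funext fun τ => (G.mul_inv _).symm
  rw [h8, ← h1]
  have h9 : (G.tangentMul (G.unit x) (G.unit x) (velocity EP k + (0 : EP) : EP)
    ((0 : EP) + velocity EP (fun τ => G.inv (k τ)) : EP) : EP) =
    G.tangentMul (G.unit x) (G.unit x) (velocity EP k) (0 : EP) +
    G.tangentMul (G.unit x) (G.unit x) (0 : EP) (velocity EP (fun τ => G.inv (k τ))) := h4
  rw [h5, h6] at h9
  exact h9

theorem isMultiplicative_barField (ha : a ∈ G.algebroidSection) :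
    G.IsMultiplicative (G.anchor a) (G.barField a) where
  src g := by
    refine (map_add (mfderiv 𝓘(ℝ, EP) 𝓘(ℝ, EX) G.src g) (G.rightField a g)
      (G.leftField a g)).trans ?_
    refine (congrArg₂ (· + · : EX → EX → EX) (G.mfderiv_src_rightField ha g)
      (G.mfderiv_src_leftField ha g)).trans (zero_add _)
  tgt g := by
    refine (map_add (mfderiv 𝓘(ℝ, EP) 𝓘(ℝ, EX) G.tgt g) (G.rightField a g)
      (G.leftField a g)).trans ?_
    refine (congrArg₂ (· + · : EX → EX → EX) (G.mfderiv_tgt_rightField ha g)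
      (G.mfderiv_tgt_leftField ha g)).trans (add_zero _)
  unit x := G.mfderiv_unit_anchor ha x
  mul g h hgh := by
    -- Here `u, v` stand for the right-invariant and `u', v'` for the left-invariant values at `g`
    -- and `h`. The product splits into the pairs `(u, 0)`, `(u', v)` and `(0, v')`, each
    -- composable, and the middle one contributes zero.
    have key : ∀ T : EP → EP → EP, (∀ u u' v v', T (u + u') (v + v') = T u v + T u' v') →
        ∀ u u' v v', T u' v = 0 → T u 0 + T 0 v' = T (u + u') (v + v') := by
      intro T hT u u' v v' h0
      have h1 := hT u u' 0 (v + v')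
      have h2 := hT 0 u' v' v
      rw [zero_add] at h1 h2
      rw [h1, add_comm v v', h2, h0, add_zero]
    have := key (fun u v => G.tangentMul g h u v) (fun u u' v v' => G.tangentMul_add g h u u' v v')
      (G.rightField a g) (G.leftField a g) (G.rightField a h) (G.leftField a h)
      (G.tangentMul_leftField_rightField ha hgh)
    exact (congrArg₂ (· + · : EP → EP → EP) (G.rightField_mul ha hgh)
      (G.leftField_mul ha hgh)).trans this

end LieGroupoid

end Groupoid

end Gerbe

namespace Gerbe

/-! ### Retracting coordinates onto the composable pairs -/

theorem lieBracket_prodMap {E F : Type*} [NormedAddCommGroup E] [NormedSpace ℝ E]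
    [NormedAddCommGroup F] [NormedSpace ℝ F] {A C : E → E} {B D : F → F} {v : E × F}
    (hA : DifferentiableAt ℝ A v.1) (hB : DifferentiableAt ℝ B v.2)
    (hC : DifferentiableAt ℝ C v.1) (hD : DifferentiableAt ℝ D v.2) :
    VectorField.lieBracket ℝ (Prod.map A B) (Prod.map C D) v =
      (VectorField.lieBracket ℝ A C v.1, VectorField.lieBracket ℝ B D v.2) := by
  have h1 := (HasFDerivAt.prodMap v hA.hasFDerivAt hB.hasFDerivAt).fderiv
  have h2 := (HasFDerivAt.prodMap v hC.hasFDerivAt hD.hasFDerivAt).fderiv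
  rw [VectorField.lieBracket, h1, h2]
  rfl

theorem totalSpace_ext {E M : Type*} [NormedAddCommGroup E] [NormedSpace ℝ E]
    [TopologicalSpace M] [ChartedSpace E M] {p q : TangentBundle 𝓘(ℝ, E) M}
    (h : p.1 = q.1) (h' : (p.2 : E) = q.2) : p = q := by
  obtain ⟨p, u⟩ := p
  obtain ⟨q, w⟩ := q
  obtain rfl : p = q := h
  exact congrArg (Bundle.TotalSpace.mk p) h'

section Groupoid

namespace LieGroupoid

variable {EX EP X P : Type*}
  [NormedAddCommGroup EX] [NormedSpace ℝ EX] [TopologicalSpace X] [ChartedSpace EX X]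
  [NormedAddCommGroup EP] [NormedSpace ℝ EP] [TopologicalSpace P] [ChartedSpace EP P]
  [IsManifold 𝓘(ℝ, EX) ∞ X] [IsManifold 𝓘(ℝ, EP) ∞ P]
  (G : LieGroupoid EX EP X P)

section Lift

variable (r : LocalLift (E := EP) (E' := EX) G.src) (g h : P)

/-- Coordinates near `(g, h)`, retracted in the first factor onto the composable pairs. -/
def leftLift (y : EP × EP) : P :=
  r.toFun ((extChartAt 𝓘(ℝ, EP) g).symm y.1, G.tgt ((extChartAt 𝓘(ℝ, EP) h).symm y.2))

variable {r g h} {y : EP × EP}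

theorem contMDiffAt_chart_symm_fst (h1 : y.1 ∈ (extChartAt 𝓘(ℝ, EP) g).target) :
    ContMDiffAt 𝓘(ℝ, EP × EP) 𝓘(ℝ, EP) ∞
      (fun y : EP × EP => (extChartAt 𝓘(ℝ, EP) g).symm y.1) y :=
  (contMDiffAt_chart_symm h1).comp y contDiff_fst.contMDiff.contMDiffAt

theorem contMDiffAt_chart_symm_snd (h2 : y.2 ∈ (extChartAt 𝓘(ℝ, EP) h).target) :
    ContMDiffAt 𝓘(ℝ, EP × EP) 𝓘(ℝ, EP) ∞
      (fun y : EP × EP => (extChartAt 𝓘(ℝ, EP) h).symm y.2) y :=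
  (contMDiffAt_chart_symm h2).comp y contDiff_snd.contMDiff.contMDiffAt

theorem mfderiv_chart_symm_fst (h1 : y.1 ∈ (extChartAt 𝓘(ℝ, EP) g).target) (w : EP × EP) :
    (mfderiv 𝓘(ℝ, EP × EP) 𝓘(ℝ, EP) (fun y : EP × EP => (extChartAt 𝓘(ℝ, EP) g).symm y.1) y w
      : EP) = mfderiv 𝓘(ℝ, EP) 𝓘(ℝ, EP) (extChartAt 𝓘(ℝ, EP) g).symm y.1 w.1 := by
  have h3 : (mfderiv 𝓘(ℝ, EP × EP) 𝓘(ℝ, EP) (Prod.fst : EP × EP → EP) y w : EP) = w.1 := by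
    rw [mfderiv_eq_fderiv, fderiv_fst]
    rfl
  rw [← h3]
  exact (mfderiv_comp_apply_of_eq ((contMDiffAt_chart_symm h1).mdifferentiableAt (by simp))
    (mdifferentiableAt_iff_differentiableAt.2 differentiableAt_fst) rfl w).symm

theorem mfderiv_chart_symm_snd (h2 : y.2 ∈ (extChartAt 𝓘(ℝ, EP) h).target) (w : EP × EP) :
    (mfderiv 𝓘(ℝ, EP × EP) 𝓘(ℝ, EP) (fun y : EP × EP => (extChartAt 𝓘(ℝ, EP) h).symm y.2) y w
      : EP) = mfderiv 𝓘(ℝ, EP) 𝓘(ℝ, EP) (extChartAt 𝓘(ℝ, EP) h).symm y.2 w.2 := by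
  have h3 : (mfderiv 𝓘(ℝ, EP × EP) 𝓘(ℝ, EP) (Prod.snd : EP × EP → EP) y w : EP) = w.2 := by
    rw [mfderiv_eq_fderiv, fderiv_snd]
    rfl
  rw [← h3]
  exact (mfderiv_comp_apply_of_eq ((contMDiffAt_chart_symm h2).mdifferentiableAt (by simp))
    (mdifferentiableAt_iff_differentiableAt.2 differentiableAt_snd) rfl w).symm

theorem contMDiffAt_leftLift (h1 : y.1 ∈ (extChartAt 𝓘(ℝ, EP) g).target)
    (h2 : y.2 ∈ (extChartAt 𝓘(ℝ, EP) h).target)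
    (hd : ((extChartAt 𝓘(ℝ, EP) g).symm y.1, G.tgt ((extChartAt 𝓘(ℝ, EP) h).symm y.2)) ∈ r.dom) :
    ContMDiffAt 𝓘(ℝ, EP × EP) 𝓘(ℝ, EP) ∞ (G.leftLift r g h) y := by
  have h3 : ContMDiffAt 𝓘(ℝ, EP × EP) (𝓘(ℝ, EP).prod 𝓘(ℝ, EX)) ∞ (fun y : EP × EP =>
      ((extChartAt 𝓘(ℝ, EP) g).symm y.1, G.tgt ((extChartAt 𝓘(ℝ, EP) h).symm y.2))) y :=
    (contMDiffAt_chart_symm_fst h1).prodMk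
      (G.isSubmersion_tgt.contMDiff.contMDiffAt.comp y (contMDiffAt_chart_symm_snd h2))
  exact (r.contMDiffAt hd).comp y h3

/-- A composable pair of vectors enters the lift as `(u, ds u)`, where `LocalLift.mfderiv_self`
applies. The retraction thus fixes vectors tangent to the composable pairs. -/
theorem mfderiv_leftLift (h1 : y.1 ∈ (extChartAt 𝓘(ℝ, EP) g).target)
    (h2 : y.2 ∈ (extChartAt 𝓘(ℝ, EP) h).target)
    (hd : ((extChartAt 𝓘(ℝ, EP) g).symm y.1, G.src ((extChartAt 𝓘(ℝ, EP) g).symm y.1)) ∈ r.dom)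
    (hc : G.src ((extChartAt 𝓘(ℝ, EP) g).symm y.1) = G.tgt ((extChartAt 𝓘(ℝ, EP) h).symm y.2))
    {w : EP × EP} {u v : EP}
    (hu : (mfderiv 𝓘(ℝ, EP) 𝓘(ℝ, EP) (extChartAt 𝓘(ℝ, EP) g).symm y.1 w.1 : EP) = u)
    (hv : (mfderiv 𝓘(ℝ, EP) 𝓘(ℝ, EP) (extChartAt 𝓘(ℝ, EP) h).symm y.2 w.2 : EP) = v)
    (huv : (mfderiv 𝓘(ℝ, EP) 𝓘(ℝ, EX) G.src ((extChartAt 𝓘(ℝ, EP) g).symm y.1) u : EX) =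
      mfderiv 𝓘(ℝ, EP) 𝓘(ℝ, EX) G.tgt ((extChartAt 𝓘(ℝ, EP) h).symm y.2) v) :
    (mfderiv 𝓘(ℝ, EP × EP) 𝓘(ℝ, EP) (G.leftLift r g h) y w : EP) = u := by
  set p := (extChartAt 𝓘(ℝ, EP) g).symm y.1 with hp
  set q := (extChartAt 𝓘(ℝ, EP) h).symm y.2 with hq
  have e1 := (contMDiffAt_chart_symm_fst h1).mdifferentiableAt (by simp)
  have e2 := (contMDiffAt_chart_symm_snd h2).mdifferentiableAt (by simp)
  have e3 := (G.mdifferentiable_tgt q).hasMFDerivAt.comp y e2.hasMFDerivAt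
  have hd' : (p, G.tgt q) ∈ r.dom := by rwa [← hc]
  have e4 := (r.mdifferentiableAt hd').hasMFDerivAt.comp y (e1.hasMFDerivAt.prodMk e3)
  refine (DFunLike.congr_fun e4.mfderiv w).trans ?_
  have e5 := r.mfderiv_self (G.mdifferentiable_src p) hd u
  rw [huv, hc] at e5
  refine Eq.trans ?_ e5
  change (mfderiv (𝓘(ℝ, EP).prod 𝓘(ℝ, EX)) 𝓘(ℝ, EP) r.toFun (p, G.tgt q) : EP × EX →L[ℝ] EP)
    ((mfderiv 𝓘(ℝ, EP × EP) 𝓘(ℝ, EP) (fun y : EP × EP => (extChartAt 𝓘(ℝ, EP) g).symm y.1) y w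
      : EP), ((mfderiv 𝓘(ℝ, EP) 𝓘(ℝ, EX) G.tgt q : EP →L[ℝ] EX)
        (mfderiv 𝓘(ℝ, EP × EP) 𝓘(ℝ, EP) (fun y : EP × EP => (extChartAt 𝓘(ℝ, EP) h).symm y.2) y w
      : EP) : EX)) = _
  rw [mfderiv_chart_symm_fst h1, mfderiv_chart_symm_snd h2, hu, hv]

end Lift

end LieGroupoid

end Groupoid

end Gerbe

namespace Gerbe

/-! ### Compatibility of the Lie bracket with multiplication -/

section Groupoid

namespace LieGroupoid

variable {EX EP X P : Type*}
  [NormedAddCommGroup EX] [NormedSpace ℝ EX] [TopologicalSpace X] [ChartedSpace EX X]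
  [NormedAddCommGroup EP] [NormedSpace ℝ EP] [TopologicalSpace P] [ChartedSpace EP P]
  [IsManifold 𝓘(ℝ, EX) ∞ X] [IsManifold 𝓘(ℝ, EP) ∞ P]
  (G : LieGroupoid EX EP X P)

/-- The Lie bracket of vector fields is compatible with the multiplication: if `Z₁` and `Z₂` are
the products of the composable pairs `(U₁, V₁)` and `(U₂, V₂)`, then `[Z₁, Z₂]` is the product of
`[U₁, U₂]` and `[V₁, V₂]`. -/
theorem mlieBracket_mul [CompleteSpace EP] {U₁ U₂ V₁ V₂ Z₁ Z₂ : Π g : P, TangentSpace 𝓘(ℝ, EP) g}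
    (hU₁ : U₁ ∈ VectorField EP P) (hU₂ : U₂ ∈ VectorField EP P) (hV₁ : V₁ ∈ VectorField EP P)
    (hV₂ : V₂ ∈ VectorField EP P) (hZ₁ : Z₁ ∈ VectorField EP P) (hZ₂ : Z₂ ∈ VectorField EP P)
    (hc₁ : ∀ g h, G.src g = G.tgt h → (mfderiv 𝓘(ℝ, EP) 𝓘(ℝ, EX) G.src g (U₁ g) : EX) =
      mfderiv 𝓘(ℝ, EP) 𝓘(ℝ, EX) G.tgt h (V₁ h))
    (hc₂ : ∀ g h, G.src g = G.tgt h → (mfderiv 𝓘(ℝ, EP) 𝓘(ℝ, EX) G.src g (U₂ g) : EX) =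
      mfderiv 𝓘(ℝ, EP) 𝓘(ℝ, EX) G.tgt h (V₂ h))
    (hm₁ : ∀ g h, G.src g = G.tgt h → (Z₁ (G.mul g h) : EP) = G.tangentMul g h (U₁ g) (V₁ h))
    (hm₂ : ∀ g h, G.src g = G.tgt h → (Z₂ (G.mul g h) : EP) = G.tangentMul g h (U₂ g) (V₂ h))
    {g h : P} (hgh : G.src g = G.tgt h)
    (hb : (mfderiv 𝓘(ℝ, EP) 𝓘(ℝ, EX) G.src g (VectorField.mlieBracket 𝓘(ℝ, EP) U₁ U₂ g) : EX) =
      mfderiv 𝓘(ℝ, EP) 𝓘(ℝ, EX) G.tgt h (VectorField.mlieBracket 𝓘(ℝ, EP) V₁ V₂ h)) :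
    (VectorField.mlieBracket 𝓘(ℝ, EP) Z₁ Z₂ (G.mul g h) : EP) =
      G.tangentMul g h (VectorField.mlieBracket 𝓘(ℝ, EP) U₁ U₂ g)
        (VectorField.mlieBracket 𝓘(ℝ, EP) V₁ V₂ h) := by
  obtain ⟨r, hr⟩ := exists_localLift G.isSubmersion_src g
  set φ := extChartAt 𝓘(ℝ, EP) g with hφ
  set ψ := extChartAt 𝓘(ℝ, EP) h with hψ
  set v : EP × EP := (φ g, ψ h) with hv
  have hv1 : v.1 ∈ φ.target := mem_extChartAt_target g
  have hv2 : v.2 ∈ ψ.target := mem_extChartAt_target h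
  have hφv : φ.symm v.1 = g := extChartAt_to_inv g
  have hψv : ψ.symm v.2 = h := extChartAt_to_inv h
  set α : EP × EP → P := G.leftLift r g h with hα
  set β : EP × EP → P := fun y => ψ.symm y.2 with hβ
  set f : EP × EP → P := fun y => G.mul (α y) (β y) with hf
  -- The map `ρ` retracts a neighbourhood onto the composable pairs by moving the first arrow until
  -- its source meets the target of the second. Product fields are related to `Z₁` and `Z₂` under
  -- `f` only on the image of `ρ`, which is why the bracket lemma for retractions is needed.
  set ρ : EP × EP → EP × EP := fun y => (φ (α y), y.2) with hρ
  have hdv : (φ.symm v.1, G.tgt (ψ.symm v.2)) ∈ r.dom := by rwa [hφv, hψv, ← hgh]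
  have hαv : ContMDiffAt 𝓘(ℝ, EP × EP) 𝓘(ℝ, EP) ∞ α v := G.contMDiffAt_leftLift hv1 hv2 hdv
  have hβv : ContMDiffAt 𝓘(ℝ, EP × EP) 𝓘(ℝ, EP) ∞ β v := contMDiffAt_chart_symm_snd hv2
  have hα0 : α v = g := by
    rw [hα, leftLift, ← hφ, ← hψ, hφv, hψv, ← hgh]
    exact r.toFun_self g hr
  have hρv : ρ v = v := by rw [hρ, hv]; simp only [← hv, hα0]
  have hρd : ContDiffAt ℝ ∞ ρ v := by
    have : α v ∈ φ.source := by rw [hα0]; exact mem_extChartAt_source g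
    exact (contDiffAt_chart_comp this hαv).prodMk contDiffAt_snd
  -- the points at which everything is defined
  set good : EP × EP → Prop := fun z => z.1 ∈ φ.target ∧ z.2 ∈ ψ.target ∧
    (φ.symm z.1, G.src (φ.symm z.1)) ∈ r.dom ∧ G.src (φ.symm z.1) = G.tgt (ψ.symm z.2) with hgood
  have hgv : good v := ⟨hv1, hv2, by rwa [hφv], by rw [hφv, hψv, hgh]⟩
  have hgood_ev : ∀ᶠ y in 𝓝 v, good (ρ y) := by
    have c1 : ContinuousAt (fun y => (α y, G.src (α y))) v :=
      hαv.continuousAt.prodMk (G.isSubmersion_src.contMDiff.continuous.continuousAt.comp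
        hαv.continuousAt)
    have c2 : ContinuousAt (fun y : EP × EP => (φ.symm y.1, G.tgt (ψ.symm y.2))) v :=
      (contMDiffAt_chart_symm_fst hv1).continuousAt.prodMk
        (G.isSubmersion_tgt.contMDiff.continuous.continuousAt.comp hβv.continuousAt)
    have c3 : φ.source ∈ 𝓝 (α v) := by rw [hα0]; exact extChartAt_source_mem_nhds g
    filter_upwards [c1.preimage_mem_nhds (r.isOpen_dom.mem_nhds (by rwa [hα0])),
      c2.preimage_mem_nhds (r.isOpen_dom.mem_nhds hdv), hαv.continuousAt.preimage_mem_nhds c3,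
      continuousAt_snd.preimage_mem_nhds (extChartAt_target_mem_nhds_of_mem hv2)] with y y1 y2 y3 y4
    have e : φ.symm (ρ y).1 = α y := φ.left_inv y3
    refine ⟨φ.map_source y3, y4, ?_, ?_⟩
    · rw [e]; exact y1
    · rw [e]; exact r.apply_toFun _ y2
  -- At a composable pair the lift changes nothing, so `f` has the value of the multiplication and,
  -- on composable vectors, its derivative is the product in the tangent groupoid.
  have key : ∀ z, good z → ∀ (w : EP × EP) (u₁ u₂ : EP),
      (mfderiv 𝓘(ℝ, EP) 𝓘(ℝ, EP) φ.symm z.1 w.1 : EP) = u₁ →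
      (mfderiv 𝓘(ℝ, EP) 𝓘(ℝ, EP) ψ.symm z.2 w.2 : EP) = u₂ →
      (mfderiv 𝓘(ℝ, EP) 𝓘(ℝ, EX) G.src (φ.symm z.1) u₁ : EX) =
        mfderiv 𝓘(ℝ, EP) 𝓘(ℝ, EX) G.tgt (ψ.symm z.2) u₂ →
      f z = G.mul (φ.symm z.1) (ψ.symm z.2) ∧
      (mfderiv 𝓘(ℝ, EP × EP) 𝓘(ℝ, EP) α z w : EP) = u₁ ∧
      (mfderiv 𝓘(ℝ, EP × EP) 𝓘(ℝ, EP) f z w : EP) =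
        G.tangentMul (φ.symm z.1) (ψ.symm z.2) u₁ u₂ := by
    rintro z ⟨z1, z2, z3, z4⟩ w u₁ u₂ e1 e2 e3
    have z5 : (φ.symm z.1, G.tgt (ψ.symm z.2)) ∈ r.dom := by rwa [← z4]
    have a1 : α z = φ.symm z.1 := by
      rw [hα, leftLift, ← hφ, ← hψ, ← z4]
      exact r.toFun_self _ z3
    have a2 := G.mfderiv_leftLift z1 z2 z3 z4 e1 e2 e3
    have a3 := mfderiv_chart_symm_snd z2 w
    have c2 : ContinuousAt (fun y : EP × EP => (φ.symm y.1, G.tgt (ψ.symm y.2))) z :=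
      (contMDiffAt_chart_symm_fst z1).continuousAt.prodMk
        (G.isSubmersion_tgt.contMDiff.continuous.continuousAt.comp
          (contMDiffAt_chart_symm_snd z2).continuousAt)
    have a4 : ∀ᶠ y in 𝓝 z, G.src (α y) = G.tgt (β y) := by
      filter_upwards [c2.preimage_mem_nhds (r.isOpen_dom.mem_nhds z5)] with y hy
      exact r.apply_toFun _ hy
    have a5 := G.tangentMul_mfderiv
      ((G.contMDiffAt_leftLift z1 z2 z5).mdifferentiableAt (by simp))
      ((contMDiffAt_chart_symm_snd z2).mdifferentiableAt (by simp)) a4 a1 rfl w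
    rw [a2, a3, e2] at a5
    exact ⟨congrArg (fun p => G.mul p _) a1, a2, a5.symm⟩
  have hfv : f v = G.mul g h := by rw [hf]; simp only [hα0, hβ, hψv]
  have hfs : ContMDiffAt 𝓘(ℝ, EP × EP) 𝓘(ℝ, EP) ∞ f v := by
    refine G.contMDiffAt_mul hαv hβv ?_
    have c2 : ContinuousAt (fun y : EP × EP => (φ.symm y.1, G.tgt (ψ.symm y.2))) v :=
      (contMDiffAt_chart_symm_fst hv1).continuousAt.prodMk
        (G.isSubmersion_tgt.contMDiff.continuous.continuousAt.comp hβv.continuousAt)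
    filter_upwards [c2.preimage_mem_nhds (r.isOpen_dom.mem_nhds hdv)] with y hy
    exact r.apply_toFun _ hy
  have hd : ∀ {U V : Π g : P, TangentSpace 𝓘(ℝ, EP) g}, U ∈ VectorField EP P →
      V ∈ VectorField EP P →
      DifferentiableAt ℝ (vecRep g U) v.1 ∧ DifferentiableAt ℝ (vecRep h V) v.2 := fun hU hV =>
    ⟨(contDiffAt_vecRep hv1 hU).differentiableAt (by simp),
      (contDiffAt_vecRep hv2 hV).differentiableAt (by simp)⟩
  have hrel : ∀ {U V Z : Π g : P, TangentSpace 𝓘(ℝ, EP) g},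
      (∀ g h, G.src g = G.tgt h → (mfderiv 𝓘(ℝ, EP) 𝓘(ℝ, EX) G.src g (U g) : EX) =
        mfderiv 𝓘(ℝ, EP) 𝓘(ℝ, EX) G.tgt h (V h)) →
      (∀ g h, G.src g = G.tgt h → (Z (G.mul g h) : EP) = G.tangentMul g h (U g) (V h)) →
      ∀ z, good z → (mfderiv 𝓘(ℝ, EP × EP) 𝓘(ℝ, EP) f z (Prod.map (vecRep g U) (vecRep h V) z)
        : EP) = Z (f z) ∧ (mfderiv 𝓘(ℝ, EP × EP) 𝓘(ℝ, EP) α z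
          (Prod.map (vecRep g U) (vecRep h V) z) : EP) = U (φ.symm z.1) := by
    intro U V Z hc hm z hz
    obtain ⟨k1, k2, k3⟩ := key z hz (vecRep g U z.1, vecRep h V z.2) _ _ (mfderiv_vecRep hz.1 U) (mfderiv_vecRep hz.2.1 V)
      (hc _ _ hz.2.2.2)
    refine ⟨?_, k2⟩
    have e : ∀ p q : P, p = q → (Z p : EP) = Z q := by rintro p _ rfl; rfl
    rw [e _ _ k1, hm _ _ hz.2.2.2]
    exact k3
  -- The product field is tangent to the composable pairs at `v`, so `dρ` fixes its value there.
  have hfix : ∀ {U V Z : Π g : P, TangentSpace 𝓘(ℝ, EP) g},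
      (∀ g h, G.src g = G.tgt h → (mfderiv 𝓘(ℝ, EP) 𝓘(ℝ, EX) G.src g (U g) : EX) =
        mfderiv 𝓘(ℝ, EP) 𝓘(ℝ, EX) G.tgt h (V h)) →
      (∀ g h, G.src g = G.tgt h → (Z (G.mul g h) : EP) = G.tangentMul g h (U g) (V h)) →
      fderiv ℝ ρ v (Prod.map (vecRep g U) (vecRep h V) v) =
        Prod.map (vecRep g U) (vecRep h V) v := by
    intro U V Z hc hm
    have k := (hrel hc hm v hgv).2
    have hs : α v ∈ φ.source := by rw [hα0]; exact mem_extChartAt_source g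
    have d1 := (contDiffAt_chart_comp hs hαv).differentiableAt (by simp)
    have d2 : fderiv ℝ ρ v = (fderiv ℝ (fun y => φ (α y)) v).prod
        (ContinuousLinearMap.snd ℝ EP EP) :=
      (d1.hasFDerivAt.prodMk hasFDerivAt_snd).fderiv
    have d3 : (fderiv ℝ (fun y => φ (α y)) v (Prod.map (vecRep g U) (vecRep h V) v) : EP) =
        vecRep g U v.1 := by
      have d4 := mfderiv_comp_apply_of_eq ((contMDiffAt_chart hs).mdifferentiableAt (by simp))
        (hαv.mdifferentiableAt (by simp)) rfl (Prod.map (vecRep g U) (vecRep h V) v)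
      rw [k] at d4
      have d5 := mfderiv_chart_chart_symm hv1 (vecRep g U v.1)
      rw [← mfderiv_eq_fderiv]
      refine d4.symm.trans (Eq.trans ?_ d5)
      have d6 : ∀ p q : P, p = q → ∀ u : EP, (mfderiv 𝓘(ℝ, EP) 𝓘(ℝ, EP) φ p u : EP) =
        mfderiv 𝓘(ℝ, EP) 𝓘(ℝ, EP) φ q u := by rintro p _ rfl u; rfl
      refine (d6 _ _ (hα0.trans hφv.symm) _).trans ?_
      exact congrArg (mfderiv 𝓘(ℝ, EP) 𝓘(ℝ, EP) φ (φ.symm v.1) : EP →L[ℝ] EP)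
        (mfderiv_vecRep hv1 U).symm
    rw [d2]
    exact Prod.ext d3 rfl
  have main := mlieBracket_of_related_retract hfs
    (w₁ := Prod.map (vecRep g U₁) (vecRep h V₁)) (w₂ := Prod.map (vecRep g U₂) (vecRep h V₂))
    (DifferentiableAt.prodMap (p := v) (hd hU₁ hV₁).1 (hd hU₁ hV₁).2)
    (DifferentiableAt.prodMap (p := v) (hd hU₂ hV₂).1 (hd hU₂ hV₂).2) hZ₁ hZ₂
    (hρd.differentiableAt (by simp)) hρv (hfix hc₁ hm₁) (hfix hc₂ hm₂)
    (by filter_upwards [hgood_ev] with y hy using (hrel hc₁ hm₁ _ hy).1)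
    (by filter_upwards [hgood_ev] with y hy using (hrel hc₂ hm₂ _ hy).1)
  rw [lieBracket_prodMap (hd hU₁ hV₁).1 (hd hU₁ hV₁).2 (hd hU₂ hV₂).1 (hd hU₂ hV₂).2] at main
  have b1 := mfderiv_chart_symm_lieBracket hv1 hU₁ hU₂
  have b2 := mfderiv_chart_symm_lieBracket hv2 hV₁ hV₂
  have e : ∀ (W W' : Π g : P, TangentSpace 𝓘(ℝ, EP) g) (p q : P), p = q →
    (VectorField.mlieBracket 𝓘(ℝ, EP) W W' p : EP) = VectorField.mlieBracket 𝓘(ℝ, EP) W W' q := by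
      rintro W W' p _ rfl; rfl
  have b1' := Eq.trans (α := EP) b1 (e _ _ _ _ hφv)
  have b2' := Eq.trans (α := EP) b2 (e _ _ _ _ hψv)
  have e' : ∀ (p q p' q' : P), p = p' → q = q' → ∀ u w : EP,
    ((mfderiv 𝓘(ℝ, EP) 𝓘(ℝ, EX) G.src p u : EX) = mfderiv 𝓘(ℝ, EP) 𝓘(ℝ, EX) G.src p' u) ∧
    ((mfderiv 𝓘(ℝ, EP) 𝓘(ℝ, EX) G.tgt q w : EX) = mfderiv 𝓘(ℝ, EP) 𝓘(ℝ, EX) G.tgt q' w) ∧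
    (G.tangentMul p q u w : EP) = G.tangentMul p' q' u w := by
      rintro p q _ _ rfl rfl u w; exact ⟨rfl, rfl, rfl⟩
  obtain ⟨e1, e2, e3⟩ := e' _ _ _ _ hφv hψv (VectorField.mlieBracket 𝓘(ℝ, EP) U₁ U₂ g)
    (VectorField.mlieBracket 𝓘(ℝ, EP) V₁ V₂ h)
  -- The hypothesis `hb` makes the two brackets composable, so that the derivative of `f` on the
  -- pair is their product.
  obtain ⟨-, -, k3⟩ := key v hgv
    (VectorField.lieBracket ℝ (vecRep g U₁) (vecRep g U₂) v.1,
      VectorField.lieBracket ℝ (vecRep h V₁) (vecRep h V₂) v.2) _ _ b1' b2' (e1.trans (hb.trans e2.symm))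
  exact (e _ _ _ _ hfv).symm.trans (Eq.trans (α := EP) main.symm (k3.trans e3))

end LieGroupoid

end Groupoid

end Gerbe

namespace Gerbe

/-! ### Smoothness of the invariant vector fields and of the anchor -/

section Groupoid

namespace LieGroupoid

variable {EX EP X P : Type*}
  [NormedAddCommGroup EX] [NormedSpace ℝ EX] [TopologicalSpace X] [ChartedSpace EX X]
  [NormedAddCommGroup EP] [NormedSpace ℝ EP] [TopologicalSpace P] [ChartedSpace EP P]
  [IsManifold 𝓘(ℝ, EX) ∞ X] [IsManifold 𝓘(ℝ, EP) ∞ P]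
  (G : LieGroupoid EX EP X P) {a : Π x : X, TangentSpace 𝓘(ℝ, EP) (G.unit x)}

/-- The value at `g` is the derivative of multiplication applied to `(a (t g), 0)`. Multiplication
is smooth only on composable pairs, so it is first extended to an open set of `P × P`; the field is
then a composite of smooth maps. -/
theorem rightField_mem (ha : a ∈ G.algebroidSection) : G.rightField a ∈ VectorField EP P := by
  have : IsManifold 𝓘(ℝ, EP) 1 P := IsManifold.of_le (n := ∞) (by norm_cast)
  intro g₀
  obtain ⟨r, hr⟩ := exists_localLift G.isSubmersion_src (G.unit (G.tgt g₀))
  rw [G.src_unit] at hr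
  set S : Set (P × P) := {q | (q.1, G.tgt q.2) ∈ r.dom} with hS
  -- The first arrow is moved into the source fibre over the target of the second, which makes every
  -- nearby pair composable.
  set μ : P × P → P := fun q => G.mul (r.toFun (q.1, G.tgt q.2)) q.2 with hμ
  have hpair : ContMDiff (𝓘(ℝ, EP).prod 𝓘(ℝ, EP)) (𝓘(ℝ, EP).prod 𝓘(ℝ, EX)) ∞
      (fun q : P × P => (q.1, G.tgt q.2)) :=
    contMDiff_fst.prodMk (G.isSubmersion_tgt.contMDiff.comp contMDiff_snd)
  have hSo : IsOpen S := r.isOpen_dom.preimage hpair.continuous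
  have hμs : ∀ q ∈ S, ContMDiffAt (𝓘(ℝ, EP).prod 𝓘(ℝ, EP)) 𝓘(ℝ, EP) ∞ μ q := by
    intro q hq
    refine G.contMDiffAt_mul ((r.contMDiffAt hq).comp q hpair.contMDiffAt)
      contMDiff_snd.contMDiffAt ?_
    filter_upwards [hSo.mem_nhds hq] with w hw using r.apply_toFun _ hw
  have hT := ContMDiffOn.contMDiffOn_tangentMapWithin (m := ∞)
    (fun q hq => (hμs q hq).contMDiffWithinAt) (by norm_cast) hSo.uniqueMDiffOn
  set sec : P → TangentBundle (𝓘(ℝ, EP).prod 𝓘(ℝ, EP)) (P × P) := fun g =>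
    (equivTangentBundleProd 𝓘(ℝ, EP) P 𝓘(ℝ, EP) P).symm
      (⟨G.unit (G.tgt g), a (G.tgt g)⟩, ⟨g, (0 : EP)⟩) with hsec
  have hsecs : ContMDiff 𝓘(ℝ, EP) (𝓘(ℝ, EP).prod 𝓘(ℝ, EP)).tangent ∞ sec := by
    refine contMDiff_equivTangentBundleProd_symm.comp (ContMDiff.prodMk ?_ ?_)
    · exact ha.1.comp G.isSubmersion_tgt.contMDiff
    · exact (zero_mem (VectorField EP P) :)
  have hn : {g | sec g ∈ Bundle.TotalSpace.proj ⁻¹' S} ∈ 𝓝 g₀ := by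
    have : ContinuousAt (fun g => (G.unit (G.tgt g), G.tgt g)) g₀ :=
      ((G.contMDiff_unit.continuous.comp G.isSubmersion_tgt.contMDiff.continuous).prodMk
        G.isSubmersion_tgt.contMDiff.continuous).continuousAt
    exact this.preimage_mem_nhds (r.isOpen_dom.mem_nhds hr)
  have hg₀ : sec g₀ ∈ Bundle.TotalSpace.proj ⁻¹' S := hr
  have hcomp := (ContMDiffWithinAt.comp (s := sec ⁻¹' (Bundle.TotalSpace.proj ⁻¹' S)) g₀
    (hT (sec g₀) hg₀) hsecs.contMDiffAt.contMDiffWithinAt (mapsTo_preimage _ _)).contMDiffAt hn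
  refine hcomp.congr_of_eventuallyEq ?_
  filter_upwards [hn] with g hg
  have hg' : (G.unit (G.tgt g), G.tgt g) ∈ r.dom := hg
  have hgS : (G.unit (G.tgt g), g) ∈ S := hg
  have hr0 : r.toFun (G.unit (G.tgt g), G.tgt g) = G.unit (G.tgt g) := by
    have := r.toFun_self (G.unit (G.tgt g))
    rw [G.src_unit] at this
    exact this hg'
  refine totalSpace_ext ?_ ?_
  · change g = μ (G.unit (G.tgt g), g)
    rw [hμ]
    simp only [hr0, G.unit_mul]
  · change (G.rightField a g : EP) = (mfderivWithin (𝓘(ℝ, EP).prod 𝓘(ℝ, EP)) 𝓘(ℝ, EP) μ S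
      (G.unit (G.tgt g), g) : EP × EP →L[ℝ] EP) ((a (G.tgt g) : EP), (0 : EP))
    rw [mfderivWithin_of_isOpen hSo hgS]
    obtain ⟨k, hk⟩ := G.exists_isSectionCurve ha (G.tgt g)
    rw [hk.rightField_eq rfl, ← hk.velocity_eq]
    have h1 : HasMFDerivAt 𝓘(ℝ, ℝ) (𝓘(ℝ, EP).prod 𝓘(ℝ, EP)) (fun τ => (k τ, g)) (0 : ℝ) _ :=
      (hk.contMDiffAt.mdifferentiableAt (by simp)).hasMFDerivAt.prodMk
        (hasMFDerivAt_const g (0 : ℝ))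
    have h2 : MDifferentiableAt (𝓘(ℝ, EP).prod 𝓘(ℝ, EP)) 𝓘(ℝ, EP) μ (k 0, g) := by
      rw [hk.apply_zero]
      exact (hμs _ hgS).mdifferentiableAt (by simp)
    have h3 := DFunLike.congr_fun (h2.hasMFDerivAt.comp (0 : ℝ) h1).mfderiv (1 : ℝ)
    -- A curve inside the source fibre over `t g` is not moved by the lift, so the extension agrees
    -- with the product along it.
    have h4 : velocity EP (fun τ => G.mul (k τ) g) = velocity EP (fun τ => μ (k τ, g)) := by
      refine velocity_congr ?_
      have : ∀ᶠ τ in 𝓝 (0 : ℝ), (k τ, g) ∈ S := h1.continuousAt.preimage_mem_nhds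
        (hSo.mem_nhds (by rwa [hk.apply_zero]))
      filter_upwards [this, hk.src_eq] with τ h5 h6
      have h7 : (k τ, G.tgt g) ∈ r.dom := h5
      have := r.toFun_self (k τ)
      rw [h6] at this
      rw [hμ]
      simp only [this h7]
    rw [h4]
    refine Eq.trans (α := EP) h3 ?_
    have e : ∀ p q : P × P, p = q → ∀ u : EP × EP,
      (mfderiv (𝓘(ℝ, EP).prod 𝓘(ℝ, EP)) 𝓘(ℝ, EP) μ p : EP × EP →L[ℝ] EP) u =
      (mfderiv (𝓘(ℝ, EP).prod 𝓘(ℝ, EP)) 𝓘(ℝ, EP) μ q : EP × EP →L[ℝ] EP) u := by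
        rintro p _ rfl u; rfl
    exact e (k 0, g) _ (by rw [hk.apply_zero]) (velocity EP k, (0 : EP))

/-- Inversion carries the right-invariant field to the left-invariant one, so smoothness transfers.
-/
theorem leftField_mem (ha : a ∈ G.algebroidSection) : G.leftField a ∈ VectorField EP P := by
  have h1 : ContMDiff 𝓘(ℝ, EP).tangent 𝓘(ℝ, EP).tangent ∞ (tangentMap 𝓘(ℝ, EP) 𝓘(ℝ, EP) G.inv) :=
    G.contMDiff_inv.contMDiff_tangentMap (by norm_cast)
  have h2 := h1.comp (ContMDiff.comp (G.rightField_mem ha) G.contMDiff_inv)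
  refine h2.congr fun g => totalSpace_ext (G.inv_inv g).symm ?_
  have e : ∀ p q : P, p = q → (G.leftField a p : EP) = G.leftField a q := by rintro p _ rfl; rfl
  exact (e _ _ (G.inv_inv g).symm).trans (G.mfderiv_inv_rightField ha (G.inv g)).symm

theorem anchor_mem (ha : a ∈ G.algebroidSection) : G.anchor a ∈ VectorField EX X := by
  have h1 : ContMDiff 𝓘(ℝ, EP).tangent 𝓘(ℝ, EX).tangent ∞ (tangentMap 𝓘(ℝ, EP) 𝓘(ℝ, EX) G.tgt) :=
    G.isSubmersion_tgt.contMDiff.contMDiff_tangentMap (by norm_cast)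
  have h2 := h1.comp ha.1
  exact h2.congr fun x => totalSpace_ext (G.tgt_unit x).symm rfl

theorem barField_mem (ha : a ∈ G.algebroidSection) : G.barField a ∈ VectorField EP P :=
  add_mem (G.rightField_mem ha) (G.leftField_mem ha)

end LieGroupoid

end Groupoid

end Gerbe

namespace Gerbe

/-! ### Linearity and Jacobi identity for brackets of smooth vector fields -/

namespace VectorField

variable {E : Type*} [NormedAddCommGroup E] [NormedSpace ℝ E] [CompleteSpace E]
  {M : Type*} [TopologicalSpace M] [ChartedSpace E M] [IsManifold 𝓘(ℝ, E) ∞ M]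
  {U V W : Π x : M, TangentSpace 𝓘(ℝ, E) x}

open _root_.VectorField

theorem mdifferentiableAt_of_mem (hV : V ∈ VectorField E M) (x : M) :
    MDifferentiableAt 𝓘(ℝ, E) (𝓘(ℝ, E).prod 𝓘(ℝ, E))
      (fun x => (⟨x, V x⟩ : TangentBundle 𝓘(ℝ, E) M)) x :=
  ContMDiffAt.mdifferentiableAt (hV x) (by simp)

theorem mlieBracket_add_left (hU : U ∈ VectorField E M) (hV : V ∈ VectorField E M) :
    mlieBracket 𝓘(ℝ, E) (U + V) W = mlieBracket 𝓘(ℝ, E) U W + mlieBracket 𝓘(ℝ, E) V W := by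
  have : IsManifold 𝓘(ℝ, E) (minSmoothness ℝ 2) M := IsManifold.of_le (n := ∞) minSmoothness_two_le
  funext x
  exact _root_.VectorField.mlieBracket_add_left (mdifferentiableAt_of_mem hU x)
    (mdifferentiableAt_of_mem hV x)

theorem mlieBracket_add_right (hU : U ∈ VectorField E M) (hV : V ∈ VectorField E M) :
    mlieBracket 𝓘(ℝ, E) W (U + V) = mlieBracket 𝓘(ℝ, E) W U + mlieBracket 𝓘(ℝ, E) W V := by
  have : IsManifold 𝓘(ℝ, E) (minSmoothness ℝ 2) M := IsManifold.of_le (n := ∞) minSmoothness_two_le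
  funext x
  exact _root_.VectorField.mlieBracket_add_right (mdifferentiableAt_of_mem hU x)
    (mdifferentiableAt_of_mem hV x)

theorem mlieBracket_smul_left (hU : U ∈ VectorField E M) (c : ℝ) :
    mlieBracket 𝓘(ℝ, E) (c • U) W = c • mlieBracket 𝓘(ℝ, E) U W := by
  have : IsManifold 𝓘(ℝ, E) (minSmoothness ℝ 2) M := IsManifold.of_le (n := ∞) minSmoothness_two_le
  funext x
  exact mlieBracket_const_smul_left (mdifferentiableAt_of_mem hU x)

theorem mlieBracket_smul_right (hU : U ∈ VectorField E M) (c : ℝ) :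
    mlieBracket 𝓘(ℝ, E) W (c • U) = c • mlieBracket 𝓘(ℝ, E) W U := by
  have : IsManifold 𝓘(ℝ, E) (minSmoothness ℝ 2) M := IsManifold.of_le (n := ∞) minSmoothness_two_le
  funext x
  exact mlieBracket_const_smul_right (mdifferentiableAt_of_mem hU x)

theorem leibniz_mlieBracket (hU : U ∈ VectorField E M) (hV : V ∈ VectorField E M)
    (hW : W ∈ VectorField E M) :
    mlieBracket 𝓘(ℝ, E) U (mlieBracket 𝓘(ℝ, E) V W) =
      mlieBracket 𝓘(ℝ, E) (mlieBracket 𝓘(ℝ, E) U V) W +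
        mlieBracket 𝓘(ℝ, E) V (mlieBracket 𝓘(ℝ, E) U W) := by
  have : IsManifold 𝓘(ℝ, E) (minSmoothness ℝ 3) M := IsManifold.of_le (n := ∞)
    (by rw [minSmoothness_of_isRCLikeNormedField]; exact WithTop.coe_le_coe.2 le_top)
  have e : ∀ {U : Π x : M, TangentSpace 𝓘(ℝ, E) x}, U ∈ VectorField E M →
      ContMDiff 𝓘(ℝ, E) (𝓘(ℝ, E).prod 𝓘(ℝ, E)) (minSmoothness ℝ 2)
        (fun x => (⟨x, U x⟩ : TangentBundle 𝓘(ℝ, E) M)) := fun hU =>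
    ContMDiff.of_le hU minSmoothness_two_le
  exact leibniz_identity_mlieBracket (e hU) (e hV) (e hW)

theorem mlieBracket_jacobi (hU : U ∈ VectorField E M) (hV : V ∈ VectorField E M)
    (hW : W ∈ VectorField E M) :
    mlieBracket 𝓘(ℝ, E) U (mlieBracket 𝓘(ℝ, E) V W) +
      mlieBracket 𝓘(ℝ, E) V (mlieBracket 𝓘(ℝ, E) W U) +
      mlieBracket 𝓘(ℝ, E) W (mlieBracket 𝓘(ℝ, E) U V) = 0 := by
  have h : ∀ {A B : Π x : M, TangentSpace 𝓘(ℝ, E) x}, mlieBracket 𝓘(ℝ, E) A B =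
    -mlieBracket 𝓘(ℝ, E) B A := mlieBracket_swap
  have e : ∀ {A B : Π x : M, TangentSpace 𝓘(ℝ, E) x}, B ∈ VectorField E M →
      mlieBracket 𝓘(ℝ, E) A (-B) = -mlieBracket 𝓘(ℝ, E) A B := by
    intro A B hB
    have := mlieBracket_smul_right (W := A) hB (-1)
    rwa [neg_one_smul, neg_one_smul] at this
  rw [leibniz_mlieBracket hU hV hW, h (A := W) (B := U), e (mlieBracket_mem hU hW),
    h (A := W) (B := mlieBracket 𝓘(ℝ, E) U V)]
  abel

end VectorField

/-! ### Brackets of multiplicative and invariant vector fields -/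

section Groupoid

namespace LieGroupoid

variable {EX EP X P : Type*}
  [NormedAddCommGroup EX] [NormedSpace ℝ EX] [TopologicalSpace X] [ChartedSpace EX X]
  [NormedAddCommGroup EP] [NormedSpace ℝ EP] [TopologicalSpace P] [ChartedSpace EP P]
  [IsManifold 𝓘(ℝ, EX) ∞ X] [IsManifold 𝓘(ℝ, EP) ∞ P] [CompleteSpace EX] [CompleteSpace EP]
  (G : LieGroupoid EX EP X P) {a b : Π x : X, TangentSpace 𝓘(ℝ, EP) (G.unit x)}

variable {G} in
-- Source, target and unit relate the fields, hence their brackets. For the multiplication, `p` is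
-- the product of the pair `(p, p)` and `mlieBracket_mul` applies.
theorem IsMultiplicative.mlieBracket {x z : Π y : X, TangentSpace 𝓘(ℝ, EX) y}
    {p q : Π g : P, TangentSpace 𝓘(ℝ, EP) g} (hp : p ∈ VectorField EP P) (hq : q ∈ VectorField EP P)
    (hx : x ∈ VectorField EX X) (hz : z ∈ VectorField EX X)
    (h₁ : G.IsMultiplicative x p) (h₂ : G.IsMultiplicative z q) :
    G.IsMultiplicative (VectorField.mlieBracket 𝓘(ℝ, EX) x z)
      (VectorField.mlieBracket 𝓘(ℝ, EP) p q) where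
  src g := mfderiv_mlieBracket_of_related G.isSubmersion_src.contMDiff hp hq hx hz h₁.src h₂.src g
  tgt g := mfderiv_mlieBracket_of_related G.isSubmersion_tgt.contMDiff hp hq hx hz h₁.tgt h₂.tgt g
  unit y := mfderiv_mlieBracket_of_related G.contMDiff_unit hx hz hp hq h₁.unit h₂.unit y
  mul g h hgh := by
    have e : ∀ (W : Π y : X, TangentSpace 𝓘(ℝ, EX) y) (y y' : X), y = y' → (W y : EX) = W y' := by
      rintro W y _ rfl; rfl
    have k : ∀ {x : Π y : X, TangentSpace 𝓘(ℝ, EX) y} {p : Π g : P, TangentSpace 𝓘(ℝ, EP) g},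
        G.IsMultiplicative x p → ∀ g h, G.src g = G.tgt h →
        (mfderiv 𝓘(ℝ, EP) 𝓘(ℝ, EX) G.src g (p g) : EX) =
          mfderiv 𝓘(ℝ, EP) 𝓘(ℝ, EX) G.tgt h (p h) := fun hm g h hgh =>
      (hm.src g).trans ((e _ _ _ hgh).trans (hm.tgt h).symm)
    refine G.mlieBracket_mul hp hq hp hq hp hq (k h₁) (k h₂) h₁.mul h₂.mul hgh ?_
    exact Eq.trans (α := EX) (mfderiv_mlieBracket_of_related G.isSubmersion_src.contMDiff
      hp hq hx hz h₁.src h₂.src g) ((e _ _ _ hgh).trans (mfderiv_mlieBracket_of_related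
        G.isSubmersion_tgt.contMDiff hp hq hx hz h₁.tgt h₂.tgt h).symm)

/-- A right-invariant vector field is determined by its values at the units. -/
theorem rightField_eq_of_mul {R : Π g : P, TangentSpace 𝓘(ℝ, EP) g}
    (hR : ∀ g h, G.src g = G.tgt h → (R (G.mul g h) : EP) = G.tangentMul g h (R g) (0 : EP))
    (ha : a ∈ G.algebroidSection) (h : ∀ x, (R (G.unit x) : EP) = a x) :
    G.rightField a = R := by
  funext g
  have e : ∀ p q : P, p = q → (R p : EP) = R q := by rintro p _ rfl; rfl
  have h1 := hR (G.unit (G.tgt g)) g (G.src_unit _)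
  rw [h] at h1
  exact (G.rightField_eq_tangentMul ha g).trans (h1.symm.trans (e _ _ (G.unit_mul g)))

/-- A left-invariant vector field is determined by its values at the units. -/
theorem leftField_eq_of_mul {R : Π g : P, TangentSpace 𝓘(ℝ, EP) g}
    (hR : ∀ g h, G.src g = G.tgt h → (R (G.mul g h) : EP) = G.tangentMul g h (0 : EP) (R h))
    (ha : a ∈ G.algebroidSection)
    (h : ∀ x, (R (G.unit x) : EP) = G.leftField a (G.unit x)) :
    G.leftField a = R := by
  funext g
  have e : ∀ (R : Π g : P, TangentSpace 𝓘(ℝ, EP) g) (p q : P), p = q → (R p : EP) = R q := by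
    rintro R p _ rfl; rfl
  have h1 := hR g (G.unit (G.src g)) (G.tgt_unit _).symm
  have h2 := G.leftField_mul ha (g := g) (h := G.unit (G.src g)) (G.tgt_unit _).symm
  rw [h, ← h2] at h1
  exact (e _ _ _ (G.mul_unit g)).symm.trans (h1.symm.trans (e _ _ _ (G.mul_unit g)))

theorem mfderiv_zero_apply {E : Type*} [NormedAddCommGroup E] [NormedSpace ℝ E]
    {M : Type*} [TopologicalSpace M] [ChartedSpace E M]
    {E' : Type*} [NormedAddCommGroup E'] [NormedSpace ℝ E']
    {N : Type*} [TopologicalSpace N] [ChartedSpace E' N] (f : M → N) (x : M) :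
    (mfderiv 𝓘(ℝ, E) 𝓘(ℝ, E') f x ((0 : Π x : M, TangentSpace 𝓘(ℝ, E) x) x) : E') = 0 :=
  map_zero (mfderiv 𝓘(ℝ, E) 𝓘(ℝ, E') f x)

/-- The fields are the products of `(→a, 0)` and `(0, ←b)`, whose brackets vanish in each factor.
Evaluating at `g · 1 = g` gives the claim everywhere. -/
theorem mlieBracket_rightField_leftField (ha : a ∈ G.algebroidSection)
    (hb : b ∈ G.algebroidSection) :
    VectorField.mlieBracket 𝓘(ℝ, EP) (G.rightField a) (G.leftField b) = 0 := by
  funext g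
  have hgh : G.src g = G.tgt (G.unit (G.src g)) := (G.tgt_unit _).symm
  have h := G.mlieBracket_mul (U₁ := G.rightField a) (U₂ := 0) (V₁ := 0) (V₂ := G.leftField b)
    (G.rightField_mem ha) (zero_mem _) (zero_mem _) (G.leftField_mem hb) (G.rightField_mem ha)
    (G.leftField_mem hb)
    (fun g h _ => Eq.trans (α := EX) (G.mfderiv_src_rightField ha g) (mfderiv_zero_apply G.tgt h).symm)
    (fun g h _ => (mfderiv_zero_apply _ _).trans (G.mfderiv_tgt_leftField hb h).symm)
    (fun g h hgh => G.rightField_mul ha hgh) (fun g h hgh => G.leftField_mul hb hgh) hgh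
    (by
      rw [VectorField.mlieBracket_zero_right, VectorField.mlieBracket_zero_left]
      exact Eq.trans (α := EX) (mfderiv_zero_apply G.src _) (mfderiv_zero_apply G.tgt _).symm)
  rw [VectorField.mlieBracket_zero_right, VectorField.mlieBracket_zero_left] at h
  have e : ∀ (R : Π g : P, TangentSpace 𝓘(ℝ, EP) g) (p q : P), p = q → (R p : EP) = R q := by
    rintro R p _ rfl; rfl
  refine (e _ _ _ (G.mul_unit g)).symm.trans (h.trans ?_)
  exact map_zero (mfderivWithin (𝓘(ℝ, EP).prod 𝓘(ℝ, EP)) 𝓘(ℝ, EP)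
    (fun q : P × P => G.mul q.1 q.2) {q | G.src q.1 = G.tgt q.2} (g, G.unit (G.src g)))

/-- The action of a vector field on `P` on the sections of the Lie algebroid: the restriction to
the units of the bracket with the right-invariant extension. -/
def bracketSection (p : Π g : P, TangentSpace 𝓘(ℝ, EP) g)
    (a : Π x : X, TangentSpace 𝓘(ℝ, EP) (G.unit x)) : Π x : X, TangentSpace 𝓘(ℝ, EP) (G.unit x) :=
  fun x => VectorField.mlieBracket 𝓘(ℝ, EP) p (G.rightField a) (G.unit x)

variable {x : Π y : X, TangentSpace 𝓘(ℝ, EX) y} {p : Π g : P, TangentSpace 𝓘(ℝ, EP) g}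

theorem mfderiv_src_mlieBracket_rightField (hx : x ∈ VectorField EX X) (hp : p ∈ VectorField EP P)
    (hm : G.IsMultiplicative x p) (ha : a ∈ G.algebroidSection) (g : P) :
    (mfderiv 𝓘(ℝ, EP) 𝓘(ℝ, EX) G.src g
      (VectorField.mlieBracket 𝓘(ℝ, EP) p (G.rightField a) g) : EX) = 0 := by
  have h := mfderiv_mlieBracket_of_related G.isSubmersion_src.contMDiff hp (G.rightField_mem ha) hx
    (zero_mem _) hm.src (G.mfderiv_src_rightField ha) g
  rw [VectorField.mlieBracket_zero_right] at h
  exact h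

theorem bracketSection_mem (hx : x ∈ VectorField EX X) (hp : p ∈ VectorField EP P)
    (hm : G.IsMultiplicative x p) (ha : a ∈ G.algebroidSection) :
    G.bracketSection p a ∈ G.algebroidSection :=
  ⟨ContMDiff.comp (mlieBracket_mem hp (G.rightField_mem ha)) G.contMDiff_unit,
    fun y => G.mfderiv_src_mlieBracket_rightField hx hp hm ha (G.unit y)⟩

/-- Taking brackets of the pairs `(p, p)` and `(→a, 0)` gives `([p, →a], 0)`, so `[p, →a]` is
right-invariant and is recovered from its restriction to the units. -/
theorem rightField_bracketSection (hx : x ∈ VectorField EX X) (hp : p ∈ VectorField EP P)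
    (hm : G.IsMultiplicative x p) (ha : a ∈ G.algebroidSection) :
    G.rightField (G.bracketSection p a) =
      VectorField.mlieBracket 𝓘(ℝ, EP) p (G.rightField a) := by
  refine G.rightField_eq_of_mul (fun g h hgh => ?_) (G.bracketSection_mem hx hp hm ha) fun x => rfl
  have e : ∀ (W : Π y : X, TangentSpace 𝓘(ℝ, EX) y) (y y' : X), y = y' → (W y : EX) = W y' := by
    rintro W y _ rfl; rfl
  have h := G.mlieBracket_mul (U₁ := p) (U₂ := G.rightField a) (V₁ := p) (V₂ := 0)
    hp (G.rightField_mem ha) hp (zero_mem _) hp (G.rightField_mem ha)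
    (fun g h hgh => (hm.src g).trans ((e _ _ _ hgh).trans (hm.tgt h).symm))
    (fun g h _ => Eq.trans (α := EX) (G.mfderiv_src_rightField ha g) (mfderiv_zero_apply G.tgt h).symm)
    hm.mul (fun g h hgh => G.rightField_mul ha hgh) hgh
    (by
      rw [VectorField.mlieBracket_zero_right]
      exact Eq.trans (α := EX) (G.mfderiv_src_mlieBracket_rightField hx hp hm ha g)
        (mfderiv_zero_apply G.tgt h).symm)
  rw [VectorField.mlieBracket_zero_right] at h
  exact h

theorem anchor_bracketSection (hx : x ∈ VectorField EX X) (hp : p ∈ VectorField EP P)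
    (hm : G.IsMultiplicative x p) (ha : a ∈ G.algebroidSection) :
    G.anchor (G.bracketSection p a) = VectorField.mlieBracket 𝓘(ℝ, EX) x (G.anchor a) := by
  funext y
  have h := mfderiv_mlieBracket_of_related G.isSubmersion_tgt.contMDiff hp (G.rightField_mem ha) hx
    (G.anchor_mem ha) hm.tgt (G.mfderiv_tgt_rightField ha) (G.unit y)
  have e : ∀ (W : Π y : X, TangentSpace 𝓘(ℝ, EX) y) (y y' : X), y = y' → (W y : EX) = W y' := by
    rintro W y _ rfl; rfl
  exact Eq.trans (α := EX) h (e _ _ _ (G.tgt_unit y))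

/-- Left-invariance of `[p, ←a]` comes from the pairs `(p, p)` and `(0, ←a)`, so only the units need
checking; there the right-invariant case is used. -/
theorem leftField_bracketSection (hx : x ∈ VectorField EX X) (hp : p ∈ VectorField EP P)
    (hm : G.IsMultiplicative x p) (ha : a ∈ G.algebroidSection) :
    G.leftField (G.bracketSection p a) =
      VectorField.mlieBracket 𝓘(ℝ, EP) p (G.leftField a) := by
  have e : ∀ (W : Π y : X, TangentSpace 𝓘(ℝ, EX) y) (y y' : X), y = y' → (W y : EX) = W y' := by
    rintro W y _ rfl; rfl
  have hb := G.bracketSection_mem hx hp hm ha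
  have ht : ∀ g, (mfderiv 𝓘(ℝ, EP) 𝓘(ℝ, EX) G.tgt g
      (VectorField.mlieBracket 𝓘(ℝ, EP) p (G.leftField a) g) : EX) = 0 := by
    intro g
    have h := mfderiv_mlieBracket_of_related G.isSubmersion_tgt.contMDiff hp (G.leftField_mem ha) hx
      (zero_mem _) hm.tgt (G.mfderiv_tgt_leftField ha) g
    rw [VectorField.mlieBracket_zero_right] at h
    exact h
  refine G.leftField_eq_of_mul (fun g h hgh => ?_) hb fun y => ?_
  · have h := G.mlieBracket_mul (U₁ := p) (U₂ := 0) (V₁ := p) (V₂ := G.leftField a)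
      hp (zero_mem _) hp (G.leftField_mem ha) hp (G.leftField_mem ha)
      (fun g h hgh => (hm.src g).trans ((e _ _ _ hgh).trans (hm.tgt h).symm))
      (fun g h _ => (mfderiv_zero_apply _ _).trans (G.mfderiv_tgt_leftField ha h).symm)
      hm.mul (fun g h hgh => G.leftField_mul ha hgh) hgh
      (by
        rw [VectorField.mlieBracket_zero_right]
        exact (mfderiv_zero_apply _ _).trans (ht h).symm)
    rw [VectorField.mlieBracket_zero_right] at h
    exact h
  -- At a unit, `dε([x, 𝐚])` is `[p, ā]` by relatedness. It is also the sum of the two invariant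
  -- fields of the bracket section, whose anchor is `[x, 𝐚]`. The right-invariant summands agree, so
  -- the left-invariant ones do.
  · have h1 := mfderiv_mlieBracket_of_related G.contMDiff_unit hx (G.anchor_mem ha) hp
      (G.barField_mem ha) hm.unit (G.mfderiv_unit_anchor ha) y
    have h2 := G.mfderiv_unit_anchor hb y
    rw [G.anchor_bracketSection hx hp hm ha] at h2
    have h3 : VectorField.mlieBracket 𝓘(ℝ, EP) p (G.barField a) =
        VectorField.mlieBracket 𝓘(ℝ, EP) p (G.rightField a) +
        VectorField.mlieBracket 𝓘(ℝ, EP) p (G.leftField a) :=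
      VectorField.mlieBracket_add_right (G.rightField_mem ha) (G.leftField_mem ha)
    have h4 := Eq.trans (α := EP) h2.symm h1
    rw [h3, barField, G.rightField_bracketSection hx hp hm ha] at h4
    exact (add_left_cancel (G := TangentSpace 𝓘(ℝ, EP) (G.unit y)) h4).symm

theorem barField_bracketSection (hx : x ∈ VectorField EX X) (hp : p ∈ VectorField EP P)
    (hm : G.IsMultiplicative x p) (ha : a ∈ G.algebroidSection) :
    G.barField (G.bracketSection p a) = VectorField.mlieBracket 𝓘(ℝ, EP) p (G.barField a) := by
  rw [barField, G.rightField_bracketSection hx hp hm ha, G.leftField_bracketSection hx hp hm ha]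
  exact (VectorField.mlieBracket_add_right (G.rightField_mem ha) (G.leftField_mem ha)).symm

/-- The left-invariant part of `ā` commutes with `→b`, so `[ā, →b] = [→a, →b]`, which is skew. This
is the Peiffer identity. -/
theorem bracketSection_barField (ha : a ∈ G.algebroidSection) (hb : b ∈ G.algebroidSection) :
    G.bracketSection (G.barField a) b = -G.bracketSection (G.barField b) a := by
  have h : ∀ {a b}, a ∈ G.algebroidSection → b ∈ G.algebroidSection →
      VectorField.mlieBracket 𝓘(ℝ, EP) (G.barField a) (G.rightField b) =
        VectorField.mlieBracket 𝓘(ℝ, EP) (G.rightField a) (G.rightField b) := by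
    intro a b ha hb
    have h1 : VectorField.mlieBracket 𝓘(ℝ, EP) (G.barField a) (G.rightField b) = _ :=
      VectorField.mlieBracket_add_left (G.rightField_mem ha) (G.leftField_mem ha)
    rw [h1, VectorField.mlieBracket_swap (V := G.leftField a),
      G.mlieBracket_rightField_leftField hb ha, neg_zero, add_zero]
  funext y
  have h1 := congrFun (h ha hb) (G.unit y)
  have h2 := congrFun (h hb ha) (G.unit y)
  have h3 := congrFun (VectorField.mlieBracket_swap (I := 𝓘(ℝ, EP)) (V := G.rightField a)
    (W := G.rightField b)) (G.unit y)
  exact h1.trans (h3.trans (congrArg Neg.neg h2.symm))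

end LieGroupoid

end Groupoid

end Gerbe

namespace Gerbe

/-! ### Formal properties of pullback, contraction and Lie derivative -/

section Forms

variable {E : Type*} [NormedAddCommGroup E] [NormedSpace ℝ E]
  {M : Type*} [TopologicalSpace M] [ChartedSpace E M]
  {E' : Type*} [NormedAddCommGroup E'] [NormedSpace ℝ E']
  {N : Type*} [TopologicalSpace N] [ChartedSpace E' N]

theorem pullbackForm_pullbackForm_of_leftInverse [IsManifold 𝓘(ℝ, E) ∞ M]
    [IsManifold 𝓘(ℝ, E') ∞ N] {k : ℕ} {f : M → N} {g : N → M}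
    (hf : MDifferentiable 𝓘(ℝ, E) 𝓘(ℝ, E') f) (hg : MDifferentiable 𝓘(ℝ, E') 𝓘(ℝ, E) g)
    (h : ∀ x, g (f x) = x) (η : RawForm E M k) :
    (pullbackForm f (pullbackForm g η : RawForm E' N k) : RawForm E M k) = η := by
  funext x
  ext v
  have h1 := fun i => mfderiv_comp_apply_of_eq (hg (f x)) (hf x) rfl (v i)
  have h2 : (fun w => g (f w)) = id := funext h
  have e : ∀ p q : M, p = q → ∀ u : Fin k → E, (η p : E [⋀^Fin k]→L[ℝ] ℝ) u =
    (η q : E [⋀^Fin k]→L[ℝ] ℝ) u := by rintro p _ rfl u; rfl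
  refine Eq.trans ?_ (e _ _ (h x) v)
  change (η (g (f x)) : E [⋀^Fin k]→L[ℝ] ℝ) (fun i => (mfderiv 𝓘(ℝ, E') 𝓘(ℝ, E) g (f x)
    (mfderiv 𝓘(ℝ, E) 𝓘(ℝ, E') f x (v i) : E') : E)) = _
  congr 1
  funext i
  rw [h1 i, h2, mfderiv_id]
  rfl

theorem contract_zero_left {k : ℕ} (η : RawForm E M (k + 1)) :
    contract (0 : Π x : M, TangentSpace 𝓘(ℝ, E) x) η = 0 := by
  have := contract_smul 0 (0 : Π x : M, TangentSpace 𝓘(ℝ, E) x) η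
  rwa [zero_smul, zero_smul] at this

theorem lieD_zero_left {k : ℕ} (η : RawForm E M (k + 1)) :
    lieD (0 : Π x : M, TangentSpace 𝓘(ℝ, E) x) η = 0 := by
  have := lieD_smul 0 (0 : Π x : M, TangentSpace 𝓘(ℝ, E) x) η
  rwa [zero_smul, zero_smul] at this

theorem pullbackForm_zero {k : ℕ} (f : M → N) :
    (pullbackForm f (0 : RawForm E' N k) : RawForm E M k) = 0 := rfl

theorem pullbackForm_add {k : ℕ} (f : M → N) (η ζ : RawForm E' N k) :
    (pullbackForm f (η + ζ) : RawForm E M k) = pullbackForm f η + pullbackForm f ζ := rfl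

theorem pullbackForm_sub {k : ℕ} (f : M → N) (η ζ : RawForm E' N k) :
    (pullbackForm f (η - ζ) : RawForm E M k) = pullbackForm f η - pullbackForm f ζ := rfl

theorem pullbackForm_smul {k : ℕ} (f : M → N) (c : ℝ) (η : RawForm E' N k) :
    (pullbackForm f (c • η) : RawForm E M k) = c • pullbackForm f η := rfl

end Forms

/-! ### The connection form against invariant fields, and the form component of the differential -/

section Groupoid

namespace LieGroupoid

variable {EX EP X P : Type*}
  [NormedAddCommGroup EX] [NormedSpace ℝ EX] [TopologicalSpace X] [ChartedSpace EX X]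
  [NormedAddCommGroup EP] [NormedSpace ℝ EP] [TopologicalSpace P] [ChartedSpace EP P]
  [IsManifold 𝓘(ℝ, EX) ∞ X] [IsManifold 𝓘(ℝ, EP) ∞ P]
  (G : LieGroupoid EX EP X P) {a b : Π x : X, TangentSpace 𝓘(ℝ, EP) (G.unit x)}
  {γ : RawForm EP P 1}

theorem rightField_add : G.rightField (a + b) = G.rightField a + G.rightField b := by
  funext g
  exact map_add (mfderivWithin 𝓘(ℝ, EP) 𝓘(ℝ, EP) (fun h => G.mul h g) {h | G.src h = G.tgt g}
    (G.unit (G.tgt g))) (a (G.tgt g)) (b (G.tgt g))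

theorem rightField_smul (c : ℝ) : G.rightField (c • a) = c • G.rightField a := by
  funext g
  exact map_smul (mfderivWithin 𝓘(ℝ, EP) 𝓘(ℝ, EP) (fun h => G.mul h g) {h | G.src h = G.tgt g}
    (G.unit (G.tgt g))) c (a (G.tgt g))

theorem leftField_add : G.leftField (a + b) = G.leftField a + G.leftField b := by
  funext g
  exact map_add (mfderivWithin 𝓘(ℝ, EP) 𝓘(ℝ, EP) (fun h => G.mul g (G.inv h))
    {h | G.src h = G.src g} (G.unit (G.src g))) (a (G.src g)) (b (G.src g))

theorem leftField_smul (c : ℝ) : G.leftField (c • a) = c • G.leftField a := by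
  funext g
  exact map_smul (mfderivWithin 𝓘(ℝ, EP) 𝓘(ℝ, EP) (fun h => G.mul g (G.inv h))
    {h | G.src h = G.src g} (G.unit (G.src g))) c (a (G.src g))

theorem barField_add : G.barField (a + b) = G.barField a + G.barField b := by
  rw [barField, rightField_add, leftField_add, barField, barField]
  abel

theorem barField_smul (c : ℝ) : G.barField (c • a) = c • G.barField a := by
  rw [barField, rightField_smul, leftField_smul, barField, smul_add]

theorem anchor_add : G.anchor (a + b) = G.anchor a + G.anchor b := by
  funext x
  exact map_add (mfderiv 𝓘(ℝ, EP) 𝓘(ℝ, EX) G.tgt (G.unit x)) (a x) (b x)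

theorem anchor_smul (c : ℝ) : G.anchor (c • a) = c • G.anchor a := by
  funext x
  exact map_smul (mfderiv 𝓘(ℝ, EP) 𝓘(ℝ, EX) G.tgt (G.unit x)) c (a x)

theorem pullbackForm_unit_tgt {k : ℕ} (η : RawForm EX X k) :
    (pullbackForm G.unit (pullbackForm G.tgt η : RawForm EP P k) : RawForm EX X k) = η :=
  pullbackForm_pullbackForm_of_leftInverse G.mdifferentiable_unit G.mdifferentiable_tgt
    G.tgt_unit η

theorem apply_zero_eq_zero (γ : RawForm EP P 1) (g : P) :
    (γ g : EP [⋀^Fin 1]→L[ℝ] ℝ) (fun _ => (0 : EP)) = 0 :=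
  (γ g : EP [⋀^Fin 1]→L[ℝ] ℝ).map_zero

variable {G}

/-- At `g` the field is the product of `a (t g)` with the zero vector, so multiplicativity of `γ`
leaves only the value at the unit over `t g`. -/
theorem IsMultiplicativeForm.contract_rightField (hγ : G.IsMultiplicativeForm γ)
    (ha : a ∈ G.algebroidSection) :
    contract (G.rightField a) γ =
      pullbackForm G.tgt (pullbackForm G.unit (contract (G.rightField a) γ) : RawForm EX X 0) := by
  funext g
  ext v
  have h := hγ (G.unit (G.tgt g)) g (G.src_unit _) (a (G.tgt g)) (0 : EP)
    (Eq.trans (α := EX) (ha.2 (G.tgt g)) (map_zero (mfderiv 𝓘(ℝ, EP) 𝓘(ℝ, EX) G.tgt g)).symm)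
  have h0 := apply_zero_eq_zero γ g
  have e : ∀ (p q : P), p = q → ∀ u : EP, (γ p : EP [⋀^Fin 1]→L[ℝ] ℝ) (fun _ => u) =
    (γ q : EP [⋀^Fin 1]→L[ℝ] ℝ) (fun _ => u) := by
      rintro p _ rfl u; rfl
  have e1 : ∀ (p : P) (u : EP) (w : Fin 0 → EP), (γ p : EP [⋀^Fin 1]→L[ℝ] ℝ)
      (Fin.cons u w : Fin 1 → EP) = (γ p : EP [⋀^Fin 1]→L[ℝ] ℝ) (fun _ => u) := by
    intro p u w
    congr 1
    funext i
    exact Fin.cases rfl (fun j => j.elim0) i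
  refine (e1 g (G.rightField a g) v).trans ?_
  refine Eq.trans ?_ (e1 (G.unit (G.tgt g)) (G.rightField a (G.unit (G.tgt g))) _).symm
  rw [G.rightField_eq_tangentMul ha g, G.rightField_unit ha]
  refine (e _ _ (G.unit_mul g) _).symm.trans (h.trans ?_)
  exact (congrArg _ h0).trans (add_zero _)

/-- The left-invariant vector at `g` and the right-invariant vector at the unit over `s g` multiply
to zero, so `γ` takes opposite values on them. -/
theorem IsMultiplicativeForm.contract_leftField (hγ : G.IsMultiplicativeForm γ)
    (ha : a ∈ G.algebroidSection) :
    contract (G.leftField a) γ =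
      -pullbackForm G.src (pullbackForm G.unit (contract (G.rightField a) γ) : RawForm EX X 0) := by
  funext g
  ext v
  have hgh : G.src g = G.tgt (G.unit (G.src g)) := (G.tgt_unit _).symm
  have eX : ∀ (W : Π y : X, TangentSpace 𝓘(ℝ, EX) y) (y y' : X), y = y' → (W y : EX) = W y' := by
    rintro W y _ rfl; rfl
  have h := hγ g (G.unit (G.src g)) hgh (G.leftField a g) (G.rightField a (G.unit (G.src g)))
    (Eq.trans (α := EX) (G.mfderiv_src_leftField ha g) ((eX _ _ _ hgh).trans
      (G.mfderiv_tgt_rightField ha _).symm))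
  have h0 := apply_zero_eq_zero γ (G.mul g (G.unit (G.src g)))
  have e1 : ∀ (p : P) (u : EP) (w : Fin 0 → EP), (γ p : EP [⋀^Fin 1]→L[ℝ] ℝ)
      (Fin.cons u w : Fin 1 → EP) = (γ p : EP [⋀^Fin 1]→L[ℝ] ℝ) (fun _ => u) := by
    intro p u w
    congr 1
    funext i
    exact Fin.cases rfl (fun j => j.elim0) i
  refine (e1 g (G.leftField a g) v).trans ?_
  refine Eq.trans ?_ (congrArg Neg.neg
    (e1 (G.unit (G.src g)) (G.rightField a (G.unit (G.src g))) _).symm)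
  refine eq_neg_of_add_eq_zero_left (h.symm.trans (Eq.trans ?_ h0))
  exact congrArg (fun u : EP => (γ (G.mul g (G.unit (G.src g))) : EP [⋀^Fin 1]→L[ℝ] ℝ)
    (fun _ => u)) (G.tangentMul_leftField_rightField ha hgh)

theorem IsMultiplicativeForm.contract_barField (hγ : G.IsMultiplicativeForm γ)
    (ha : a ∈ G.algebroidSection) :
    contract (G.barField a) γ =
      -G.delta (pullbackForm G.unit (contract (G.rightField a) γ) : RawForm EX X 0) := by
  rw [barField, contract_add, hγ.contract_leftField ha, delta, neg_sub, sub_eq_add_neg]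
  exact congrArg (· + _) (hγ.contract_rightField ha)

variable (G)

theorem delta_sub {k : ℕ} (η ζ : RawForm EX X k) : G.delta (η - ζ) = G.delta η - G.delta ζ :=
  sub_sub_sub_comm (pullbackForm G.src η) (pullbackForm G.src ζ) (pullbackForm G.tgt η)
    (pullbackForm G.tgt ζ)

theorem extD_delta {k : ℕ} {η : RawForm EX X k} (hη : η ∈ DiffForm EX X k) :
    extD (G.delta η) = G.delta (extD η) := by
  rw [delta, extD_sub (pullbackForm_mem hη G.isSubmersion_src.contMDiff)
    (pullbackForm_mem hη G.isSubmersion_tgt.contMDiff),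
    extD_pullbackForm hη G.isSubmersion_src.contMDiff,
    extD_pullbackForm hη G.isSubmersion_tgt.contMDiff, delta]

variable {x : Π y : X, TangentSpace 𝓘(ℝ, EX) y} {p : Π g : P, TangentSpace 𝓘(ℝ, EP) g}

theorem contract_delta {k : ℕ} (hm : G.IsMultiplicative x p) (η : RawForm EX X (k + 1)) :
    contract p (G.delta η) = G.delta (contract x η) := by
  rw [delta, contract_form_sub, pullbackForm_contract hm.src, pullbackForm_contract hm.tgt, delta]

variable [CompleteSpace EX] [CompleteSpace EP]

theorem lieD_delta {k : ℕ} (hm : G.IsMultiplicative x p) (hx : x ∈ VectorField EX X)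
    (hp : p ∈ VectorField EP P) {η : RawForm EX X (k + 1)} (hη : η ∈ DiffForm EX X (k + 1)) :
    lieD p (G.delta η) = G.delta (lieD x η) := by
  rw [delta, lieD_form_sub hp (pullbackForm_mem hη G.isSubmersion_src.contMDiff)
    (pullbackForm_mem hη G.isSubmersion_tgt.contMDiff),
    lieD_pullbackForm G.isSubmersion_src.contMDiff hx hm.src hη,
    lieD_pullbackForm G.isSubmersion_tgt.contMDiff hx hm.tgt hη, delta]

/-- The right-invariant field is related to zero under the source and to the anchor under the
target, so only the target term of `δ` survives. -/
theorem lieD_rightField_delta {k : ℕ} (ha : a ∈ G.algebroidSection) {η : RawForm EX X (k + 1)}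
    (hη : η ∈ DiffForm EX X (k + 1)) :
    lieD (G.rightField a) (G.delta η) = -pullbackForm G.tgt (lieD (G.anchor a) η) := by
  rw [delta, lieD_form_sub (G.rightField_mem ha)
    (pullbackForm_mem hη G.isSubmersion_src.contMDiff)
    (pullbackForm_mem hη G.isSubmersion_tgt.contMDiff),
    lieD_pullbackForm G.isSubmersion_src.contMDiff (zero_mem _) (G.mfderiv_src_rightField ha) hη,
    lieD_pullbackForm G.isSubmersion_tgt.contMDiff (G.anchor_mem ha)
      (G.mfderiv_tgt_rightField ha) hη, lieD_zero_left, pullbackForm_zero, zero_sub]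

/-- The 1-form `-ε^* L_{a→} γ` on `X`. -/
def algebroidForm (γ : RawForm EP P 1) (a : Π x : X, TangentSpace 𝓘(ℝ, EP) (G.unit x)) :
    RawForm EX X 1 :=
  -pullbackForm G.unit (lieD (G.rightField a) γ)

theorem algebroidForm_mem (hγ : γ ∈ DiffForm EP P 1) (ha : a ∈ G.algebroidSection) :
    G.algebroidForm γ a ∈ DiffForm EX X 1 :=
  neg_mem (pullbackForm_mem (lieD_mem hγ (G.rightField_mem ha)) G.contMDiff_unit)

theorem algebroidForm_add (hγ : γ ∈ DiffForm EP P 1) (ha : a ∈ G.algebroidSection)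
    (hb : b ∈ G.algebroidSection) :
    G.algebroidForm γ (a + b) = G.algebroidForm γ a + G.algebroidForm γ b := by
  rw [algebroidForm, rightField_add, lieD_add (G.rightField_mem ha) (G.rightField_mem hb) hγ,
    pullbackForm_add, neg_add, algebroidForm, algebroidForm]

theorem algebroidForm_smul (c : ℝ) :
    G.algebroidForm γ (c • a) = c • G.algebroidForm γ a := by
  rw [algebroidForm, rightField_smul, lieD_smul, pullbackForm_smul, algebroidForm, smul_neg]

/-- Contracting `dγ = s^*B - t^*B` with `→a` leaves `-t^* ι_𝐚 B`, and `t ∘ ε = id`; Cartan's formula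
does the rest. The right side does not involve `B`, hence the differential is the same for all
curvings. -/
theorem contract_curving_sub_extD (hγ : γ ∈ DiffForm EP P 1) (ha : a ∈ G.algebroidSection)
    {B : RawForm EX X 2} (hB : G.delta B = extD γ) :
    contract (G.anchor a) B -
      extD (pullbackForm G.unit (contract (G.rightField a) γ) : RawForm EX X 0) =
      G.algebroidForm γ a := by
  have h1 : contract (G.rightField a) (extD γ) = -pullbackForm G.tgt (contract (G.anchor a) B) := by
    rw [← hB, delta, contract_form_sub, pullbackForm_contract (Z := 0) (G.mfderiv_src_rightField ha),
      pullbackForm_contract (G.mfderiv_tgt_rightField ha)]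
    have := contract_zero_left B
    have h2 : (pullbackForm G.src (contract (0 : Π y : X, TangentSpace 𝓘(ℝ, EX) y) B)
      : RawForm EP P 1) = 0 := by rw [this]; rfl
    exact (congrArg (· - _) h2).trans (zero_sub _)
  have h3 : (pullbackForm G.unit (-pullbackForm G.tgt (contract (G.anchor a) B) : RawForm EP P 1)
      : RawForm EX X 1) = -contract (G.anchor a) B :=
    congrArg Neg.neg (G.pullbackForm_unit_tgt (contract (G.anchor a) B))
  rw [algebroidForm, lieD, pullbackForm_add, h1, h3,
    extD_pullbackForm (contract_mem hγ (G.rightField_mem ha)) G.contMDiff_unit]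
  abel

variable {G} in
-- By Cartan's formula, with `ι_ā dγ = ι_ā δB = δ ι_𝐚 B` because `ā` is multiplicative over `𝐚`, and
-- `d ι_ā γ = -δ d v_a`. A curving is what exhibits the result as a `δ`.
theorem IsMultiplicativeForm.lieD_barField (hγm : G.IsMultiplicativeForm γ)
    (hγ : γ ∈ DiffForm EP P 1) (ha : a ∈ G.algebroidSection)
    {B : RawForm EX X 2} (hB : G.delta B = extD γ) :
    lieD (G.barField a) γ = G.delta (G.algebroidForm γ a) := by
  have hv : (pullbackForm G.unit (contract (G.rightField a) γ) : RawForm EX X 0) ∈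
    DiffForm EX X 0 := pullbackForm_mem (contract_mem hγ (G.rightField_mem ha)) G.contMDiff_unit
  rw [← G.contract_curving_sub_extD hγ ha hB, delta_sub, ← G.extD_delta hv,
    ← G.contract_delta (G.isMultiplicative_barField ha), hB, lieD, hγm.contract_barField ha,
    extD_neg]
  abel

/-- Expand `L_{[p, →a]} γ` as a commutator. Pulled back by the unit map, `L_p` becomes `L_x`, while
`L_{→a} L_p γ = L_{→a} δα` becomes `-L_𝐚 α`. This is the form component of equivariance of the
differential. -/
theorem algebroidForm_bracketSection (hγ : γ ∈ DiffForm EP P 1) (hx : x ∈ VectorField EX X)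
    (hp : p ∈ VectorField EP P) (hm : G.IsMultiplicative x p) (ha : a ∈ G.algebroidSection)
    {α : RawForm EX X 1} (hα : α ∈ DiffForm EX X 1) (h : lieD p γ = G.delta α) :
    G.algebroidForm γ (G.bracketSection p a) =
      lieD x (G.algebroidForm γ a) - lieD (G.anchor a) α := by
  rw [algebroidForm, G.rightField_bracketSection hx hp hm ha,
    lieD_mlieBracket hγ hp (G.rightField_mem ha), h, G.lieD_rightField_delta ha hα,
    pullbackForm_sub, algebroidForm, lieD_form_neg,
    lieD_pullbackForm G.contMDiff_unit hp hm.unit (lieD_mem hγ (G.rightField_mem ha))]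
  have h3 : (pullbackForm G.unit (-pullbackForm G.tgt (lieD (G.anchor a) α) : RawForm EP P 1)
      : RawForm EX X 1) = -lieD (G.anchor a) α :=
    congrArg Neg.neg (G.pullbackForm_unit_tgt (lieD (G.anchor a) α))
  rw [h3]
  abel

theorem lieD_mlieBracket_delta (hγ : γ ∈ DiffForm EP P 1)
    {z : Π y : X, TangentSpace 𝓘(ℝ, EX) y} {q : Π g : P, TangentSpace 𝓘(ℝ, EP) g}
    (hx : x ∈ VectorField EX X) (hp : p ∈ VectorField EP P) (hz : z ∈ VectorField EX X)
    (hq : q ∈ VectorField EP P) (h₁ : G.IsMultiplicative x p) (h₂ : G.IsMultiplicative z q)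
    {α β : RawForm EX X 1} (hα : α ∈ DiffForm EX X 1) (hβ : β ∈ DiffForm EX X 1)
    (hpα : lieD p γ = G.delta α) (hqβ : lieD q γ = G.delta β) :
    lieD (VectorField.mlieBracket 𝓘(ℝ, EP) p q) γ = G.delta (lieD x β - lieD z α) := by
  rw [lieD_mlieBracket hγ hp hq, hpα, hqβ, G.lieD_delta h₁ hx hp hβ, G.lieD_delta h₂ hz hq hα,
    delta_sub]

end LieGroupoid

end Groupoid

end Gerbe

namespace Gerbe

/-! ### The circle action and the connection form -/

section OneForm

variable {E : Type*} [NormedAddCommGroup E] [NormedSpace ℝ E] (f : E [⋀^Fin 1]→L[ℝ] ℝ)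

theorem update_fin_one (w : Fin 1 → E) (u : E) : Function.update w 0 u = fun _ => u := by
  funext i
  rw [Subsingleton.elim i 0, Function.update_self]

theorem oneForm_apply_add (u v : E) :
    f (fun _ => u + v) = f (fun _ => u) + f (fun _ => v) := by
  simpa only [update_fin_one] using f.map_update_add 0 0 u v

theorem oneForm_apply_smul (c : ℝ) (u : E) : f (fun _ => c • u) = c • f (fun _ => u) := by
  simpa only [update_fin_one] using f.map_update_smul 0 0 c u

end OneForm

section CircleAction

theorem contMDiff_circle_coe : ContMDiff (𝓡 1) 𝓘(ℝ, ℂ) ∞ (fun z : Circle => (z : ℂ)) := by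
  have : Fact (Module.finrank ℝ ℂ = 1 + 1) := finrank_real_complex_fact'
  exact contMDiff_coe_sphere

theorem contMDiffAt_circle_arg {z : Circle} (hz : (z : ℂ) ∈ Complex.slitPlane) :
    ContMDiffAt (𝓡 1) 𝓘(ℝ, ℝ) ∞ (fun z : Circle => Complex.arg z) z := by
  have h1 : ContDiffAt ℝ ∞ (fun w : ℂ => (Complex.log w).im) z :=
    (Complex.imCLM.contDiff.contDiffAt).comp (z : ℂ) ((Complex.contDiffAt_log hz).restrict_scalars ℝ)
  exact (h1.contMDiffAt.comp z contMDiff_circle_coe.contMDiffAt).congr_of_eventuallyEq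
    (Filter.Eventually.of_forall fun w => (Complex.log_im _).symm)

variable {𝕍 : Type*} [NormedAddCommGroup 𝕍] [NormedSpace ℝ 𝕍]

/-- Near every point, a smooth `S¹`-valued function has a smooth logarithm. -/
theorem exists_circle_log {z : 𝕍 → Circle} {v : 𝕍} (hz : ContMDiffAt 𝓘(ℝ, 𝕍) (𝓡 1) ∞ z v) :
    ∃ θ : 𝕍 → ℝ, ContDiffAt ℝ ∞ θ v ∧ ∀ y, z y = Circle.exp (θ y) * z v := by
  have h1 : ContMDiffAt 𝓘(ℝ, 𝕍) (𝓡 1) ∞ (fun y => z y * (z v)⁻¹) v := by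
    have : LieGroup (𝓡 1) ∞ Circle := LieGroup.of_le (n := ω) le_top
    exact hz.mul contMDiffAt_const
  -- The quotient by `z v` equals `1` at `v`, away from the branch cut of the argument.
  refine ⟨fun y => Complex.arg (z y * (z v)⁻¹ : Circle), ?_, fun y => ?_⟩
  · refine contMDiffAt_iff_contDiffAt.1 (ContMDiffAt.comp v (contMDiffAt_circle_arg ?_) h1)
    simp
  · rw [Circle.exp_arg, inv_mul_cancel_right]

end CircleAction

section BundleGerbe

variable {EM EX EP M X P : Type*}
  [NormedAddCommGroup EM] [NormedSpace ℝ EM] [TopologicalSpace M] [ChartedSpace EM M]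
  [NormedAddCommGroup EX] [NormedSpace ℝ EX] [TopologicalSpace X] [ChartedSpace EX X]
  [NormedAddCommGroup EP] [NormedSpace ℝ EP] [TopologicalSpace P] [ChartedSpace EP P]
  [IsManifold 𝓘(ℝ, EM) ∞ M] [IsManifold 𝓘(ℝ, EX) ∞ X] [IsManifold 𝓘(ℝ, EP) ∞ P]
  [MulAction Circle P]
  {𝕍 : Type*} [NormedAddCommGroup 𝕍] [NormedSpace ℝ 𝕍]

namespace BundleGerbe

theorem contMDiff_const_smul (G : BundleGerbe EM EX EP M X P) (z : Circle) :
    ContMDiff 𝓘(ℝ, EP) 𝓘(ℝ, EP) ∞ (fun p : P => z • p) :=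
  G.contMDiff_smul.comp (contMDiff_const.prodMk contMDiff_id)

theorem contMDiff_exp_smul (G : BundleGerbe EM EX EP M X P) :
    ContMDiff (𝓘(ℝ, ℝ).prod 𝓘(ℝ, EP)) 𝓘(ℝ, EP) ∞
      (fun q : ℝ × P => Circle.exp q.1 • q.2) :=
  G.contMDiff_smul.comp ((contMDiff_circleExp.comp contMDiff_fst).prodMk contMDiff_snd)

/-- By the group law the orbit from time `τ` on is the orbit of the point reached at `τ`, started at
time zero. -/
theorem mfderiv_exp_smul (G : BundleGerbe EM EX EP M X P) (τ : ℝ) (p : P) (s : ℝ) :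
    (mfderiv 𝓘(ℝ, ℝ) 𝓘(ℝ, EP) (fun τ : ℝ => Circle.exp τ • p) τ s : EP) =
      s • (fundamentalField (Circle.exp τ • p) : EP) := by
  have h1 : (fun τ' : ℝ => Circle.exp τ' • p) =
      (fun τ' : ℝ => Circle.exp τ' • (Circle.exp τ • p)) ∘ fun τ' => τ' - τ := by
    funext τ'
    simp only [Function.comp, smul_smul, ← Circle.exp_add, sub_add_cancel]
  have h2 : ContMDiff 𝓘(ℝ, ℝ) 𝓘(ℝ, EP) ∞ (fun τ' : ℝ => Circle.exp τ' • (Circle.exp τ • p)) :=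
    G.contMDiff_exp_smul.comp (contMDiff_id.prodMk contMDiff_const)
  have h3 : HasFDerivAt (fun τ' : ℝ => τ' - τ) (ContinuousLinearMap.id ℝ ℝ) τ :=
    (hasFDerivAt_id τ).sub_const τ
  have h4 := mfderiv_comp_apply_of_eq ((h2 0).mdifferentiableAt (by simp))
    h3.differentiableAt.mdifferentiableAt (sub_self τ) s
  have h5 : (mfderiv 𝓘(ℝ, ℝ) 𝓘(ℝ, ℝ) (fun τ' : ℝ => τ' - τ) τ s : ℝ) = s := by
    rw [mfderiv_eq_fderiv, h3.fderiv]
    rfl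
  rw [h5] at h4
  rw [h1]
  refine Eq.trans (α := EP) h4.symm ?_
  have h6 : ∀ A : ℝ →L[ℝ] EP, A s = s • A 1 := fun A => by rw [← map_smul, smul_eq_mul, mul_one]
  exact h6 _

variable {G : BundleGerbe EM EX EP M X P} (γ : G.Connection)

theorem Connection.plotForm_const_smul (z : Circle) {q : 𝕍 → P} {v : 𝕍}
    (hq : MDifferentiableAt 𝓘(ℝ, 𝕍) 𝓘(ℝ, EP) q v) :
    plotForm (fun y => z • q y) γ.form.1 v = plotForm q γ.form.1 v := by
  have h := plotForm_pullbackForm (((G.contMDiff_const_smul z) (q v)).mdifferentiableAt (by simp))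
    hq γ.form.1
  rw [γ.pullback_smul] at h
  exact h.symm

/-- The derivative splits into a multiple `dθ` of the generator, on which `γ` is `1`, and the
translate of `dq`, on which invariance of `γ` applies. -/
theorem Connection.plotForm_exp_smul {θ : 𝕍 → ℝ} {q : 𝕍 → P} {v : 𝕍}
    (hθ : DifferentiableAt ℝ θ v) (hq : MDifferentiableAt 𝓘(ℝ, 𝕍) 𝓘(ℝ, EP) q v) :
    plotForm (fun y => Circle.exp (θ y) • q y) γ.form.1 v =
      plotForm q γ.form.1 v + ContinuousAlternatingMap.ofSubsingleton ℝ 𝕍 ℝ (0 : Fin 1)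
        (fderiv ℝ θ v) := by
  ext w
  have hA := (G.contMDiff_exp_smul (θ v, q v)).mdifferentiableAt (by simp)
  have hθ' : MDifferentiableAt 𝓘(ℝ, 𝕍) 𝓘(ℝ, ℝ) θ v := hθ.mdifferentiableAt
  have h1 := DFunLike.congr_fun (hA.hasMFDerivAt.comp v
    (hθ'.hasMFDerivAt.prodMk hq.hasMFDerivAt)).mfderiv (w 0)
  have h2 := mfderiv_prod_eq_add_apply (I := 𝓘(ℝ, ℝ)) (I' := 𝓘(ℝ, EP)) (E := ℝ) (E' := EP)
    (v := ((mfderiv 𝓘(ℝ, 𝕍) 𝓘(ℝ, ℝ) θ v (w 0) : ℝ),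
    (mfderiv 𝓘(ℝ, 𝕍) 𝓘(ℝ, EP) q v (w 0) : EP))) hA
  have h3 : (mfderiv 𝓘(ℝ, 𝕍) 𝓘(ℝ, EP) (fun y => Circle.exp (θ y) • q y) v (w 0) : EP) =
      (fderiv ℝ θ v (w 0)) • (fundamentalField (Circle.exp (θ v) • q v) : EP) +
      (mfderiv 𝓘(ℝ, EP) 𝓘(ℝ, EP) (fun p : P => Circle.exp (θ v) • p) (q v)
        (mfderiv 𝓘(ℝ, 𝕍) 𝓘(ℝ, EP) q v (w 0) : EP) : EP) := by
    refine Eq.trans (α := EP) h1 (Eq.trans (α := EP) h2 ?_)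
    have h4 := G.mfderiv_exp_smul (θ v) (q v) (mfderiv 𝓘(ℝ, 𝕍) 𝓘(ℝ, ℝ) θ v (w 0))
    have h7 : (mfderiv 𝓘(ℝ, 𝕍) 𝓘(ℝ, ℝ) θ v (w 0) : ℝ) = fderiv ℝ θ v (w 0) := by
      rw [mfderiv_eq_fderiv]
      rfl
    rw [← h7]
    exact congrArg₂ (· + · : EP → EP → EP) h4 rfl
  have hw : w = fun _ => w 0 := by
    funext i
    rw [Subsingleton.elim i 0]
  have h5 : (γ.form.1 (Circle.exp (θ v) • q v) : EP [⋀^Fin 1]→L[ℝ] ℝ) (fun _ =>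
      (mfderiv 𝓘(ℝ, EP) 𝓘(ℝ, EP) (fun p : P => Circle.exp (θ v) • p) (q v)
        (mfderiv 𝓘(ℝ, 𝕍) 𝓘(ℝ, EP) q v (w 0) : EP) : EP)) =
      (γ.form.1 (q v) : EP [⋀^Fin 1]→L[ℝ] ℝ) (fun _ =>
        (mfderiv 𝓘(ℝ, 𝕍) 𝓘(ℝ, EP) q v (w 0) : EP)) :=
    DFunLike.congr_fun (congrFun (γ.pullback_smul (Circle.exp (θ v))) (q v))
      (fun _ => (mfderiv 𝓘(ℝ, 𝕍) 𝓘(ℝ, EP) q v (w 0) : EP))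
  have h6 := γ.apply_fundamentalField (Circle.exp (θ v) • q v)
  rw [hw]
  change (γ.form.1 (Circle.exp (θ v) • q v) : EP [⋀^Fin 1]→L[ℝ] ℝ) (fun _ =>
    (mfderiv 𝓘(ℝ, 𝕍) 𝓘(ℝ, EP) (fun y => Circle.exp (θ y) • q y) v (w 0) : EP)) =
    (γ.form.1 (q v) : EP [⋀^Fin 1]→L[ℝ] ℝ) (fun _ =>
        (mfderiv 𝓘(ℝ, 𝕍) 𝓘(ℝ, EP) q v (w 0) : EP)) + fderiv ℝ θ v (w 0)
  rw [h3, ← h5]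
  refine (oneForm_apply_add (E := EP) (γ.form.1 (Circle.exp (θ v) • q v) : EP [⋀^Fin 1]→L[ℝ] ℝ) _ _).trans ?_
  rw [add_comm]
  refine congrArg (_ + ·) ((oneForm_apply_smul (E := EP)
    (γ.form.1 (Circle.exp (θ v) • q v) : EP [⋀^Fin 1]→L[ℝ] ℝ) _ _).trans ?_)
  exact (congrArg (_ • ·) h6).trans (mul_one _)

/-- Locally `z` is a constant times `exp(iθ)`, so the pullback of `γ` changes by `dθ`, and `d`
removes it. This is the statement that the curvature is basic for `P → X ×_M X`, expressed along
plots. -/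
theorem Connection.plotForm_smul {z : 𝕍 → Circle} {q : 𝕍 → P} {v : 𝕍}
    (hz : ContMDiffAt 𝓘(ℝ, 𝕍) (𝓡 1) ∞ z v) (hq : ContMDiffAt 𝓘(ℝ, 𝕍) 𝓘(ℝ, EP) ∞ q v) :
    plotForm (fun y => z y • q y) (extD γ.form.1) v = plotForm q (extD γ.form.1) v := by
  obtain ⟨θ, hθ, hzθ⟩ := exists_circle_log hz
  have hzq : ContMDiffAt 𝓘(ℝ, 𝕍) 𝓘(ℝ, EP) ∞ (fun y => z y • q y) v :=
    (G.contMDiff_smul (z v, q v)).comp v (hz.prodMk hq)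
  have h0 : plotForm (fun y => z y • q y) γ.form.1 =ᶠ[𝓝 v] plotForm q γ.form.1 +
      extDeriv (fun y => ContinuousAlternatingMap.constOfIsEmpty ℝ 𝕍 (Fin 0) (θ y)) := by
    have h1 : ∀ᶠ y in 𝓝 v, DifferentiableAt ℝ θ y := by
      have := (hθ.of_le (m := 1) (by norm_cast)).eventually (by simp)
      filter_upwards [this] with y hy using hy.differentiableAt (by simp)
    filter_upwards [h1, eventually_mdifferentiableAt hq] with y hy hqy
    have h2 : (fun y => z y • q y) = fun y => Circle.exp (θ y) • (z v • q y) := by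
      funext y
      rw [hzθ y, mul_smul]
    have h3 : MDifferentiableAt 𝓘(ℝ, 𝕍) 𝓘(ℝ, EP) (fun y => z v • q y) y :=
      (((G.contMDiff_const_smul (z v)) (q y)).mdifferentiableAt (by simp)).comp y hqy
    rw [h2, γ.plotForm_exp_smul hy h3, γ.plotForm_const_smul (z v) hqy, Pi.add_apply,
      extDeriv_constOfIsEmpty]
  have hγ := fun p => smoothFormAt_of_mem γ.form.2 p
  have hθ' : ContDiffAt ℝ ∞
      (fun y => ContinuousAlternatingMap.constOfIsEmpty ℝ 𝕍 (Fin 0) (θ y)) v :=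
    (ContinuousAlternatingMap.constOfIsEmptyLIE ℝ 𝕍 ℝ (Fin 0)).contDiff.contDiffAt.comp v hθ
  rw [← (hγ _).extDeriv_plotForm hzq, ← (hγ _).extDeriv_plotForm hq, h0.extDeriv_eq,
    extDeriv_add (((hγ _).contDiffAt_plotForm hq).differentiableAt (by simp))
      ((contDiffAt_extDeriv hθ').differentiableAt (by simp)),
    extDeriv_extDeriv_apply hθ' minSmoothness_two_le, add_zero]

end BundleGerbe

end BundleGerbe

end Gerbe

namespace Gerbe

/-! ### Local curvings obtained from local sections of the submersion -/

section Forms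

variable {E : Type*} [NormedAddCommGroup E] [NormedSpace ℝ E]
  {M : Type*} [TopologicalSpace M] [ChartedSpace E M]

theorem plotForm_congr_form {𝕍 : Type*} [NormedAddCommGroup 𝕍] [NormedSpace ℝ 𝕍] {k : ℕ}
    {f : 𝕍 → M} {v : 𝕍} {η ζ : RawForm E M k} (h : η (f v) = ζ (f v)) :
    plotForm f η v = plotForm f ζ v := by
  have h' : (η (f v) : E [⋀^Fin k]→L[ℝ] ℝ) = ζ (f v) := h
  ext w
  exact DFunLike.congr_fun h' _

theorem SmoothFormAt.congr {k : ℕ} {η ζ : RawForm E M k} {x : M} (hη : SmoothFormAt η x)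
    (h : ∀ᶠ y in 𝓝 x, ζ y = η y) : SmoothFormAt ζ x := by
  refine ContDiffAt.congr_of_eventuallyEq hη ?_
  have hc : ContinuousAt (extChartAt 𝓘(ℝ, E) x).symm (extChartAt 𝓘(ℝ, E) x x) :=
    continuousAt_extChartAt_symm x
  have h' : ∀ᶠ y in 𝓝 ((extChartAt 𝓘(ℝ, E) x).symm (extChartAt 𝓘(ℝ, E) x x)), ζ y = η y := by
    rwa [extChartAt_to_inv]
  filter_upwards [hc.eventually h'] with z hz
  exact plotForm_congr_form hz

end Forms

section BundleGerbe

variable {EM EX EP M X P : Type*}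
  [NormedAddCommGroup EM] [NormedSpace ℝ EM] [TopologicalSpace M] [ChartedSpace EM M]
  [NormedAddCommGroup EX] [NormedSpace ℝ EX] [TopologicalSpace X] [ChartedSpace EX X]
  [NormedAddCommGroup EP] [NormedSpace ℝ EP] [TopologicalSpace P] [ChartedSpace EP P]
  [IsManifold 𝓘(ℝ, EM) ∞ M] [IsManifold 𝓘(ℝ, EX) ∞ X] [IsManifold 𝓘(ℝ, EP) ∞ P]
  [MulAction Circle P]
  {𝕍 : Type*} [NormedAddCommGroup 𝕍] [NormedSpace ℝ 𝕍]

namespace BundleGerbe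

variable {G : BundleGerbe EM EX EP M X P} (γ : G.Connection)

/-- The curvature pulls back equally along plots of `P` with the same source and target. -/
theorem Connection.plotForm_curvature_congr {q₁ q₂ : 𝕍 → P} {v : 𝕍}
    (h₁ : ContMDiffAt 𝓘(ℝ, 𝕍) 𝓘(ℝ, EP) ∞ q₁ v) (h₂ : ContMDiffAt 𝓘(ℝ, 𝕍) 𝓘(ℝ, EP) ∞ q₂ v)
    (ht : ∀ᶠ y in 𝓝 v, G.tgt (q₁ y) = G.tgt (q₂ y))
    (hs : ∀ᶠ y in 𝓝 v, G.src (q₁ y) = G.src (q₂ y)) :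
    plotForm q₁ (extD γ.form.1) v = plotForm q₂ (extD γ.form.1) v := by
  obtain ⟨U, σ, θ, hU, hv, hσ, -, hθ, hθσ⟩ := G.locallyTrivial (G.tgt (q₁ v)) (G.src (q₁ v))
    (G.proj_tgt _)
  have hts : Continuous fun p => (G.tgt p, G.src p) :=
    G.isSubmersion_tgt.contMDiff.continuous.prodMk G.isSubmersion_src.contMDiff.continuous
  have hW : IsOpen {p | (G.tgt p, G.src p) ∈ U} := hU.preimage hts
  -- A reference plot through the trivializing section. Every plot with the same source and target
  -- is an `S¹`-valued multiple of it near `v`, the factor being the fibre coordinate `θ`.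
  set q : 𝕍 → P := fun y => σ (G.tgt (q₁ y), G.src (q₁ y)) with hq
  have key : ∀ q' : 𝕍 → P, ContMDiffAt 𝓘(ℝ, 𝕍) 𝓘(ℝ, EP) ∞ q' v →
      (∀ᶠ y in 𝓝 v, G.tgt (q₁ y) = G.tgt (q' y)) → (∀ᶠ y in 𝓝 v, G.src (q₁ y) = G.src (q' y)) →
      plotForm q' (extD γ.form.1) v = plotForm q (extD γ.form.1) v := by
    intro q' h' ht' hs'
    have hmem : q' v ∈ {p | (G.tgt p, G.src p) ∈ U} := by
      rw [mem_ofPred_eq, ← ht'.self_of_nhds, ← hs'.self_of_nhds]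
      exact hv
    have hqs : ContMDiffAt 𝓘(ℝ, 𝕍) 𝓘(ℝ, EP) ∞ q v := by
      have h3 : ContMDiffAt 𝓘(ℝ, 𝕍) (𝓘(ℝ, EX).prod 𝓘(ℝ, EX)) ∞
          (fun y => (G.tgt (q₁ y), G.src (q₁ y))) v :=
        (G.isSubmersion_tgt.contMDiff.contMDiffAt.comp v h₁).prodMk
          (G.isSubmersion_src.contMDiff.contMDiffAt.comp v h₁)
      have hm : MapsTo (fun y => (G.tgt (q₁ y), G.src (q₁ y)))
        {y | (G.tgt (q₁ y), G.src (q₁ y)) ∈ U} (U ∩ {q | G.proj q.1 = G.proj q.2}) :=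
          fun y hy => ⟨hy, G.proj_tgt _⟩
      have h4 := ContMDiffWithinAt.comp (g := σ) v (hσ (G.tgt (q₁ v), G.src (q₁ v))
        ⟨hv, G.proj_tgt _⟩) h3.contMDiffWithinAt hm
      exact h4.contMDiffAt (h3.continuousAt.preimage_mem_nhds (hU.mem_nhds hv))
    have hz : ContMDiffAt 𝓘(ℝ, 𝕍) (𝓡 1) ∞ (fun y => θ (q' y)) v :=
      ContMDiffAt.comp v (hθ.contMDiffAt (hW.mem_nhds hmem)) h'
    rw [← γ.plotForm_smul hz hqs]
    refine plotForm_congr ?_ _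
    filter_upwards [ht', hs', h'.continuousAt.preimage_mem_nhds (hW.mem_nhds hmem)] with y y1 y2 y3
    have := hθσ (q' y) y3
    rw [← y1, ← y2] at this
    exact this.symm
  rw [key q₁ h₁ (Filter.Eventually.of_forall fun _ => rfl)
    (Filter.Eventually.of_forall fun _ => rfl), key q₂ h₂ ht hs]

/-- The curvature is multiplicative along plots of composable pairs. -/
theorem Connection.plotForm_curvature_mul {q₁ q₂ : 𝕍 → P} {v : 𝕍}
    (h₁ : ContMDiffAt 𝓘(ℝ, 𝕍) 𝓘(ℝ, EP) ∞ q₁ v) (h₂ : ContMDiffAt 𝓘(ℝ, 𝕍) 𝓘(ℝ, EP) ∞ q₂ v)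
    (hc : ∀ᶠ y in 𝓝 v, G.src (q₁ y) = G.tgt (q₂ y)) :
    plotForm (fun y => G.mul (q₁ y) (q₂ y)) (extD γ.form.1) v =
      plotForm q₁ (extD γ.form.1) v + plotForm q₂ (extD γ.form.1) v := by
  have h0 : plotForm (fun y => G.mul (q₁ y) (q₂ y)) γ.form.1 =ᶠ[𝓝 v]
      plotForm q₁ γ.form.1 + plotForm q₂ γ.form.1 := by
    filter_upwards [eventually_mdifferentiableAt h₁, eventually_mdifferentiableAt h₂,
      hc.eventually_nhds] with y y1 y2 y3
    ext w
    have hw : w = fun _ => w 0 := by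
      funext i
      rw [Subsingleton.elim i 0]
    rw [hw]
    have e1 := G.tangentMul_mfderiv y1 y2 y3 rfl rfl (w 0)
    have e2 : (mfderiv 𝓘(ℝ, EP) 𝓘(ℝ, EX) G.src (q₁ y) (mfderiv 𝓘(ℝ, 𝕍) 𝓘(ℝ, EP) q₁ y (w 0) : EP)
        : EX) = mfderiv 𝓘(ℝ, EP) 𝓘(ℝ, EX) G.tgt (q₂ y)
          (mfderiv 𝓘(ℝ, 𝕍) 𝓘(ℝ, EP) q₂ y (w 0) : EP) := by
      have e3 := mfderiv_comp_apply_of_eq (G.mdifferentiable_src _) y1 rfl (w 0)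
      have e4 := mfderiv_comp_apply_of_eq (G.mdifferentiable_tgt _) y2 rfl (w 0)
      have e5 : (mfderiv 𝓘(ℝ, 𝕍) 𝓘(ℝ, EX) (fun w => G.src (q₁ w)) y : 𝕍 →L[ℝ] EX) =
        mfderiv 𝓘(ℝ, 𝕍) 𝓘(ℝ, EX) (fun w => G.tgt (q₂ w)) y := Filter.EventuallyEq.mfderiv_eq y3
      exact Eq.trans (α := EX) e3 (Eq.trans (α := EX) (DFunLike.congr_fun e5 (w 0)) e4.symm)
    have e6 := γ.isMultiplicative (q₁ y) (q₂ y) y3.self_of_nhds _ _ e2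
    refine Eq.trans ?_ e6
    exact congrArg (fun u : EP => (γ.form.1 (G.mul (q₁ y) (q₂ y)) : EP [⋀^Fin 1]→L[ℝ] ℝ)
      (fun _ => u)) e1.symm
  have hγ := fun p => smoothFormAt_of_mem γ.form.2 p
  have h₃ := G.contMDiffAt_mul h₁ h₂ hc
  rw [← (hγ _).extDeriv_plotForm h₁, ← (hγ _).extDeriv_plotForm h₂, ← (hγ _).extDeriv_plotForm h₃,
    h0.extDeriv_eq, extDeriv_add (((hγ _).contDiffAt_plotForm h₁).differentiableAt (by simp))
      (((hγ _).contDiffAt_plotForm h₂).differentiableAt (by simp))]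

/-- A germ at `x` of a map `τ : X → P` for which `τ y` is an arrow from `y` to `σ (π y)`. -/
structure IsArrowLift (G : BundleGerbe EM EX EP M X P) (σ : M → X) (x : X) (τ : X → P) : Prop where
  eventually_contMDiffAt : ∀ᶠ y in 𝓝 x, ContMDiffAt 𝓘(ℝ, EX) 𝓘(ℝ, EP) ∞ τ y
  src_eq : ∀ᶠ y in 𝓝 x, G.src (τ y) = y
  tgt_eq : ∀ᶠ y in 𝓝 x, G.tgt (τ y) = σ (G.proj y)

theorem IsArrowLift.contMDiffAt {σ : M → X} {x : X} {τ : X → P} (hτ : G.IsArrowLift σ x τ) :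
    ContMDiffAt 𝓘(ℝ, EX) 𝓘(ℝ, EP) ∞ τ x :=
  hτ.eventually_contMDiffAt.self_of_nhds

/-- The bundle `P → X ×_M X` has a local section near `(σ (π x), x)`; it is evaluated at `(σ (π y),
y)`, which lies in the fibre product as `π ∘ σ = id` near `π x`. -/
theorem exists_isArrowLift (G : BundleGerbe EM EX EP M X P) {σ : M → X} {x : X}
    (hσ : ∀ᶠ m in 𝓝 (G.proj x), ContMDiffAt 𝓘(ℝ, EM) 𝓘(ℝ, EX) ∞ σ m)
    (hσp : ∀ᶠ m in 𝓝 (G.proj x), G.proj (σ m) = m) : ∃ τ, G.IsArrowLift σ x τ := by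
  obtain ⟨U, s, -, hU, hx, hs, hts, -, -⟩ := G.locallyTrivial (σ (G.proj x)) x hσp.self_of_nhds
  have hπ : Continuous G.proj := G.isSubmersion_proj.contMDiff.continuous
  have h3 : ∀ y, ContMDiffAt 𝓘(ℝ, EM) 𝓘(ℝ, EX) ∞ σ (G.proj y) →
      ContMDiffAt 𝓘(ℝ, EX) (𝓘(ℝ, EX).prod 𝓘(ℝ, EX)) ∞ (fun y => (σ (G.proj y), y)) y :=
    fun y hy => (ContMDiffAt.comp y hy G.isSubmersion_proj.contMDiff.contMDiffAt).prodMk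
      contMDiffAt_id
  have hσ' : ∀ᶠ y in 𝓝 x, ContMDiffAt 𝓘(ℝ, EM) 𝓘(ℝ, EX) ∞ σ (G.proj y) :=
    hπ.continuousAt.eventually hσ
  have hn : ∀ᶠ y in 𝓝 x, (σ (G.proj y), y) ∈ U :=
    (h3 x hσ.self_of_nhds).continuousAt.preimage_mem_nhds (hU.mem_nhds hx)
  have hp : ∀ᶠ y in 𝓝 x, G.proj (σ (G.proj y)) = G.proj y := hπ.continuousAt.eventually hσp
  refine ⟨fun y => s (σ (G.proj y), y), ?_, ?_, ?_⟩
  · filter_upwards [hσ', hn.eventually_nhds, hp.eventually_nhds] with y y1 y2 y3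
    have hm : MapsTo (fun y => (σ (G.proj y), y)) {y | (σ (G.proj y), y) ∈ U ∧
      G.proj (σ (G.proj y)) = G.proj y} (U ∩ {q | G.proj q.1 = G.proj q.2}) :=
        fun y hy => ⟨hy.1, hy.2⟩
    have h4 := ContMDiffWithinAt.comp (g := s) (f := fun y => (σ (G.proj y), y)) y
      (hs (σ (G.proj y), y) ⟨y2.self_of_nhds, y3.self_of_nhds⟩) (h3 y y1).contMDiffWithinAt hm
    exact h4.contMDiffAt (y2.and y3)
  · filter_upwards [hn, hp] with y y1 y2 using (hts _ y1 y2).2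
  · filter_upwards [hn, hp] with y y1 y2 using (hts _ y1 y2).1

open Classical in
/-- The pullback of the curvature along the germs of maps `X → P` determined by a local section
`σ`. -/
def localCurving (σ : M → X) : RawForm EX X 2 := fun x =>
  -- Different choices of `τ` give the same form, by `plotForm_curvature_congr`. The value zero
  -- occurs only where no lift exists; in the gluing below, the partition function vanishes at such
  -- points.
  if h : ∃ τ, G.IsArrowLift σ x τ then pullbackForm h.choose (extD γ.form.1) x else 0

variable {γ} in
-- The chosen lift and `τ` have the same source and target near the point, so the curvature pulls
-- back equally along them.
theorem IsArrowLift.plotForm_localCurving {σ : M → X} {f : 𝕍 → X} {v : 𝕍} {τ : X → P}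
    (hτ : G.IsArrowLift σ (f v) τ) (hf : ContMDiffAt 𝓘(ℝ, 𝕍) 𝓘(ℝ, EX) ∞ f v) :
    plotForm f (localCurving γ σ) v = plotForm (fun w => τ (f w)) (extD γ.form.1) v := by
  have h : ∃ τ, G.IsArrowLift σ (f v) τ := ⟨τ, hτ⟩
  have h1 := h.choose_spec
  have h2 : localCurving γ σ (f v) = pullbackForm h.choose (extD γ.form.1) (f v) := dif_pos h
  rw [plotForm_congr_form h2, plotForm_pullbackForm (h1.contMDiffAt.mdifferentiableAt (by simp))
    (hf.mdifferentiableAt (by simp))]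
  refine γ.plotForm_curvature_congr (h1.contMDiffAt.comp v hf) (hτ.contMDiffAt.comp v hf) ?_ ?_
  · filter_upwards [hf.continuousAt.eventually h1.tgt_eq, hf.continuousAt.eventually hτ.tgt_eq]
      with y y1 y2 using y1.trans y2.symm
  · filter_upwards [hf.continuousAt.eventually h1.src_eq, hf.continuousAt.eventually hτ.src_eq]
      with y y1 y2 using y1.trans y2.symm

theorem IsArrowLift.eventually {σ : M → X} {x : X} {τ : X → P} (hτ : G.IsArrowLift σ x τ) :
    ∀ᶠ y in 𝓝 x, G.IsArrowLift σ y τ := by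
  filter_upwards [hτ.eventually_contMDiffAt.eventually_nhds, hτ.src_eq.eventually_nhds, hτ.tgt_eq.eventually_nhds] with y y1 y2 y3
  exact ⟨y1, y2, y3⟩

/-- The lifts in the definition are chosen independently at each point, but one `τ` serves at all
nearby points, where the form is the pullback of the curvature along it. -/
theorem IsArrowLift.smoothFormAt_localCurving {σ : M → X} {x : X} {τ : X → P}
    (hτ : G.IsArrowLift σ x τ) : SmoothFormAt (localCurving γ σ) x := by
  have h1 := (smoothFormAt_of_mem (extD_mem γ.form.2) (τ x)).pullbackForm hτ.contMDiffAt
  refine h1.congr ?_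
  filter_upwards [hτ.eventually] with y hy
  refine form_eq_of_chartRep_eq ?_
  have hz := mem_extChartAt_target (I := 𝓘(ℝ, EX)) y
  have hy' : G.IsArrowLift σ ((extChartAt 𝓘(ℝ, EX) y).symm (extChartAt 𝓘(ℝ, EX) y y)) τ := by
    rwa [extChartAt_to_inv]
  rw [chartRep_eq_plotForm, hy'.plotForm_localCurving (contMDiffAt_chart_symm hz),
    chartRep_eq_plotForm, plotForm_pullbackForm (hy'.contMDiffAt.mdifferentiableAt (by simp))
      ((contMDiffAt_chart_symm hz).mdifferentiableAt (by simp))]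

/-- The arrows `τ (t p) · p` and `τ (s p)` both run from `s p` to `σ (π (s p))`, so the curvature
agrees along them. Multiplicativity splits the first into the target term plus `dγ`. -/
theorem delta_localCurving {σ : M → X} {p : P}
    (hσ : ∀ y, G.proj y = G.proj (G.src p) → ∃ τ, G.IsArrowLift σ y τ) :
    G.delta (localCurving γ σ) p = extD γ.form.1 p := by
  refine form_eq_of_chartRep_eq ?_
  set z := extChartAt 𝓘(ℝ, EP) p p
  have hz : z ∈ _ := mem_extChartAt_target (I := 𝓘(ℝ, EP)) p
  set q : EP → P := fun y => (extChartAt 𝓘(ℝ, EP) p).symm y with hq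
  have hqz : q z = p := extChartAt_to_inv p
  have hqs : ContMDiffAt 𝓘(ℝ, EP) 𝓘(ℝ, EP) ∞ q z := contMDiffAt_chart_symm hz
  obtain ⟨τs, hτs⟩ := hσ (G.src (q z)) (by rw [hqz])
  obtain ⟨τt, hτt⟩ := hσ (G.tgt (q z)) (by rw [hqz, G.proj_tgt])
  have hs : ContMDiffAt 𝓘(ℝ, EP) 𝓘(ℝ, EX) ∞ (fun y => G.src (q y)) z :=
    G.isSubmersion_src.contMDiff.contMDiffAt.comp z hqs
  have ht : ContMDiffAt 𝓘(ℝ, EP) 𝓘(ℝ, EX) ∞ (fun y => G.tgt (q y)) z :=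
    G.isSubmersion_tgt.contMDiff.contMDiffAt.comp z hqs
  have e1 : ∀ᶠ y in 𝓝 z, G.src (τt (G.tgt (q y))) = G.tgt (q y) :=
    ht.continuousAt.eventually hτt.src_eq
  have e2 : ∀ᶠ y in 𝓝 z, G.tgt (τt (G.tgt (q y))) = σ (G.proj (G.tgt (q y))) :=
    ht.continuousAt.eventually hτt.tgt_eq
  have e3 : ∀ᶠ y in 𝓝 z, G.src (τs (G.src (q y))) = G.src (q y) :=
    hs.continuousAt.eventually hτs.src_eq
  have e4 : ∀ᶠ y in 𝓝 z, G.tgt (τs (G.src (q y))) = σ (G.proj (G.src (q y))) :=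
    hs.continuousAt.eventually hτs.tgt_eq
  have c1 : ContMDiffAt 𝓘(ℝ, EP) 𝓘(ℝ, EP) ∞ (fun y => τt (G.tgt (q y))) z :=
    ContMDiffAt.comp z hτt.contMDiffAt ht
  have c2 : ContMDiffAt 𝓘(ℝ, EP) 𝓘(ℝ, EP) ∞ (fun y => τs (G.src (q y))) z :=
    ContMDiffAt.comp z hτs.contMDiffAt hs
  have h1 := γ.plotForm_curvature_mul c1 hqs e1
  have h2 := γ.plotForm_curvature_congr (G.contMDiffAt_mul c1 hqs e1) c2
    (by
      filter_upwards [e1, e2, e4] with y y1 y2 y4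
      rw [G.tgt_mul _ _ y1, y2, y4, G.proj_tgt])
    (by
      filter_upwards [e1, e3] with y y1 y3
      rw [G.src_mul _ _ y1, y3])
  have h3 : chartRep p (G.delta (localCurving γ σ)) z =
      plotForm q (pullbackForm G.src (localCurving γ σ)) z -
        plotForm q (pullbackForm G.tgt (localCurving γ σ)) z := rfl
  have hqd := hqs.mdifferentiableAt (by simp)
  rw [h3, plotForm_pullbackForm (G.mdifferentiable_src _) hqd,
    plotForm_pullbackForm (G.mdifferentiable_tgt _) hqd, hτs.plotForm_localCurving (f := fun y => G.src (q y)) hs,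
    hτt.plotForm_localCurving (f := fun y => G.tgt (q y)) ht, ← h2, h1, add_sub_cancel_left]
  rfl

end BundleGerbe

end BundleGerbe

end Gerbe

namespace Gerbe

/-! ### Existence of a curving -/

section Forms

variable {E : Type*} [NormedAddCommGroup E] [NormedSpace ℝ E]
  {M : Type*} [TopologicalSpace M] [ChartedSpace E M] [IsManifold 𝓘(ℝ, E) ∞ M]

theorem SmoothFormAt.smul {k : ℕ} {η : RawForm E M k} {f : M → ℝ} {x : M}
    (hf : ContMDiffAt 𝓘(ℝ, E) 𝓘(ℝ, ℝ) ∞ f x) (hη : SmoothFormAt η x) :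
    SmoothFormAt (fun y => f y • η y) x := by
  have hx := extChartAt_to_inv (I := 𝓘(ℝ, E)) x
  have hf' : ContMDiffAt 𝓘(ℝ, E) 𝓘(ℝ, ℝ) ∞ f
      ((extChartAt 𝓘(ℝ, E) x).symm (extChartAt 𝓘(ℝ, E) x x)) := by rwa [hx]
  have h1 : ContDiffAt ℝ ∞ (fun z => f ((extChartAt 𝓘(ℝ, E) x).symm z))
      (extChartAt 𝓘(ℝ, E) x x) :=
    contMDiffAt_iff_contDiffAt.1 (hf'.comp (extChartAt 𝓘(ℝ, E) x x)
      (contMDiffAt_chart_symm (mem_extChartAt_target x)))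
  exact h1.smul hη

theorem SmoothFormAt.sum {ι : Type*} {k : ℕ} {η : ι → RawForm E M k} {x : M} (s : Finset ι)
    (h : ∀ i ∈ s, SmoothFormAt (η i) x) : SmoothFormAt (∑ i ∈ s, η i) x := by
  classical
  induction s using Finset.induction_on with
  | empty => exact smoothFormAt_of_mem (zero_mem (DiffForm E M k)) x
  | insert i s hi ih =>
    rw [Finset.sum_insert hi]
    exact ContDiffAt.add (h i (Finset.mem_insert_self i s))
      (ih fun j hj => h j (Finset.mem_insert_of_mem hj))

end Forms

namespace BundleGerbe

variable {EM EX EP M X P : Type*}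
  [NormedAddCommGroup EM] [NormedSpace ℝ EM] [FiniteDimensional ℝ EM]
  [TopologicalSpace M] [T2Space M] [SecondCountableTopology M] [ChartedSpace EM M]
  [NormedAddCommGroup EX] [NormedSpace ℝ EX] [TopologicalSpace X] [ChartedSpace EX X]
  [NormedAddCommGroup EP] [NormedSpace ℝ EP] [TopologicalSpace P] [ChartedSpace EP P]
  [IsManifold 𝓘(ℝ, EM) ∞ M] [IsManifold 𝓘(ℝ, EX) ∞ X] [IsManifold 𝓘(ℝ, EP) ∞ P]
  [MulAction Circle P]

/-- Local curvings are averaged with a partition of unity on `M` pulled back along `π`. As `π ∘ s =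
π ∘ t`, such functions pass through `δ`, and weights summing to one preserve the equation `δB = dγ`.
-/
theorem exists_isCurving {G : BundleGerbe EM EX EP M X P} (γ : G.Connection) :
    ∃ B : DiffForm EX X 2, IsCurving γ B := by
  have hloc : ∀ m : M, ∃ (O : Set M) (σ : M → X), IsOpen O ∧ m ∈ O ∧
      ∀ y, G.proj y ∈ O → ∃ τ, G.IsArrowLift σ y τ := by
    intro m
    obtain ⟨x, rfl⟩ := G.surjective_proj m
    obtain ⟨R, hR⟩ := exists_localLift G.isSubmersion_proj x
    have hc : ∀ m, ContMDiffAt 𝓘(ℝ, EM) (𝓘(ℝ, EX).prod 𝓘(ℝ, EM)) ∞ (fun m' : M => (x, m')) m :=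
      fun m => contMDiffAt_const.prodMk contMDiffAt_id
    have hO : IsOpen {m' | (x, m') ∈ R.dom} := R.isOpen_dom.preimage (by fun_prop)
    refine ⟨{m' | (x, m') ∈ R.dom}, fun m' => R.toFun (x, m'), hO, hR, fun y hy => ?_⟩
    refine exists_isArrowLift G ?_ ?_
    · filter_upwards [hO.mem_nhds hy] with m' hm'
      exact (R.contMDiffAt hm').comp m' (hc m')
    · filter_upwards [hO.mem_nhds hy] with m' hm' using R.apply_toFun _ hm'
  choose O σ hO hmO hτ using hloc
  have : LocallyCompactSpace M := ChartedSpace.locallyCompactSpace EM M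
  obtain ⟨ρ, hρ⟩ := SmoothPartitionOfUnity.exists_isSubordinate 𝓘(ℝ, EM) isClosed_univ O hO
    fun m _ => mem_iUnion.2 ⟨m, hmO m⟩
  set b : M → RawForm EX X 2 := fun i => localCurving γ (σ i) with hb
  set B : RawForm EX X 2 := fun x => ∑ᶠ i, ρ i (G.proj x) • b i x with hB
  -- The finite index set is left free: smoothness needs one set valid near a point, the curving
  -- equation one set common to the source and target of `p`.
  have hsum : ∀ (y : X) (s : Finset M), ρ.finsupport (G.proj y) ⊆ s →
      B y = ∑ i ∈ s, ρ i (G.proj y) • b i y := by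
    intro y s hs
    refine finsum_eq_sum_of_support_subset _ fun i hi => hs ?_
    rw [SmoothPartitionOfUnity.mem_finsupport]
    exact fun h0 => hi (by simp only [h0, zero_smul])
  have hsmooth : B ∈ DiffForm EX X 2 := by
    refine mem_diffForm_iff.2 fun x => ?_
    -- Indices are taken by closed supports: these lie in the sets `O i`, so each term is smooth at
    -- `x`, and near `x` no other index contributes.
    set s := ρ.fintsupport (G.proj x) with hs
    have h1 : SmoothFormAt (∑ i ∈ s, fun y => ρ i (G.proj y) • b i y) x := by
      refine SmoothFormAt.sum s fun i hi => SmoothFormAt.smul ?_ ?_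
      · exact (ρ i).contMDiff.contMDiffAt.comp x G.isSubmersion_proj.contMDiff.contMDiffAt
      · obtain ⟨τ, h⟩ := hτ i x (hρ i ((ρ.mem_fintsupport_iff _ i).1 hi))
        exact h.smoothFormAt_localCurving γ
    refine h1.congr ?_
    have hπ : ContinuousAt G.proj x := G.isSubmersion_proj.contMDiff.continuous.continuousAt
    filter_upwards [hπ.eventually (ρ.eventually_finsupport_subset (G.proj x))] with y hy
    rw [hsum y s hy, Finset.sum_apply]
  refine ⟨⟨B, hsmooth⟩, ?_⟩
  funext p
  ext w
  set m := G.proj (G.src p) with hm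
  set s := ρ.finsupport m with hs
  have h1 := hsum (G.src p) s (by rw [hs])
  have h2 := hsum (G.tgt p) s (by rw [hs, hm, G.proj_tgt])
  rw [G.proj_tgt, ← hm] at h2
  have h3 : ∀ (η : RawForm EX X 2), (G.delta η p : EP [⋀^Fin 2]→L[ℝ] ℝ) w =
      (η (G.src p) : EX [⋀^Fin 2]→L[ℝ] ℝ)
        (fun i => (mfderiv 𝓘(ℝ, EP) 𝓘(ℝ, EX) G.src p : EP →L[ℝ] EX) (w i)) -
      (η (G.tgt p) : EX [⋀^Fin 2]→L[ℝ] ℝ)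
        (fun i => (mfderiv 𝓘(ℝ, EP) 𝓘(ℝ, EX) G.tgt p : EP →L[ℝ] EX) (w i)) := fun η => rfl
  have h4 : ∀ (t : Finset M) (f : M → EX [⋀^Fin 2]→L[ℝ] ℝ) (v : Fin 2 → EX),
      (∑ i ∈ t, ρ i m • f i) v = ∑ i ∈ t, ρ i m * f i v := by
    intro t f v
    rw [ContinuousAlternatingMap.sum_apply]
    rfl
  have h1' : (B (G.src p) : EX [⋀^Fin 2]→L[ℝ] ℝ) = ∑ i ∈ s, ρ i m • (b i (G.src p) :
    EX [⋀^Fin 2]→L[ℝ] ℝ) := h1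
  have h2' : (B (G.tgt p) : EX [⋀^Fin 2]→L[ℝ] ℝ) = ∑ i ∈ s, ρ i m • (b i (G.tgt p) :
    EX [⋀^Fin 2]→L[ℝ] ℝ) := h2
  have h5 : ∀ i ∈ s, ρ i m * (b i (G.src p) : EX [⋀^Fin 2]→L[ℝ] ℝ)
        (fun i => (mfderiv 𝓘(ℝ, EP) 𝓘(ℝ, EX) G.src p : EP →L[ℝ] EX) (w i)) -
      ρ i m * (b i (G.tgt p) : EX [⋀^Fin 2]→L[ℝ] ℝ)
        (fun i => (mfderiv 𝓘(ℝ, EP) 𝓘(ℝ, EX) G.tgt p : EP →L[ℝ] EX) (w i)) =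
      ρ i m * (extD γ.form.1 p : EP [⋀^Fin 2]→L[ℝ] ℝ) w := by
    intro i hi
    rw [← mul_sub]
    refine congrArg (ρ i m * ·) ((h3 (b i)).symm.trans ?_)
    have hi' : m ∈ O i := hρ i (subset_tsupport _ ((ρ.mem_finsupport m).1 hi))
    have h6 := delta_localCurving γ (σ := σ i) (p := p) fun y hy => hτ i y (by rwa [hy, ← hm])
    exact DFunLike.congr_fun h6 w
  refine ((h3 B).trans (congrArg₂ (· - ·) ((DFunLike.congr_fun h1' _).trans (h4 s _ _))
    ((DFunLike.congr_fun h2' _).trans (h4 s _ _)))).trans ?_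
  refine (Finset.sum_sub_distrib _ _).symm.trans ((Finset.sum_congr rfl h5).trans ?_)
  rw [← Finset.sum_mul, ρ.sum_finsupport m (mem_univ m), one_mul]

end BundleGerbe

end Gerbe

namespace Gerbe

/-! ### Assembly of the strict Lie 2-algebra -/

section Abstract

variable {L₁ L₀ : Type*} [AddCommGroup L₁] [Module ℝ L₁] [AddCommGroup L₀] [Module ℝ L₀]

theorem add_right_of_skew {b : L₀ → L₀ → L₀} (h : ∀ x y, b x y = -b y x)
    (hb : ∀ x y z, b (x + y) z = b x z + b y z) (x y z : L₀) :
    b x (y + z) = b x y + b x z := by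
  rw [h, hb, neg_add, ← h, ← h]

theorem smul_right_of_skew {b : L₀ → L₀ → L₀} (h : ∀ x y, b x y = -b y x)
    (hb : ∀ (c : ℝ) x y, b (c • x) y = c • b x y) (c : ℝ) (x y : L₀) :
    b x (c • y) = c • b x y := by
  rw [h, hb, ← smul_neg, ← h]

/-- The strict Lie 2-algebra of a crossed module of Lie algebras, given by a differential, the
bracket in degree zero and the action in mixed degrees. -/
def StrictLieTwoAlgebra.ofAction (d : L₁ →ₗ[ℝ] L₀) (b : L₀ →ₗ[ℝ] L₀ →ₗ[ℝ] L₀)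
    (ρ : L₀ →ₗ[ℝ] L₁ →ₗ[ℝ] L₁) (skew : ∀ x y, b x y = -b y x)
    (jacobi : ∀ x y z, b x (b y z) + b y (b z x) + b z (b x y) = 0)
    (action : ∀ x y a, ρ (b x y) a = ρ x (ρ y a) - ρ y (ρ x a))
    (equivariant : ∀ x a, d (ρ x a) = b x (d a)) (peiffer : ∀ a c, ρ (d a) c = -ρ (d c) a) :
    StrictLieTwoAlgebra L₁ L₀ where
  d := d
  bracket₀ := b
  bracket₀₁ := ρ
  bracket₁₀ := -ρ.flip
  bracket₀_skew := skew
  bracket₁₀_skew a x := (neg_neg _).symm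
  d_bracket := equivariant
  bracket_d := peiffer
  jacobi₀ := jacobi
  jacobi₁ x y a := by
    simp only [LinearMap.neg_apply, LinearMap.flip_apply, map_neg, action]
    abel

end Abstract

namespace BundleGerbe

variable {EM EX EP M X P : Type*}
  [NormedAddCommGroup EM] [NormedSpace ℝ EM] [TopologicalSpace M] [ChartedSpace EM M]
  [NormedAddCommGroup EX] [NormedSpace ℝ EX] [TopologicalSpace X] [ChartedSpace EX X]
  [NormedAddCommGroup EP] [NormedSpace ℝ EP] [TopologicalSpace P] [ChartedSpace EP P]
  [IsManifold 𝓘(ℝ, EX) ∞ X] [IsManifold 𝓘(ℝ, EP) ∞ P]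
  [MulAction Circle P] [FiniteDimensional ℝ EX] [FiniteDimensional ℝ EP]
  {G : BundleGerbe EM EX EP M X P} (γ : G.Connection)

open _root_.VectorField Gerbe.VectorField

/-- The differential `a ↦ (𝐚, ā, -ε^* L_{a→} γ)` of the Lie 2-algebra of a bundle gerbe with a
curving `B`. -/
def differential {B : DiffForm EX X 2} (hB : IsCurving γ B) :
    G.algebroidSection →ₗ[ℝ] connectionPreserving γ where
  -- The form component is written without `B`; the curving serves only to verify `L_ā γ = δα`.
  toFun a := ⟨(G.anchor a.1, G.barField a.1, G.algebroidForm γ.form.1 a.1), by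
    have : CompleteSpace EX := FiniteDimensional.complete ℝ EX
    have : CompleteSpace EP := FiniteDimensional.complete ℝ EP
    exact ⟨G.anchor_mem a.2, G.barField_mem a.2, G.algebroidForm_mem γ.form.2 a.2,
      G.isMultiplicative_barField a.2, γ.isMultiplicative.lieD_barField γ.form.2 a.2 hB⟩⟩
  map_add' a b := by
    have : CompleteSpace EX := FiniteDimensional.complete ℝ EX
    have : CompleteSpace EP := FiniteDimensional.complete ℝ EP
    exact Subtype.ext (Prod.ext G.anchor_add (Prod.ext G.barField_add
      (G.algebroidForm_add γ.form.2 a.2 b.2)))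
  map_smul' c a := by
    have : CompleteSpace EX := FiniteDimensional.complete ℝ EX
    have : CompleteSpace EP := FiniteDimensional.complete ℝ EP
    exact Subtype.ext (Prod.ext (G.anchor_smul c) (Prod.ext (G.barField_smul c)
      (G.algebroidForm_smul c)))

/-- The bracket of two connection preserving multiplicative vector fields. -/
def connectionPreservingBracket (ξ ζ : connectionPreserving γ) : connectionPreserving γ :=
  ⟨(mlieBracket 𝓘(ℝ, EX) ξ.1.1 ζ.1.1, mlieBracket 𝓘(ℝ, EP) ξ.1.2.1 ζ.1.2.1,
    lieD ξ.1.1 ζ.1.2.2 - lieD ζ.1.1 ξ.1.2.2), by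
    have : CompleteSpace EX := FiniteDimensional.complete ℝ EX
    have : CompleteSpace EP := FiniteDimensional.complete ℝ EP
    obtain ⟨hx, hp, hα, h1, h2⟩ := ξ.2
    obtain ⟨hz, hr, hβ, h3, h4⟩ := ζ.2
    exact ⟨mlieBracket_mem hx hz, mlieBracket_mem hp hr,
      sub_mem (lieD_mem hβ hx) (lieD_mem hα hz), h1.mlieBracket hp hr hx hz h3,
      G.lieD_mlieBracket_delta γ.form.2 hx hp hz hr h1 h3 hα hβ h2 h4⟩⟩

theorem connectionPreservingBracket_skew (ξ ζ : connectionPreserving γ) :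
    connectionPreservingBracket γ ξ ζ = -connectionPreservingBracket γ ζ ξ :=
  Subtype.ext (Prod.ext mlieBracket_swap (Prod.ext mlieBracket_swap (neg_sub _ _).symm))

theorem connectionPreservingBracket_add_left (ξ ξ' ζ : connectionPreserving γ) :
    connectionPreservingBracket γ (ξ + ξ') ζ =
      connectionPreservingBracket γ ξ ζ + connectionPreservingBracket γ ξ' ζ := by
  have : CompleteSpace EX := FiniteDimensional.complete ℝ EX
  have : CompleteSpace EP := FiniteDimensional.complete ℝ EP
  refine Subtype.ext (Prod.ext (Gerbe.VectorField.mlieBracket_add_left ξ.2.1 ξ'.2.1)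
    (Prod.ext (Gerbe.VectorField.mlieBracket_add_left ξ.2.2.1 ξ'.2.2.1) ?_))
  change lieD (ξ.1.1 + ξ'.1.1) ζ.1.2.2 - lieD ζ.1.1 (ξ.1.2.2 + ξ'.1.2.2) =
    lieD ξ.1.1 ζ.1.2.2 - lieD ζ.1.1 ξ.1.2.2 + (lieD ξ'.1.1 ζ.1.2.2 - lieD ζ.1.1 ξ'.1.2.2)
  rw [lieD_add ξ.2.1 ξ'.2.1 ζ.2.2.2.1, lieD_form_add ζ.2.1 ξ.2.2.2.1 ξ'.2.2.2.1,
    add_sub_add_comm]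

theorem connectionPreservingBracket_smul_left (c : ℝ) (ξ ζ : connectionPreserving γ) :
    connectionPreservingBracket γ (c • ξ) ζ = c • connectionPreservingBracket γ ξ ζ := by
  have : CompleteSpace EX := FiniteDimensional.complete ℝ EX
  have : CompleteSpace EP := FiniteDimensional.complete ℝ EP
  refine Subtype.ext (Prod.ext (Gerbe.VectorField.mlieBracket_smul_left ξ.2.1 c)
    (Prod.ext (Gerbe.VectorField.mlieBracket_smul_left ξ.2.2.1 c) ?_))
  change lieD (c • ξ.1.1) ζ.1.2.2 - lieD ζ.1.1 (c • ξ.1.2.2) =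
    c • (lieD ξ.1.1 ζ.1.2.2 - lieD ζ.1.1 ξ.1.2.2)
  rw [lieD_smul, lieD_form_smul, smul_sub]

/-- The bracket of the Lie algebra of connection preserving multiplicative vector fields, as a
bilinear map. -/
def vectorFieldBracket :
    connectionPreserving γ →ₗ[ℝ] connectionPreserving γ →ₗ[ℝ] connectionPreserving γ :=
  LinearMap.mk₂ ℝ (connectionPreservingBracket γ) (connectionPreservingBracket_add_left γ)
    (connectionPreservingBracket_smul_left γ)
    (add_right_of_skew (L₀ := connectionPreserving γ) (connectionPreservingBracket_skew γ)
      (connectionPreservingBracket_add_left γ))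
    (smul_right_of_skew (L₀ := connectionPreserving γ) (connectionPreservingBracket_skew γ)
      (connectionPreservingBracket_smul_left γ))

/-- The action of the connection preserving multiplicative vector fields on the sections of the
Lie algebroid. -/
def sectionBracket :
    connectionPreserving γ →ₗ[ℝ] G.algebroidSection →ₗ[ℝ] G.algebroidSection :=
  have : CompleteSpace EX := FiniteDimensional.complete ℝ EX
  have : CompleteSpace EP := FiniteDimensional.complete ℝ EP
  LinearMap.mk₂ ℝ
    (fun ξ a => ⟨G.bracketSection ξ.1.2.1 a.1,
      G.bracketSection_mem ξ.2.1 ξ.2.2.1 ξ.2.2.2.2.1 a.2⟩)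
    (fun ξ ξ' a => Subtype.ext (funext fun x =>
      congrFun (Gerbe.VectorField.mlieBracket_add_left ξ.2.2.1 ξ'.2.2.1) (G.unit x)))
    (fun c ξ a => Subtype.ext (funext fun x =>
      congrFun (Gerbe.VectorField.mlieBracket_smul_left ξ.2.2.1 c) (G.unit x)))
    (fun ξ a b => Subtype.ext (funext fun x => by
      change mlieBracket 𝓘(ℝ, EP) ξ.1.2.1 (G.rightField (a.1 + b.1)) (G.unit x) = _
      rw [G.rightField_add, Gerbe.VectorField.mlieBracket_add_right (G.rightField_mem a.2)
        (G.rightField_mem b.2)]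
      rfl))
    (fun c ξ a => Subtype.ext (funext fun x => by
      change mlieBracket 𝓘(ℝ, EP) ξ.1.2.1 (G.rightField (c • a.1)) (G.unit x) = _
      rw [G.rightField_smul, Gerbe.VectorField.mlieBracket_smul_right (G.rightField_mem a.2)]
      rfl))

/-- The vector field components are the usual Jacobi identity. In the form component each Lie
derivative along a bracket expands to a commutator, and the cyclic sum cancels. -/
theorem vectorFieldBracket_jacobi (ξ ζ χ : connectionPreserving γ) :
    vectorFieldBracket γ ξ (vectorFieldBracket γ ζ χ) +
      vectorFieldBracket γ ζ (vectorFieldBracket γ χ ξ) +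
      vectorFieldBracket γ χ (vectorFieldBracket γ ξ ζ) = 0 := by
  have : CompleteSpace EX := FiniteDimensional.complete ℝ EX
  have : CompleteSpace EP := FiniteDimensional.complete ℝ EP
  refine Subtype.ext (Prod.ext (mlieBracket_jacobi ξ.2.1 ζ.2.1 χ.2.1)
    (Prod.ext (mlieBracket_jacobi ξ.2.2.1 ζ.2.2.1 χ.2.2.1) ?_))
  obtain ⟨⟨x, p, α⟩, hx, hp, hα, -, -⟩ := ξ
  obtain ⟨⟨y, q, β⟩, hy, hq, hβ, -, -⟩ := ζ
  obtain ⟨⟨z, r, ε⟩, hz, hr, hε, -, -⟩ := χ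
  change lieD x (lieD y ε - lieD z β) - lieD (mlieBracket 𝓘(ℝ, EX) y z) α +
    (lieD y (lieD z α - lieD x ε) - lieD (mlieBracket 𝓘(ℝ, EX) z x) β) +
    (lieD z (lieD x β - lieD y α) - lieD (mlieBracket 𝓘(ℝ, EX) x y) ε) = 0
  rw [lieD_mlieBracket hα hy hz, lieD_mlieBracket hβ hz hx, lieD_mlieBracket hε hx hy,
    lieD_form_sub hx (lieD_mem hε hy) (lieD_mem hβ hz),
    lieD_form_sub hy (lieD_mem hα hz) (lieD_mem hε hx),
    lieD_form_sub hz (lieD_mem hβ hx) (lieD_mem hα hy)]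
  abel

/-- The right-invariant extension of a bracket section is the bracket itself, so iterating the
action iterates the bracket on `P`; the Leibniz identity restricted to the units gives the claim. -/
theorem sectionBracket_vectorFieldBracket (ξ ζ : connectionPreserving γ)
    (a : G.algebroidSection) :
    sectionBracket γ (vectorFieldBracket γ ξ ζ) a =
      sectionBracket γ ξ (sectionBracket γ ζ a) - sectionBracket γ ζ (sectionBracket γ ξ a) := by
  have : CompleteSpace EX := FiniteDimensional.complete ℝ EX
  have : CompleteSpace EP := FiniteDimensional.complete ℝ EP
  obtain ⟨hx, hp, -, h1, -⟩ := ξ.2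
  obtain ⟨hz, hr, -, h2, -⟩ := ζ.2
  refine Subtype.ext (funext fun y => ?_)
  have h := congrFun (leibniz_mlieBracket hp hr (G.rightField_mem a.2)) (G.unit y)
  change mlieBracket 𝓘(ℝ, EP) (mlieBracket 𝓘(ℝ, EP) ξ.1.2.1 ζ.1.2.1) (G.rightField a.1)
    (G.unit y) = mlieBracket 𝓘(ℝ, EP) ξ.1.2.1 (G.rightField (G.bracketSection ζ.1.2.1 a.1))
      (G.unit y) - mlieBracket 𝓘(ℝ, EP) ζ.1.2.1 (G.rightField (G.bracketSection ξ.1.2.1 a.1))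
      (G.unit y)
  rw [G.rightField_bracketSection hx hp h1 a.2, G.rightField_bracketSection hz hr h2 a.2, h]
  exact (add_sub_cancel_right _ _).symm

/-- The strict Lie 2-algebra of connection preserving multiplicative vector fields. -/
def lieTwoAlgebra {B : DiffForm EX X 2} (hB : IsCurving γ B) :
    StrictLieTwoAlgebra G.algebroidSection (connectionPreserving γ) :=
  have : CompleteSpace EX := FiniteDimensional.complete ℝ EX
  have : CompleteSpace EP := FiniteDimensional.complete ℝ EP
  .ofAction (differential γ hB) (vectorFieldBracket γ) (sectionBracket γ)
    (connectionPreservingBracket_skew γ) (vectorFieldBracket_jacobi γ)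
    (sectionBracket_vectorFieldBracket γ)
    (fun ξ a => by
      obtain ⟨hx, hp, hα, h1, h2⟩ := ξ.2
      exact Subtype.ext (Prod.ext (G.anchor_bracketSection hx hp h1 a.2)
        (Prod.ext (G.barField_bracketSection hx hp h1 a.2)
          (G.algebroidForm_bracketSection γ.form.2 hx hp h1 a.2 hα h2))))
    (fun a b => Subtype.ext (G.bracketSection_barField a.2 b.2))

end BundleGerbe

end Gerbe

end

open Gerbe in
theorem proposition2p6
    {EM EX EP M X P : Type*}
    [NormedAddCommGroup EM] [NormedSpace ℝ EM] [FiniteDimensional ℝ EM]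
    [TopologicalSpace M] [T2Space M] [SecondCountableTopology M]
    [ChartedSpace EM M] [IsManifold 𝓘(ℝ, EM) ∞ M]
    [NormedAddCommGroup EX] [NormedSpace ℝ EX] [FiniteDimensional ℝ EX]
    [TopologicalSpace X] [T2Space X] [SecondCountableTopology X]
    [ChartedSpace EX X] [IsManifold 𝓘(ℝ, EX) ∞ X]
    [NormedAddCommGroup EP] [NormedSpace ℝ EP] [FiniteDimensional ℝ EP]
    [TopologicalSpace P] [T2Space P] [SecondCountableTopology P]
    [ChartedSpace EP P] [IsManifold 𝓘(ℝ, EP) ∞ P]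
    [MulAction Circle P]
    (G : BundleGerbe EM EX EP M X P) (γ : G.Connection) :
    (∃ B : DiffForm EX X 2, BundleGerbe.IsCurving γ B) ∧
    ∃ L : StrictLieTwoAlgebra G.algebroidSection (BundleGerbe.connectionPreserving γ),
      (∀ B : DiffForm EX X 2, BundleGerbe.IsCurving γ B → ∀ a : G.algebroidSection,
        (L.d a).1 = (G.anchor a.1, G.barField a.1,
          contract (G.anchor a.1) B.1 - extD (BundleGerbe.vFun γ a.1))) ∧
      (∀ ξ ζ : BundleGerbe.connectionPreserving γ,
        (L.bracket₀ ξ ζ).1 =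
          (VectorField.mlieBracket 𝓘(ℝ, EX) ξ.1.1 ζ.1.1,
            VectorField.mlieBracket 𝓘(ℝ, EP) ξ.1.2.1 ζ.1.2.1,
            lieD ξ.1.1 ζ.1.2.2 - lieD ζ.1.1 ξ.1.2.2)) ∧
      (∀ (ξ : BundleGerbe.connectionPreserving γ) (a : G.algebroidSection),
        (L.bracket₀₁ ξ a).1 =
          fun x => VectorField.mlieBracket 𝓘(ℝ, EP) ξ.1.2.1 (G.rightField a.1) (G.unit x)) ∧
      (∀ (ξ : BundleGerbe.connectionPreserving γ) (a : G.algebroidSection),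
        L.bracket₀₁ ξ a = -L.bracket₁₀ a ξ) := by
  obtain ⟨B, hB⟩ := BundleGerbe.exists_isCurving γ
  have : CompleteSpace EX := FiniteDimensional.complete ℝ EX
  have : CompleteSpace EP := FiniteDimensional.complete ℝ EP
  refine ⟨⟨B, hB⟩, BundleGerbe.lieTwoAlgebra γ hB, fun B' hB' a => ?_, fun ξ ζ => rfl,
    fun ξ a => rfl, fun ξ a => (neg_neg _).symm⟩
  -- Any curving `B'` yields the same form `-ε^* L_{→a} γ`, so the structure built from the
  -- particular `B` satisfies the formula for all of them.
  exact Prod.ext rfl (Prod.ext rfl (G.contract_curving_sub_extD γ.form.2 a.2 hB').symm)
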